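/- Let $K=\mathbb F_q\subseteq E=\mathbb F_{q^d}$ with $d\ge 2$ and $q$ a power of the prime $p$, and let $\sigma$ generate $\mathrm{Gal}(E/K)$; extend $\sigma$ to $E(Y)$ and $E((Y))$ by acting on coefficients. Let $\mathcal A=(E(Y),\sigma,1+Y)$ be the cyclic $K(Y)$-algebra generated by $E(Y)$ and an element $t$ with $t^d=1+Y$ and $tb=\sigma(b)t$ for $b\in E(Y)$. Let $\mathcal A_0$ be the $E[Y^{-1}]$-span of $1,t,\dots,t^{d-1}$, and put $\widetilde\Gamma=\{\gamma\in\mathrm{Aut}_{K(Y)}(\mathcal A) : \gamma(\mathcal A_0)\subseteq\mathcal A_0\}$. Choose $x\in E((Y))$ with $\prod_{k<d}\sigma^k(x)=1+Y$ and a $K((Y))$-basis of $E((Y))$. The homomorphism $\Psi:\mathcal A\to\mathrm{End}_{K((Y))}(E((Y)))$, in which $b\in E(Y)$ acts by multiplication and $t$ acts as $y\mapsto x\,\sigma(y)$, then induces (every automorphism of $\mathcal A$ being inner) an embedding of $\widetilde\Gamma$ in $G=\mathrm{PGL}_d(K((Y)))$, and $\widetilde\Gamma$ is identified with its image, which is a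 subgroup of $G$. Let $\Delta$ be the building of $G$; its vertices are the homothety classes of $K[[Y]]$-lattices in $K((Y))^d$, and $v_0$ denotes the class of $K[[Y]]^d$. A Singer cycle of $\mathrm{GL}_d(q)$ is a cyclic subgroup acting simply transitively on the nonzero vectors of $\mathbb F_q^d$; a Singer cycle of $\mathrm{PGL}_d(q)$ is the image of one of these. Let $v$ be any vertex of $\Delta$, let $G_v$ be its stabiliser in $G$, and let $H=\widetilde\Gamma_v=\widetilde\Gamma\cap G_v$. Then there is $g\in G$ with $gv_0=v$ such that: 1. $H\le G_v$, and $h\mapsto g^{-1}hg$ is an isomorphism $G_v\cong\mathrm{PGL}_d(\mathbb F_q[[Y]])$; 2. there is a Singer cycle $S_0$ of $\mathrm{PGL}_d(q)\subseteq\mathrm{PGL}_d(\mathbb F_q[[Y]])$ such that $S=gS_0g^{-1}$ is a cyclic normal subgroup of $H$ of order $\frac{q^d-1}{q-1}$; 3. $H\cong N_{\mathrm{PGL}_d(q)}(S_0)$; 4. identifying $\mathrm{PSL}_d(K((Y)))$ with a subgroup of $G$, $$|H\cap\mathrm{PSL}_d(K((Y)))|=\frac{d}{\mathrm{Ord}_p(d)}\cdot\frac{q^d-1}{(q-1)(d,q-1)},$$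 where $\mathrm{Ord}_p(d)$ is the largest power of $p$ dividing $d$. -/

import Mathlib

open scoped LaurentSeries

noncomputable section

namespace CartwrightSteger

/-! ### Cyclic algebras -/

section CyclicAlgebra

variable {F L : Type*} [Field F] [Field L]

/-- The defining relations of the cyclic algebra `(L, σ, a)` of degree `d` over `F`, where `F` is
embedded in `L` by `i`.  The generator `some b` stands for the element `b` of `L`, and `none` for
the extra generator `t`. -/
inductive CyclicAlgebra.Rel (i : F →+* L) (σ : L →+* L) (a : F) (d : ℕ) :
    FreeAlgebra F (Option L) → FreeAlgebra F (Option L) → Prop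
  | add (b c : L) : CyclicAlgebra.Rel i σ a d
      (FreeAlgebra.ι F (some (b + c))) (FreeAlgebra.ι F (some b) + FreeAlgebra.ι F (some c))
  | mul (b c : L) : CyclicAlgebra.Rel i σ a d
      (FreeAlgebra.ι F (some (b * c))) (FreeAlgebra.ι F (some b) * FreeAlgebra.ι F (some c))
  | base (c : F) : CyclicAlgebra.Rel i σ a d
      (FreeAlgebra.ι F (some (i c))) (algebraMap F (FreeAlgebra F (Option L)) c)
  | pow : CyclicAlgebra.Rel i σ a d
      (FreeAlgebra.ι F none ^ d) (algebraMap F (FreeAlgebra F (Option L)) a)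
  | twist (b : L) : CyclicAlgebra.Rel i σ a d
      (FreeAlgebra.ι F none * FreeAlgebra.ι F (some b))
      (FreeAlgebra.ι F (some (σ b)) * FreeAlgebra.ι F none)

/-- The cyclic algebra `(L, σ, a)`: the `F`-algebra generated by `L` and an element `t` subject to
`t ^ d = a` and `t * b = σ b * t` for `b ∈ L`. -/
def CyclicAlgebra (i : F →+* L) (σ : L →+* L) (a : F) (d : ℕ) : Type _ :=
  RingQuot (CyclicAlgebra.Rel i σ a d)

namespace CyclicAlgebra

variable (i : F →+* L) (σ : L →+* L) (a : F) (d : ℕ)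

instance : Ring (CyclicAlgebra i σ a d) :=
  inferInstanceAs (Ring (RingQuot (CyclicAlgebra.Rel i σ a d)))

instance : Algebra F (CyclicAlgebra i σ a d) :=
  inferInstanceAs (Algebra F (RingQuot (CyclicAlgebra.Rel i σ a d)))

/-- The element of the cyclic algebra given by an element of the field `L`. -/
def of (b : L) : CyclicAlgebra i σ a d :=
  RingQuot.mkAlgHom F (CyclicAlgebra.Rel i σ a d) (FreeAlgebra.ι F (some b))

/-- The generator `t` of the cyclic algebra. -/
def t : CyclicAlgebra i σ a d :=
  RingQuot.mkAlgHom F (CyclicAlgebra.Rel i σ a d) (FreeAlgebra.ι F none)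

/-- The ring homomorphism out of the cyclic algebra determined by the images `φ` of `L` and `τ` of
`t`. -/
def lift {R : Type*} [Ring R] (φ : L →+* R) (τ : R)
    (hc : ∀ (c : F) (x : R), φ (i c) * x = x * φ (i c)) (hτ : τ ^ d = φ (i a))
    (htw : ∀ b, τ * φ b = φ (σ b) * τ) : CyclicAlgebra i σ a d →+* R :=
  letI : Algebra F R := (φ.comp i).toAlgebra' hc
  (RingQuot.liftAlgHom F (s := CyclicAlgebra.Rel i σ a d)
    ⟨FreeAlgebra.lift F (fun o : Option L => o.elim τ φ), by
      intro x y h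
      induction h with
      | add b c => simp
      | mul b c => simp
      | base c => simp; rfl
      | pow => simp; exact hτ
      | twist b => simpa using htw b⟩).toRingHom

theorem lift_of {R : Type*} [Ring R] (φ : L →+* R) (τ : R) (hc) (hτ) (htw) (b : L) :
    lift i σ a d φ τ hc hτ htw (of i σ a d b) = φ b := by
  let _ : Algebra F R := (φ.comp i).toAlgebra' hc
  exact (RingQuot.liftAlgHom_mkAlgHom_apply F _ _ _).trans (FreeAlgebra.lift_ι_apply _ _)

theorem lift_t {R : Type*} [Ring R] (φ : L →+* R) (τ : R) (hc) (hτ) (htw) :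
    lift i σ a d φ τ hc hτ htw (t i σ a d) = τ := by
  let _ : Algebra F R := (φ.comp i).toAlgebra' hc
  exact (RingQuot.liftAlgHom_mkAlgHom_apply F _ _ _).trans (FreeAlgebra.lift_ι_apply _ _)

end CyclicAlgebra

end CyclicAlgebra

/-! ### Rational functions and Laurent series -/

section Series

/-- The map `K(Y) → E(Y)` applying a field homomorphism to the coefficients. -/
def ratMap {K E : Type*} [Field K] [Field E] (f : K →+* E) : RatFunc K →+* RatFunc E :=
  RatFunc.mapRingHom (Polynomial.mapRingHom f)
    (nonZeroDivisors_le_comap_nonZeroDivisors_of_injective _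
      (Polynomial.map_injective f f.injective))

/-- The map `K((Y)) → E((Y))` applying a field homomorphism to the coefficients. -/
def laurentMap {K E : Type*} [Field K] [Field E] (f : K →+* E) : K⸨X⸩ →+* E⸨X⸩ where
  toFun x := HahnSeries.map x f
  map_one' := HahnSeries.map_one f.toMonoidWithZeroHom
  map_mul' _ _ := HahnSeries.map_mul f.toNonUnitalRingHom
  map_zero' := by ext; simp
  map_add' x y := by ext; simp

theorem laurentMap_coeff {K E : Type*} [Field K] [Field E] (f : K →+* E) (x : K⸨X⸩) (n : ℤ) :
    (laurentMap f x).coeff n = f (x.coeff n) := rfl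

/-- The expansion of rational functions as Laurent series, `E(Y) → E((Y))`. -/
def ratToLaurent (E : Type*) [Field E] : RatFunc E →+* E⸨X⸩ :=
  IsFractionRing.lift (A := Polynomial E) (FaithfulSMul.algebraMap_injective (Polynomial E) E⸨X⸩)

theorem ratMap_algebraMap {K E : Type*} [Field K] [Field E] (f : K →+* E) (P : Polynomial K) :
    ratMap f (algebraMap _ (RatFunc K) P) = algebraMap _ (RatFunc E) (P.map f) := by
  have h := RatFunc.map_apply_div_ne_zero (Polynomial.mapRingHom f)
    (nonZeroDivisors_le_comap_nonZeroDivisors_of_injective _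
      (Polynomial.map_injective f f.injective)) P 1 one_ne_zero
  simp only [map_one, div_one] at h
  exact h

theorem ratToLaurent_algebraMap {E : Type*} [Field E] (P : Polynomial E) :
    ratToLaurent E (algebraMap _ (RatFunc E) P) = algebraMap (Polynomial E) E⸨X⸩ P :=
  IsFractionRing.lift_algebraMap _ _

theorem algebraMap_C_laurent {E : Type*} [Field E] (c : E) :
    algebraMap (Polynomial E) E⸨X⸩ (Polynomial.C c) = HahnSeries.single 0 c := by
  simp [Polynomial.algebraMap_hahnSeries_apply]

theorem algebraMap_X_laurent {E : Type*} [Field E] :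
    algebraMap (Polynomial E) E⸨X⸩ Polynomial.X = HahnSeries.single 1 1 := by
  simp [Polynomial.algebraMap_hahnSeries_apply]

theorem laurentMap_single {K E : Type*} [Field K] [Field E] (f : K →+* E) (n : ℤ) (c : K) :
    laurentMap f (HahnSeries.single n c) = HahnSeries.single n (f c) := by
  ext m
  by_cases h : m = n <;> simp [laurentMap_coeff, h]

theorem ratToLaurent_X {E : Type*} [Field E] :
    ratToLaurent E RatFunc.X = HahnSeries.single 1 1 := by
  rw [← RatFunc.algebraMap_X, ratToLaurent_algebraMap, algebraMap_X_laurent]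

theorem ratToLaurent_ratMap {K E : Type*} [Field K] [Field E] (f : K →+* E) (x : RatFunc K) :
    ratToLaurent E (ratMap f x) = laurentMap f (ratToLaurent K x) := by
  suffices h : (ratToLaurent E).comp (ratMap f) = (laurentMap f).comp (ratToLaurent K) from
    congrArg (fun g : RatFunc K →+* E⸨X⸩ => g x) h
  refine IsLocalization.ringHom_ext (nonZeroDivisors (Polynomial K)) ?_
  refine Polynomial.ringHom_ext (fun c => ?_) ?_
  · simp only [RingHom.comp_apply, ratMap_algebraMap, ratToLaurent_algebraMap, Polynomial.map_C,
      algebraMap_C_laurent, laurentMap_single]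
  · simp only [RingHom.comp_apply, ratMap_algebraMap, ratToLaurent_algebraMap, Polynomial.map_X,
      algebraMap_X_laurent, laurentMap_single, map_one]

instance laurentAlgebra {K E : Type*} [Field K] [Field E] [Algebra K E] :
    Algebra K⸨X⸩ E⸨X⸩ :=
  (laurentMap (algebraMap K E)).toAlgebra

end Series

/-! ### The algebra `𝒜`, its matrix representation and the lattice `Γ̃` -/

section Lattice

variable (K : Type*) {E : Type*} [Field K] [Field E] [Algebra K E] (σ : E ≃ₐ[K] E) (d : ℕ)

/-- The cyclic algebra `𝒜 = (E(Y), σ, 1 + Y)` over `K(Y)`. -/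
abbrev AlgA : Type _ :=
  CyclicAlgebra (ratMap (algebraMap K E)) (ratMap (σ : E →+* E)) (1 + RatFunc.X : RatFunc K) d

/-- The embedding of `E(Y)` in `𝒜`. -/
abbrev AlgA.of (f : RatFunc E) : AlgA K σ d :=
  CyclicAlgebra.of (ratMap (algebraMap K E)) (ratMap (σ : E →+* E)) (1 + RatFunc.X : RatFunc K) d f

/-- The generator `t` of `𝒜`. -/
abbrev AlgA.t : AlgA K σ d :=
  CyclicAlgebra.t (ratMap (algebraMap K E)) (ratMap (σ : E →+* E)) (1 + RatFunc.X : RatFunc K) d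

/-- The `E[Y⁻¹]`-span `𝒜₀` of the elements `t ^ m`, `m < d`, in `𝒜`. -/
def AlgA.zero : Set (AlgA K σ d) :=
  {x | ∃ f : Fin d → RatFunc E, (∀ m, f m ∈ Algebra.adjoin E {(RatFunc.X : RatFunc E)⁻¹}) ∧
    x = ∑ m : Fin d, AlgA.of K σ d (f m) * AlgA.t K σ d ^ (m : ℕ)}

/-- The group `Γ̃`, as a set of automorphisms of the `K(Y)`-algebra `𝒜`. -/
def gammaTildeAut : Set (AlgA K σ d ≃ₐ[RatFunc K] AlgA K σ d) :=
  {γ | ∀ x ∈ AlgA.zero K σ d, γ x ∈ AlgA.zero K σ d}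

variable {K}

/-- The automorphism `σ` of `E((Y))`, acting on coefficients, as a `K((Y))`-linear map. -/
def sigmaLin : E⸨X⸩ →ₗ[K⸨X⸩] E⸨X⸩ where
  toFun := laurentMap (σ : E →+* E)
  map_add' := map_add _
  map_smul' c x := by
    have h : laurentMap (σ : E →+* E) (laurentMap (algebraMap K E) c)
        = laurentMap (algebraMap K E) c := by
      ext n
      simp [laurentMap_coeff]
    rw [Algebra.smul_def, Algebra.smul_def, map_mul]
    exact congrArg (· * _) h

theorem sigmaLin_pow_coeff (k : ℕ) (x : E⸨X⸩) (n : ℤ) :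
    ((sigmaLin σ ^ k) x).coeff n = (σ ^ k) (x.coeff n) := by
  induction k generalizing x with
  | zero => simp
  | succ k ih => rw [pow_succ, Module.End.mul_apply, ih, pow_succ]; rfl

theorem sigmaLin_mul (x y : E⸨X⸩) :
    sigmaLin σ (x * y) = sigmaLin σ x * sigmaLin σ y :=
  map_mul (laurentMap (σ : E →+* E)) x y

theorem sigmaLin_pow_mul (k : ℕ) (x y : E⸨X⸩) :
    (sigmaLin σ ^ k) (x * y) = (sigmaLin σ ^ k) x * (sigmaLin σ ^ k) y := by
  induction k generalizing x y with
  | zero => simp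
  | succ k ih => simp only [pow_succ, Module.End.mul_apply, sigmaLin_mul, ih]

theorem sigmaLin_pow_eq_one (hσ : σ ^ d = 1) : sigmaLin σ ^ d = 1 := by
  ext x n
  rw [sigmaLin_pow_coeff, hσ]
  simp

/-- The norm `N(x) = ∏_{k < d} σ^k(x)` on `E((Y))`. -/
def laurentNorm (x : E⸨X⸩) : E⸨X⸩ :=
  ∏ k ∈ Finset.range d, (sigmaLin σ ^ k) x

/-- The homomorphism `Ψ : 𝒜 → End_{K((Y))}(E((Y)))`, `Ψ(∑ a_j t^j) b = ∑ a_j x^j σ^j(b)`, attached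
to a solution `x` of `N(x) = 1 + Y`. -/
def Psi (hσ : σ ^ d = 1) (x : E⸨X⸩) (hx : laurentNorm σ d x = 1 + HahnSeries.single 1 1) :
    AlgA K σ d →+* Module.End K⸨X⸩ E⸨X⸩ :=
  CyclicAlgebra.lift _ _ _ _
    ((Algebra.lmul K⸨X⸩ E⸨X⸩).toRingHom.comp (ratToLaurent E))
    (LinearMap.mulLeft K⸨X⸩ x * sigmaLin σ)
    (by
      intro c f
      ext y
      have h : ratToLaurent E (ratMap (algebraMap K E) c) = algebraMap K⸨X⸩ E⸨X⸩ (ratToLaurent K c) :=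
        ratToLaurent_ratMap _ _
      simp [h, ← Algebra.smul_def])
    (by
      have key : ∀ (n : ℕ) (y : E⸨X⸩), ((LinearMap.mulLeft K⸨X⸩ x * sigmaLin σ) ^ n) y
          = (∏ k ∈ Finset.range n, (sigmaLin σ ^ k) x) * (sigmaLin σ ^ n) y := by
        intro n
        induction n with
        | zero => intro y; simp
        | succ n ih =>
          intro y
          rw [pow_succ, Module.End.mul_apply, ih, Finset.prod_range_succ, Module.End.mul_apply,
            LinearMap.mulLeft_apply, sigmaLin_pow_mul, pow_succ, Module.End.mul_apply, mul_assoc]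
      refine LinearMap.ext fun y => ?_
      rw [key, sigmaLin_pow_eq_one σ d hσ]
      change laurentNorm σ d x * y = ratToLaurent E (ratMap (algebraMap K E) (1 + RatFunc.X)) * y
      rw [hx, ratToLaurent_ratMap, map_add, map_one (ratToLaurent K), map_add,
        map_one (laurentMap (algebraMap K E)), ratToLaurent_X, laurentMap_single,
        map_one (algebraMap K E)])
    (by
      intro f
      refine LinearMap.ext fun y => ?_
      have h := ratToLaurent_ratMap (σ : E →+* E) f
      change x * sigmaLin σ (ratToLaurent E f * y) =
        ratToLaurent E (ratMap (σ : E →+* E) f) * (x * sigmaLin σ y)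
      rw [h, sigmaLin_mul, mul_left_comm]
      rfl)

/-- The matrix form `𝒜 → M_d(K((Y)))` of `Ψ` in a `K((Y))`-basis `β` of `E((Y))`. -/
def psiMatrix (hσ : σ ^ d = 1) (x : E⸨X⸩) (hx : laurentNorm σ d x = 1 + HahnSeries.single 1 1)
    (β : Module.Basis (Fin d) K⸨X⸩ E⸨X⸩) :
    AlgA K σ d →+* Matrix (Fin d) (Fin d) K⸨X⸩ :=
  ((LinearMap.toMatrixAlgEquiv β : Module.End K⸨X⸩ E⸨X⸩ ≃ₐ[K⸨X⸩] _) : _ →+* _).comp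
    (Psi σ d hσ x hx)

/-- The image of `Γ̃` in `PGL_d(K((Y)))`: an automorphism of `𝒜`, being conjugation by a unit `y`,
is sent to the class of the matrix `Ψ(y)`. -/
def gammaTilde (hσ : σ ^ d = 1) (x : E⸨X⸩) (hx : laurentNorm σ d x = 1 + HahnSeries.single 1 1)
    (β : Module.Basis (Fin d) K⸨X⸩ E⸨X⸩) : Set (Matrix.ProjGenLinGroup (Fin d) K⸨X⸩) :=
  {g | ∃ γ ∈ gammaTildeAut K σ d, ∃ y : (AlgA K σ d)ˣ,
    (∀ z, γ z = y * z * (y⁻¹ : (AlgA K σ d)ˣ)) ∧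
    g = Matrix.ProjGenLinGroup.mk (Units.map (psiMatrix σ d hσ x hx β).toMonoidHom y)}

/-- In a cyclic extension of finite fields, `σ ^ [E : K] = 1`. -/
theorem pow_eq_one_of_finrank [Finite E] (hd : Module.finrank K E = d) : σ ^ d = 1 := by
  have : Finite K := Finite.of_injective _ (algebraMap K E).injective
  have : FiniteDimensional K E := Module.Finite.of_finite
  rw [← hd, ← IsGalois.card_aut_eq_finrank K E]
  exact pow_card_eq_one'

end Lattice

/-! ### Vertices of the building of `PGL_d(F((t)))` -/

section Building

variable (d : ℕ) (F : Type*) [Field F]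

/-- Lattices in `F((t))^d`: the `F[[t]]`-submodules which are finitely generated (hence free, of
rank `d`) and span `F((t))^d`. -/
def LatticeIn : Type _ :=
  {M : Submodule (PowerSeries F) (Fin d → F⸨X⸩) // M.IsLattice F⸨X⸩}

variable {d F}

/-- The `F[[t]]`-linear map of `F((t))^d` given by an invertible matrix. -/
def glLin (g : GL (Fin d) F⸨X⸩) : (Fin d → F⸨X⸩) →ₗ[PowerSeries F] (Fin d → F⸨X⸩) :=
  (Matrix.mulVecLin (g : Matrix (Fin d) (Fin d) F⸨X⸩)).restrictScalars (PowerSeries F)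

theorem glLin_one : glLin (1 : GL (Fin d) F⸨X⸩) = LinearMap.id := by
  ext; simp [glLin]

theorem glLin_mul (g h : GL (Fin d) F⸨X⸩) : glLin (g * h) = glLin g ∘ₗ glLin h := by
  refine LinearMap.ext fun v => ?_
  simp [glLin]

theorem isLattice_map (g : GL (Fin d) F⸨X⸩) (M : Submodule (PowerSeries F) (Fin d → F⸨X⸩))
    (hM : M.IsLattice F⸨X⸩) : (M.map (glLin g)).IsLattice F⸨X⸩ where
  fg := hM.fg.map _
  span_eq_top := by
    have h : ((M.map (glLin g) : Submodule (PowerSeries F) (Fin d → F⸨X⸩)) : Set (Fin d → F⸨X⸩))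
        = Matrix.mulVecLin (g : Matrix (Fin d) (Fin d) F⸨X⸩) '' (M : Set (Fin d → F⸨X⸩)) := rfl
    rw [h, Submodule.span_image, hM.span_eq_top, Submodule.map_top, LinearMap.range_eq_top]
    intro v
    refine ⟨Matrix.mulVec (g⁻¹ : GL (Fin d) F⸨X⸩) v, ?_⟩
    simp [Matrix.mulVec_mulVec, -Matrix.coe_units_inv]

/-- `GL_d(F((t)))` acts on lattices. -/
instance : MulAction (GL (Fin d) F⸨X⸩) (LatticeIn d F) where
  smul g M := ⟨M.1.map (glLin g), isLattice_map g M.1 M.2⟩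
  one_smul M := Subtype.ext <| by
    change M.1.map (glLin 1) = M.1
    rw [glLin_one, Submodule.map_id]
  mul_smul g h M := Subtype.ext <| by
    change M.1.map (glLin (g * h)) = (M.1.map (glLin h)).map (glLin g)
    rw [glLin_mul, Submodule.map_comp]

variable (d F)

/-- Lattices `L` and `L'` are equivalent if `L' = c L` for a nonzero scalar `c`. -/
instance homothety : Setoid (LatticeIn d F) where
  r L L' := ∃ c : (F⸨X⸩)ˣ, L' = Matrix.GeneralLinearGroup.scalar (Fin d) c • L
  iseqv := {
    refl := fun L => ⟨1, by simp⟩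
    symm := by
      rintro L L' ⟨c, rfl⟩
      exact ⟨c⁻¹, by simp⟩
    trans := by
      rintro L L' L'' ⟨c, rfl⟩ ⟨e, rfl⟩
      exact ⟨e * c, by simp [mul_smul]⟩ }

/-- The vertices of the building of `PGL_d(F((t)))`: the classes of lattices in `F((t))^d`. -/
def Vertex : Type _ := Quotient (homothety d F)

variable {d F}

theorem scalar_comm (c : (F⸨X⸩)ˣ) (g : GL (Fin d) F⸨X⸩) :
    g * Matrix.GeneralLinearGroup.scalar (Fin d) c =
      Matrix.GeneralLinearGroup.scalar (Fin d) c * g := by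
  have h : Matrix.GeneralLinearGroup.scalar (Fin d) c ∈ Subgroup.center (GL (Fin d) F⸨X⸩) := by
    rw [Matrix.GeneralLinearGroup.center_eq_range_scalar]
    exact ⟨c, rfl⟩
  exact Subgroup.mem_center_iff.mp h g

instance : MulAction (GL (Fin d) F⸨X⸩) (Vertex d F) where
  smul g := Quotient.map (g • ·) (by
    rintro L L' ⟨c, rfl⟩
    exact ⟨c, by simp only [← mul_smul, scalar_comm]⟩)
  one_smul := by
    rintro ⟨L⟩
    exact congrArg (Quotient.mk _) (one_smul _ L)
  mul_smul g h := by
    rintro ⟨L⟩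
    exact congrArg (Quotient.mk _) (mul_smul g h L)

/-- The action of `PGL_d(F((t)))` on the vertices of its building. -/
instance : MulAction (Matrix.ProjGenLinGroup (Fin d) F⸨X⸩) (Vertex d F) :=
  Matrix.ProjGenLinGroup.mulActionOfGL (by
    rintro u ⟨L⟩
    exact Quotient.sound ⟨u⁻¹, by simp⟩)

variable (d F)

/-- The standard lattice `F[[t]]^d`. -/
def stdLattice : LatticeIn d F :=
  ⟨Submodule.span (PowerSeries F) (Set.range (Pi.basisFun F⸨X⸩ (Fin d))),
    ⟨Submodule.fg_span (Set.finite_range _), by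
      rw [Submodule.span_span_of_tower, (Pi.basisFun F⸨X⸩ (Fin d)).span_eq]⟩⟩

/-- The standard vertex `v₀`, the class of `F[[t]]^d`. -/
def stdVertex : Vertex d F := Quotient.mk _ (stdLattice d F)

end Building

/-! ### Singer cycles -/

section Singer

variable {d : ℕ} {F : Type*} [Field F]

/-- Singer cycles of `GL_d(F)`: cyclic subgroups which act simply transitively on the nonzero
vectors of `F^d`. -/
def IsSingerGL (S : Subgroup (GL (Fin d) F)) : Prop :=
  IsCyclic S ∧ ∀ v w : Fin d → F, v ≠ 0 → w ≠ 0 →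
    ∃! s : S, ((s : GL (Fin d) F) : Matrix (Fin d) (Fin d) F).mulVec v = w

/-- Singer cycles of `PGL_d(F)`: images of Singer cycles of `GL_d(F)`. -/
def IsSingerPGL (S : Subgroup (Matrix.ProjGenLinGroup (Fin d) F)) : Prop :=
  ∃ S' : Subgroup (GL (Fin d) F), IsSingerGL S' ∧ S = S'.map Matrix.ProjGenLinGroup.mk

end Singer

end CartwrightSteger

end

/-! Write `L = E[[Y]]`. In a basis of `E((Y))` coming from a `K`-basis of `E` this is the standard
lattice. Since the norm of `x` is the unit `1 + Y`, the series `x` is a unit of `E[[Y]]`, so `t`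
maps `L` onto itself.

Transitivity. The units `w ∈ Eˣ`, `t`, `1 - t` and `Y` of `𝒜` normalise `𝒜₀`. For `1 - t`, the
identity `(1 - t) ∑ t ^ k = 1 - t ^ d = -Y` gives the inverse and shows `Y L ⊆ (1 - t) L`. Modulo
`Y`, `1 - t` becomes `c ↦ c - x₀ σ(c)`, whose kernel is at most a line, so its image contains a
hyperplane. Every nonzero functional on `E` is an `Eˣ`-translate of any other, so for each
hyperplane some `u (1 - t) L` contains its preimage in `L`. An integral matrix with non-unit
determinant therefore has a left factor `u (1 - t)`, and induction on the valuation of the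
determinant yields `GL_d(K((Y))) = Ψ(units normalising 𝒜₀) · GL_d(K[[Y]])` (`exists_eq_psiGL_mul`).
Hence all vertex stabilisers are conjugate to that of `v₀`.

The stabiliser of `v₀`. A unit `y` that normalises `𝒜₀` and fixes the class of `L` preserves `V = 𝒜₀
∩ End(L)`, which is `⊕ E t ^ m` because `E[Y⁻¹] ∩ E[[Y]] = E`. Inside `V`, the elements with `v V ⊆
V` are exactly those of `E`, so conjugation by `y` acts on `E` as some `σ ^ j`. Then `y t ^ (-j)`
centralises `E`, hence acts as multiplication by a series `f`; conjugating `t` shows `f = c σ(f)`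
with `c ∈ E`, so `f ∈ Eˣ K((Y))ˣ`. The stabiliser thus consists of the classes of `w t ^ j`
(`exists_eq_smul_of_conj`, `exists_eq_monomialUnit`).

Structure and order. Reduction modulo `Y` sends `w t ^ j` to `c ↦ w' σ ^ j(c)`, with `w'` equal to
`w` times the constant term of a partial norm. This is an isomorphism onto the semilinear group of
`E` modulo scalars, the normaliser of the Singer cycle `Eˣ / Kˣ`. Finally `det Ψ(w t ^ j) = N(w) ε ^
j (1 + Y) ^ j` for some `ε ∈ Kˣ`. The class lies in `PSL` exactly when this is a `d`-th power, i.e.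
when the `p`-part of `d` divides `j` and `N(w) ε ^ j` is a `d`-th power in `K`. Counting uses
surjectivity of the norm. -/

noncomputable section

namespace CartwrightSteger

/-! ### Power series inside Laurent series. -/

section Integers

variable {F : Type*} [Field F]

variable (F) in
/-- The subring `F[[t]]` of `F((t))`. -/
def integers : Subring F⸨X⸩ := (algebraMap (PowerSeries F) F⸨X⸩).range

theorem mem_integers_iff {f : F⸨X⸩} : f ∈ integers F ↔ ∀ n < 0, f.coeff n = 0 := by
  constructor
  · rintro ⟨g, rfl⟩ n hn
    rw [LaurentSeries.coe_algebraMap]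
    have := PowerSeries.coeff_coe g n
    simpa [hn] using this
  · intro h
    refine ⟨PowerSeries.mk fun n => f.coeff n, ?_⟩
    ext n
    rw [LaurentSeries.coe_algebraMap, PowerSeries.coeff_coe]
    split_ifs with hn
    · exact (h n hn).symm
    · simp [abs_of_nonneg (not_lt.mp hn)]

theorem coeff_zero_algebraMap (g : PowerSeries F) :
    (algebraMap (PowerSeries F) F⸨X⸩ g).coeff 0 = PowerSeries.constantCoeff g := by
  rw [LaurentSeries.coe_algebraMap, PowerSeries.coeff_coe]
  simp

theorem coeff_zero_mul {f g : F⸨X⸩} (hf : f ∈ integers F) (hg : g ∈ integers F) :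
    (f * g).coeff 0 = f.coeff 0 * g.coeff 0 := by
  obtain ⟨f, rfl⟩ := hf
  obtain ⟨g, rfl⟩ := hg
  rw [← map_mul, coeff_zero_algebraMap, coeff_zero_algebraMap, coeff_zero_algebraMap, map_mul]

theorem coeff_zero_prod {ι : Type*} (s : Finset ι) (f : ι → F⸨X⸩) (hf : ∀ i ∈ s, f i ∈ integers F) :
    (∏ i ∈ s, f i).coeff 0 = ∏ i ∈ s, (f i).coeff 0 := by
  classical
  induction s using Finset.induction_on with
  | empty => simp
  | insert a s ha ih =>
    rw [Finset.prod_insert ha, Finset.prod_insert ha, coeff_zero_mul (hf a (by simp))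
      (prod_mem fun i hi => hf i (by simp [hi])), ih fun i hi => hf i (by simp [hi])]

theorem inv_mem_integers {f : F⸨X⸩} (hf : f ∈ integers F) (h0 : f.coeff 0 ≠ 0) :
    f⁻¹ ∈ integers F := by
  obtain ⟨g, rfl⟩ := hf
  rw [coeff_zero_algebraMap] at h0
  refine ⟨g⁻¹, ?_⟩
  refine eq_inv_of_mul_eq_one_left ?_
  rw [← map_mul, PowerSeries.inv_mul_cancel _ h0, map_one]

theorem single_mem_integers (c : F) {n : ℤ} (hn : 0 ≤ n) : HahnSeries.single n c ∈ integers F := by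
  rw [mem_integers_iff]
  intro m hm
  exact HahnSeries.coeff_single_of_ne (by omega)

/-- Series with constant term zero are divisible by the uniformizer. -/
theorem exists_eq_single_mul {f : F⸨X⸩} (hf : f ∈ integers F) (h0 : f.coeff 0 = 0) :
    ∃ g ∈ integers F, f = HahnSeries.single 1 1 * g := by
  refine ⟨HahnSeries.single (-1) 1 * f, ?_, ?_⟩
  · rw [mem_integers_iff] at hf ⊢
    intro n hn
    have : n = (n + 1) + (-1) := by ring
    rw [this, HahnSeries.coeff_single_mul_add, one_mul]
    rcases (show n + 1 < 0 ∨ n + 1 = 0 by omega) with h | h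
    · exact hf _ h
    · rw [h, h0]
  · rw [← mul_assoc, HahnSeries.single_mul_single]
    simp

/-- Every Laurent series becomes a power series after multiplication by a power of `t`. -/
theorem exists_single_mul_mem (f : F⸨X⸩) :
    ∃ N : ℕ, ∀ n : ℕ, N ≤ n → HahnSeries.single (n : ℤ) 1 * f ∈ integers F := by
  refine ⟨f.order.natAbs, fun n hn => ?_⟩
  rw [mem_integers_iff]
  intro m hm
  have : m = (m - n) + n := by ring
  rw [this, HahnSeries.coeff_single_mul_add, one_mul]
  exact HahnSeries.coeff_eq_zero_of_lt_order (by omega)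

end Integers

/-! ### Bases of `E((t))` made of constants. -/

section ConstantBasis

variable {K E : Type*} [Field K] [Field E] [Algebra K E] {ι : Type*} [Fintype ι]

theorem laurent_smul_def (c : K⸨X⸩) (y : E⸨X⸩) : c • y = laurentMap (algebraMap K E) c * y :=
  Algebra.smul_def c y

theorem laurentMap_mem_integers {K E : Type*} [Field K] [Field E] {f : K →+* E} {x : K⸨X⸩}
    (hx : x ∈ integers K) : laurentMap f x ∈ integers E := by
  rw [mem_integers_iff] at hx ⊢
  intro n hn
  rw [laurentMap_coeff, hx n hn, map_zero]

theorem smul_mem_integers {c : K⸨X⸩} {y : E⸨X⸩} (hc : c ∈ integers K) (hy : y ∈ integers E) :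
    c • y ∈ integers E := by
  rw [laurent_smul_def]
  exact mul_mem (laurentMap_mem_integers hc) hy

theorem coeff_smul_single (c : K⸨X⸩) (a : E) (n : ℤ) :
    (c • (HahnSeries.single 0 a : E⸨X⸩)).coeff n = c.coeff n • a := by
  rw [laurent_smul_def, HahnSeries.coeff_mul_single_zero, laurentMap_coeff, Algebra.smul_def]

/-- The map `c ↦ ∑ i, c i • b i`. -/
def constantCombination (b : Module.Basis ι K E) : (ι → K⸨X⸩) →ₗ[K⸨X⸩] E⸨X⸩ :=
  Fintype.linearCombination K⸨X⸩ fun i => (HahnSeries.single 0 (b i) : E⸨X⸩)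

theorem coeff_constantCombination (b : Module.Basis ι K E) (c : ι → K⸨X⸩) (n : ℤ) :
    (constantCombination b c).coeff n = ∑ i, (c i).coeff n • b i := by
  rw [constantCombination, Fintype.linearCombination_apply, HahnSeries.coeff_sum]
  simp only [coeff_smul_single]

theorem constantCombination_bijective (b : Module.Basis ι K E) :
    Function.Bijective (constantCombination b) := by
  constructor
  · rw [injective_iff_map_eq_zero]
    intro c hc
    ext i n
    have h := coeff_constantCombination b c n
    rw [hc] at h
    exact Fintype.linearIndependent_iff.mp b.linearIndependent _ (by simpa using h.symm) i
  · intro y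
    refine ⟨fun i => HahnSeries.map y (b.coord i), ?_⟩
    ext n
    rw [coeff_constantCombination]
    exact b.sum_repr (y.coeff n)

/-- A `K`-basis of `E` gives a `K((t))`-basis of `E((t))`. -/
def constantBasis (b : Module.Basis ι K E) : Module.Basis ι K⸨X⸩ E⸨X⸩ :=
  Module.Basis.ofEquivFun (LinearEquiv.ofBijective _ (constantCombination_bijective b)).symm

theorem constantBasis_apply (b : Module.Basis ι K E) (i : ι) :
    constantBasis b i = HahnSeries.single 0 (b i) := by
  classical
  rw [constantBasis, Module.Basis.coe_ofEquivFun, LinearEquiv.symm_symm]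
  exact (Fintype.linearCombination_apply_single _ _ _ _).trans (one_smul _ _)

theorem coeff_constantBasis_repr (b : Module.Basis ι K E) (y : E⸨X⸩) (i : ι) (n : ℤ) :
    ((constantBasis b).repr y i).coeff n = b.repr (y.coeff n) i := by
  obtain ⟨c, rfl⟩ := (constantCombination_bijective b).2 y
  have h : ∀ i, (constantBasis b).repr (constantCombination b c) i = c i := fun i => by
    rw [constantBasis, Module.Basis.ofEquivFun_repr_apply]
    exact congrFun ((LinearEquiv.ofBijective _ (constantCombination_bijective b)).symm_apply_apply
      c) i
  rw [h, coeff_constantCombination, b.repr_sum_self]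

/-- In a constant basis coordinates are taken coefficient by coefficient, so `E[[t]]` corresponds to
the standard lattice. This translates between endomorphisms of `E[[t]]` and integral matrices. -/
theorem mem_integers_iff_repr (b : Module.Basis ι K E) (y : E⸨X⸩) :
    y ∈ integers E ↔ ∀ i, (constantBasis b).repr y i ∈ integers K := by
  simp only [mem_integers_iff, coeff_constantBasis_repr]
  constructor
  · intro h i n hn
    simp [h n hn]
  · intro h n hn
    exact b.ext_elem fun i => by simpa using h i n hn

end ConstantBasis

/-! ### Powers of `σ`: independence and fixed elements. -/

section Frobenius

variable {K E : Type*} [Field K] [Field E] [Algebra K E] (σ : E ≃ₐ[K] E) {d : ℕ}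

theorem sigmaLin_single (k : ℕ) (n : ℤ) (c : E) :
    (sigmaLin σ ^ k) (HahnSeries.single n c) = HahnSeries.single n ((σ ^ k) c) := by
  ext m
  rw [sigmaLin_pow_coeff]
  by_cases h : m = n <;> simp [h]

theorem sigmaLin_pow_mem_integers (k : ℕ) {y : E⸨X⸩} (hy : y ∈ integers E) :
    (sigmaLin σ ^ k) y ∈ integers E := by
  rw [mem_integers_iff] at hy ⊢
  intro n hn
  rw [sigmaLin_pow_coeff, hy n hn, map_zero]

/-- Dedekind's independence of the powers of `σ` below its order. -/
theorem eq_zero_of_sum_mul_pow (hσ : orderOf σ = d) (g : Fin d → E)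
    (h : ∀ c : E, ∑ m, g m * (σ ^ (m : ℕ)) c = 0) : g = 0 := by
  have hinj : Function.Injective fun m : Fin d => ((σ ^ (m : ℕ) : E ≃ₐ[K] E) : E →* E) := by
    intro m n hmn
    have : σ ^ (m : ℕ) = σ ^ (n : ℕ) := by
      ext c
      exact DFunLike.congr_fun hmn c
    exact Fin.ext (pow_injOn_Iio_orderOf (by simp [hσ]) (by simp [hσ]) this)
  have := (linearIndependent_monoidHom E E).comp _ hinj
  funext m
  refine Fintype.linearIndependent_iff.mp this g ?_ m
  funext c
  simpa using h c

/-- On a constant `c` the degree `n` coefficient of the sum only involves the degree `n`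
coefficients of the `g m`, so Dedekind's independence over `E` applies in each degree separately. -/
theorem coeff_eq_zero_of_sum_mul_pow (hσ : orderOf σ = d) (g : Fin d → E⸨X⸩) (n : ℤ)
    (h : ∀ c : E, (∑ m, g m * (sigmaLin σ ^ (m : ℕ)) (HahnSeries.single 0 c)).coeff n = 0)
    (m : Fin d) : (g m).coeff n = 0 := by
  refine congrFun (eq_zero_of_sum_mul_pow σ hσ (fun m => (g m).coeff n) fun c => ?_) m
  rw [← h c, HahnSeries.coeff_sum]
  simp only [sigmaLin_single, HahnSeries.coeff_mul_single_zero]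

theorem mem_integers_of_sum_mul_pow (hσ : orderOf σ = d) (g : Fin d → E⸨X⸩)
    (h : ∀ y ∈ integers E, ∑ m, g m * (sigmaLin σ ^ (m : ℕ)) y ∈ integers E) (m : Fin d) :
    g m ∈ integers E := by
  rw [mem_integers_iff]
  intro n hn
  exact coeff_eq_zero_of_sum_mul_pow σ hσ g n
    (fun c => mem_integers_iff.mp (h _ (single_mem_integers c le_rfl)) n hn) m

theorem eq_zero_of_sum_mul_sigmaLin (hσ : orderOf σ = d) (g : Fin d → E⸨X⸩)
    (h : ∀ y, ∑ m, g m * (sigmaLin σ ^ (m : ℕ)) y = 0) (m : Fin d) : g m = 0 := by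
  ext n
  exact coeff_eq_zero_of_sum_mul_pow σ hσ g n (fun c => by rw [h]; rfl) m

theorem orderOf_eq_finrank [Finite E] (hd : Module.finrank K E = d)
    (hσ : ∀ τ : E ≃ₐ[K] E, τ ∈ Subgroup.zpowers σ) : orderOf σ = d := by
  have : Finite K := Finite.of_injective _ (algebraMap K E).injective
  have : FiniteDimensional K E := Module.Finite.of_finite
  rw [← hd, ← IsGalois.card_aut_eq_finrank K E, ← Nat.card_zpowers,
    (Subgroup.eq_top_iff' _).mpr hσ, Subgroup.card_top]

/-- An element fixed by a generator of the Galois group lies in the base field. -/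
theorem exists_algebraMap_eq [Finite E] (hσ : ∀ τ : E ≃ₐ[K] E, τ ∈ Subgroup.zpowers σ) {c : E}
    (hc : σ c = c) : ∃ k : K, algebraMap K E k = c := by
  have : Finite K := Finite.of_injective _ (algebraMap K E).injective
  have : FiniteDimensional K E := Module.Finite.of_finite
  refine (IsGalois.mem_range_algebraMap_iff_fixed c).mpr fun τ => ?_
  have : Subgroup.zpowers σ ≤ MulAction.stabilizer (E ≃ₐ[K] E) c := by
    rw [Subgroup.zpowers_le]
    exact hc
  exact this (hσ τ)

theorem exists_laurentMap_eq [Finite E] (hσ : ∀ τ : E ≃ₐ[K] E, τ ∈ Subgroup.zpowers σ) {y : E⸨X⸩}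
    (hy : sigmaLin σ y = y) : ∃ k : K⸨X⸩, laurentMap (algebraMap K E) k = y := by
  have hn : ∀ n, ∃ k : K, algebraMap K E k = y.coeff n := fun n =>
    exists_algebraMap_eq σ hσ (congrArg (fun z : E⸨X⸩ => z.coeff n) hy)
  choose k hk using hn
  refine ⟨⟨k, ?_⟩, ?_⟩
  · refine y.isPWO_support.mono fun n hn => ?_
    simp only [Function.mem_support, HahnSeries.mem_support] at hn ⊢
    rw [← hk]
    simpa using hn
  · ext n
    exact hk n

theorem exists_pow_eq (hord : orderOf σ = d) (hd0 : 0 < d)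
    (hσ : ∀ τ : E ≃ₐ[K] E, τ ∈ Subgroup.zpowers σ) (τ : E ≃ₐ[K] E) : ∃ j < d, τ = σ ^ j := by
  have hfin : IsOfFinOrder σ := orderOf_pos_iff.mp (hord ▸ hd0)
  obtain ⟨j, hj⟩ := hfin.mem_powers_iff_mem_zpowers.mpr (hσ τ)
  refine ⟨j % d, Nat.mod_lt _ hd0, ?_⟩
  rw [← hj, ← hord, pow_mod_orderOf]

end Frobenius

/-! ### Relations in a cyclic algebra. -/

namespace CyclicAlgebra

variable {F L : Type*} [Field F] [Field L] (i : F →+* L) (σ : L →+* L) (a : F) (d : ℕ)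

/-- The embedding of the field `L` in the cyclic algebra, as a ring homomorphism. -/
def ofHom : L →+* CyclicAlgebra i σ a d where
  toFun := of i σ a d
  map_add' b c := (RingQuot.mkAlgHom_rel F (Rel.add b c)).trans (map_add _ _ _)
  map_mul' b c := (RingQuot.mkAlgHom_rel F (Rel.mul b c)).trans (map_mul _ _ _)
  map_one' := by
    have h := RingQuot.mkAlgHom_rel F (Rel.base (i := i) (σ := σ) (a := a) (d := d) 1)
    rw [map_one, map_one] at h
    exact h.trans (map_one _)
  map_zero' := by
    have h := RingQuot.mkAlgHom_rel F (Rel.base (i := i) (σ := σ) (a := a) (d := d) 0)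
    rw [map_zero, map_zero] at h
    exact h.trans (map_zero _)

theorem ofHom_apply (b : L) : ofHom i σ a d b = of i σ a d b := rfl

theorem of_base (c : F) : of i σ a d (i c) = algebraMap F _ c :=
  (RingQuot.mkAlgHom_rel F (Rel.base c)).trans (AlgHom.commutes _ _)

theorem t_mul_of (b : L) : t i σ a d * ofHom i σ a d b = ofHom i σ a d (σ b) * t i σ a d := by
  have h := RingQuot.mkAlgHom_rel F (Rel.twist (i := i) (σ := σ) (a := a) (d := d) b)
  rw [map_mul, map_mul] at h
  exact h

theorem t_pow_mul_of (n : ℕ) (b : L) :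
    t i σ a d ^ n * ofHom i σ a d b = ofHom i σ a d ((σ ^ n) b) * t i σ a d ^ n := by
  induction n generalizing b with
  | zero => simp
  | succ n ih => rw [pow_succ, mul_assoc, t_mul_of, ← mul_assoc, ih, mul_assoc, pow_succ]; rfl

theorem t_pow_degree : t i σ a d ^ d = ofHom i σ a d (i a) := by
  have h := RingQuot.mkAlgHom_rel F (Rel.pow (i := i) (σ := σ) (a := a) (d := d))
  rw [map_pow] at h
  exact h.trans ((AlgHom.commutes _ _).trans (of_base i σ a d a).symm)

end CyclicAlgebra

/-! ### The ring `E[Y⁻¹]`. -/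

section RationalFunctions

variable {K E : Type*} [Field K] [Field E]

theorem ratMap_X (f : K →+* E) : ratMap f RatFunc.X = RatFunc.X := by
  rw [← RatFunc.algebraMap_X, ratMap_algebraMap, Polynomial.map_X, RatFunc.algebraMap_X]

theorem ratMap_C (f : K →+* E) (c : K) : ratMap f (RatFunc.C c) = RatFunc.C (f c) := by
  rw [← RatFunc.algebraMap_C, ratMap_algebraMap, Polynomial.map_C, RatFunc.algebraMap_C]

theorem ratToLaurent_C (c : E) : ratToLaurent E (RatFunc.C c) = HahnSeries.single 0 c := by
  rw [← RatFunc.algebraMap_C, ratToLaurent_algebraMap, algebraMap_C_laurent]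

variable (E) in
/-- The ring `E[Y⁻¹]`. -/
abbrev invPoly : Subalgebra E (RatFunc E) := Algebra.adjoin E {(RatFunc.X : RatFunc E)⁻¹}

theorem inv_X_mem : (RatFunc.X : RatFunc E)⁻¹ ∈ invPoly E := Algebra.subset_adjoin rfl

theorem C_mem (c : E) : RatFunc.C c ∈ invPoly E := (invPoly E).algebraMap_mem c

/-- A factor `Y⁻¹` pays for one factor `1 + Y`, that is, for one use of `t ^ d = 1 + Y`. -/
theorem inv_X_mul_mem {f : RatFunc E} (hf : f ∈ invPoly E) :
    RatFunc.X⁻¹ * f * (1 + RatFunc.X) ∈ invPoly E := by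
  have : RatFunc.X⁻¹ * f * (1 + RatFunc.X) = RatFunc.X⁻¹ * f + f := by
    rw [mul_add, mul_one, mul_right_comm, inv_mul_cancel₀ RatFunc.X_ne_zero, one_mul]
  rw [this]
  exact add_mem (mul_mem inv_X_mem hf) hf

theorem ratMap_mem (f : E →+* E) {g : RatFunc E} (hg : g ∈ invPoly E) :
    ratMap f g ∈ invPoly E := by
  induction hg using Algebra.adjoin_induction with
  | mem x hx =>
    rw [Set.mem_singleton_iff.mp hx, map_inv₀, ratMap_X]
    exact inv_X_mem
  | algebraMap c =>
    rw [show algebraMap E (RatFunc E) c = RatFunc.C c from rfl, ratMap_C]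
    exact C_mem _
  | add x y _ _ hx hy => rw [map_add]; exact add_mem hx hy
  | mul x y _ _ hx hy => rw [map_mul]; exact mul_mem hx hy

theorem ratMap_pow_mem (f : E →+* E) (n : ℕ) {g : RatFunc E} (hg : g ∈ invPoly E) :
    (ratMap f ^ n) g ∈ invPoly E := by
  induction n with
  | zero => exact hg
  | succ n ih => rw [pow_succ']; exact ratMap_mem f ih

theorem coeff_ratToLaurent_of_pos {g : RatFunc E} (hg : g ∈ invPoly E) :
    ∀ n : ℤ, 0 < n → (ratToLaurent E g).coeff n = 0 := by
  induction hg using Algebra.adjoin_induction with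
  | mem x hx =>
    intro n hn
    rw [Set.mem_singleton_iff.mp hx, map_inv₀, ratToLaurent_X, HahnSeries.inv_single]
    exact HahnSeries.coeff_single_of_ne (by omega)
  | algebraMap c =>
    intro n hn
    rw [show algebraMap E (RatFunc E) c = RatFunc.C c from rfl, ratToLaurent_C]
    exact HahnSeries.coeff_single_of_ne (by omega)
  | add x y _ _ hx hy =>
    intro n hn
    rw [map_add, HahnSeries.coeff_add, hx n hn, hy n hn, add_zero]
  | mul x y _ _ hx hy =>
    intro n hn
    rw [map_mul, HahnSeries.coeff_mul]
    refine Finset.sum_eq_zero fun ij hij => ?_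
    rw [Finset.mem_antidiagonal] at hij
    rcases (show 0 < ij.1 ∨ 0 < ij.2 by omega) with h | h
    · rw [hx _ h, zero_mul]
    · rw [hy _ h, mul_zero]

/-- `E[Y⁻¹] ∩ E[[Y]] = E`. -/
theorem eq_C_of_mem_integers {g : RatFunc E} (hg : g ∈ invPoly E)
    (h : ratToLaurent E g ∈ integers E) : ∃ c, g = RatFunc.C c := by
  refine ⟨(ratToLaurent E g).coeff 0, (ratToLaurent E).injective ?_⟩
  rw [ratToLaurent_C]
  ext n
  rcases lt_trichotomy n 0 with hn | rfl | hn
  · rw [mem_integers_iff.mp h n hn, HahnSeries.coeff_single_of_ne hn.ne]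
  · rw [HahnSeries.coeff_single_same]
  · rw [coeff_ratToLaurent_of_pos hg n hn, HahnSeries.coeff_single_of_ne hn.ne']

end RationalFunctions

/-! ### Units of `𝒜` normalising `𝒜₀`. -/

namespace AlgA

variable (K : Type*) {E : Type*} [Field K] [Field E] [Algebra K E] (σ : E ≃ₐ[K] E) (d : ℕ)

/-- The embedding of `E(Y)` in `𝒜`, as a ring homomorphism. -/
abbrev ofHom : RatFunc E →+* AlgA K σ d :=
  CyclicAlgebra.ofHom (ratMap (algebraMap K E)) (ratMap (σ : E →+* E))
    (1 + RatFunc.X : RatFunc K) d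

theorem t_pow_mul_of (n : ℕ) (f : RatFunc E) :
    t K σ d ^ n * ofHom K σ d f = ofHom K σ d ((ratMap (σ : E →+* E) ^ n) f) * t K σ d ^ n :=
  CyclicAlgebra.t_pow_mul_of _ _ _ _ n f

theorem t_mul_of (f : RatFunc E) :
    t K σ d * ofHom K σ d f = ofHom K σ d (ratMap (σ : E →+* E) f) * t K σ d :=
  CyclicAlgebra.t_mul_of _ _ _ _ f

theorem t_pow_degree : t K σ d ^ d = ofHom K σ d (1 + RatFunc.X) := by
  refine (CyclicAlgebra.t_pow_degree _ _ _ _).trans ?_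
  rw [map_add, map_one, ratMap_X]

/-- Elements of `K(Y)` are central in `𝒜`. -/
theorem commute_base (c : RatFunc K) (z : AlgA K σ d) :
    Commute (ofHom K σ d (ratMap (algebraMap K E) c)) z := by
  rw [CyclicAlgebra.ofHom_apply, CyclicAlgebra.of_base]
  exact Algebra.commutes c z

theorem commute_inv_X (z : AlgA K σ d) : Commute (ofHom K σ d RatFunc.X⁻¹) z := by
  have := commute_base K σ d RatFunc.X⁻¹ z
  rwa [map_inv₀, ratMap_X] at this

/-- `𝒜₀` as an additive subgroup. -/
def zeroAddSubgroup : AddSubgroup (AlgA K σ d) where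
  carrier := zero K σ d
  zero_mem' := ⟨fun _ => 0, fun _ => zero_mem _, by
    simp [← CyclicAlgebra.ofHom_apply]⟩
  add_mem' := by
    rintro _ _ ⟨f, hf, rfl⟩ ⟨g, hg, rfl⟩
    refine ⟨f + g, fun m => add_mem (hf m) (hg m), ?_⟩
    simp [← CyclicAlgebra.ofHom_apply, add_mul, Finset.sum_add_distrib]
  neg_mem' := by
    rintro _ ⟨f, hf, rfl⟩
    refine ⟨-f, fun m => neg_mem (hf m), ?_⟩
    simp [← CyclicAlgebra.ofHom_apply]

theorem of_mul_pow_mem {f : RatFunc E} (hf : f ∈ invPoly E) {n : ℕ} (hn : n < d) :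
    ofHom K σ d f * t K σ d ^ n ∈ zeroAddSubgroup K σ d := by
  classical
  refine ⟨fun m => if m = ⟨n, hn⟩ then f else 0, fun m => ?_, ?_⟩
  · dsimp only
    split_ifs
    · exact hf
    · exact zero_mem _
  · rw [Finset.sum_eq_single ⟨n, hn⟩]
    · simp [← CyclicAlgebra.ofHom_apply]
    · intro m _ hm
      simp [← CyclicAlgebra.ofHom_apply, hm]
    · simp

/-- For `n ≥ d` the relation `t ^ d = 1 + Y` lowers the exponent to `n - d`. Below `2 * d` this is
needed at most once, whence the single condition on `f * (1 + Y)`. -/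
theorem of_mul_pow_mem_of_lt_two_mul {f : RatFunc E} (hf : f ∈ invPoly E)
    (hf' : f * (1 + RatFunc.X) ∈ invPoly E) {n : ℕ} (hn : n < 2 * d) :
    ofHom K σ d f * t K σ d ^ n ∈ zeroAddSubgroup K σ d := by
  by_cases h : n < d
  · exact of_mul_pow_mem K σ d hf h
  · have : ofHom K σ d f * t K σ d ^ n = ofHom K σ d (f * (1 + RatFunc.X)) * t K σ d ^ (n - d) := by
      rw [map_mul, ← t_pow_degree, mul_assoc, ← pow_add, Nat.add_sub_cancel' (not_lt.mp h)]
    rw [this]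
    exact of_mul_pow_mem K σ d hf' (by omega)

theorem map_mem_zero (φ : AlgA K σ d →+ AlgA K σ d)
    (h : ∀ f ∈ invPoly E, ∀ m < d, φ (ofHom K σ d f * t K σ d ^ m) ∈ zeroAddSubgroup K σ d)
    (z : AlgA K σ d) (hz : z ∈ zero K σ d) : φ z ∈ zero K σ d := by
  obtain ⟨f, hf, rfl⟩ := hz
  rw [map_sum]
  exact sum_mem fun m _ => h _ (hf m) m m.2

/-- The units of `𝒜` such that conjugation by them is a bijection of `𝒜₀`. -/
def conjStab : Subgroup (AlgA K σ d)ˣ where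
  carrier := {y | ∀ z ∈ zero K σ d, y * z * (y⁻¹ : (AlgA K σ d)ˣ) ∈ zero K σ d ∧
    (y⁻¹ : (AlgA K σ d)ˣ) * z * y ∈ zero K σ d}
  one_mem' z hz := by simpa using hz
  mul_mem' {a b} ha hb z hz := by
    have h1 := (ha _ (hb z hz).1).1
    have h2 := (hb _ (ha z hz).2).2
    simp only [mul_inv_rev, Units.val_mul, mul_assoc] at h1 h2 ⊢
    exact ⟨h1, h2⟩
  inv_mem' {a} ha z hz := by
    rw [inv_inv]
    exact (ha z hz).symm

theorem mem_conjStab_of (y : (AlgA K σ d)ˣ)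
    (h : ∀ f ∈ invPoly E, ∀ m < d, y * (ofHom K σ d f * t K σ d ^ m) * (y⁻¹ : (AlgA K σ d)ˣ) ∈
      zeroAddSubgroup K σ d)
    (h' : ∀ f ∈ invPoly E, ∀ m < d, (y⁻¹ : (AlgA K σ d)ˣ) * (ofHom K σ d f * t K σ d ^ m) * y ∈
      zeroAddSubgroup K σ d) : y ∈ conjStab K σ d := fun z hz =>
  ⟨map_mem_zero K σ d ((AddMonoidHom.mulRight _).comp (AddMonoidHom.mulLeft (y : AlgA K σ d))) h
    z hz, map_mem_zero K σ d ((AddMonoidHom.mulRight _).comp (AddMonoidHom.mulLeft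
      ((y⁻¹ : (AlgA K σ d)ˣ) : AlgA K σ d))) h' z hz⟩

/-- The elements of `Eˣ`, as units of `𝒜`. -/
def constUnit : Eˣ →* (AlgA K σ d)ˣ :=
  Units.map ((ofHom K σ d).comp (RatFunc.C : E →+* RatFunc E)).toMonoidHom

theorem constUnit_val (w : Eˣ) : (constUnit K σ d w : AlgA K σ d) = ofHom K σ d (RatFunc.C w) := rfl

theorem ratMap_pow_C (m : ℕ) (c : E) :
    (ratMap (σ : E →+* E) ^ m) (RatFunc.C c) = RatFunc.C ((σ ^ m) c) := by
  induction m with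
  | zero => rfl
  | succ m ih =>
    rw [pow_succ', RingHom.mul_def, RingHom.comp_apply, ih, ratMap_C, pow_succ']
    rfl

theorem constUnit_conj (w : Eˣ) (f : RatFunc E) (m : ℕ) :
    constUnit K σ d w * (ofHom K σ d f * t K σ d ^ m) * ((constUnit K σ d w)⁻¹ : (AlgA K σ d)ˣ) =
      ofHom K σ d (RatFunc.C (w : E) * f * RatFunc.C ((σ ^ m) ((w⁻¹ : Eˣ) : E))) * t K σ d ^ m := by
  rw [← map_inv, constUnit_val, constUnit_val, mul_assoc, mul_assoc, t_pow_mul_of,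
    ratMap_pow_C, map_mul, map_mul]
  simp only [mul_assoc]

theorem constUnit_mem (w : Eˣ) : constUnit K σ d w ∈ conjStab K σ d := by
  have key : ∀ w : Eˣ, ∀ f ∈ invPoly E, ∀ m < d,
      constUnit K σ d w * (ofHom K σ d f * t K σ d ^ m) *
        ((constUnit K σ d w)⁻¹ : (AlgA K σ d)ˣ) ∈ zeroAddSubgroup K σ d := by
    intro w f hf m hm
    rw [constUnit_conj]
    exact of_mul_pow_mem K σ d (mul_mem (mul_mem (C_mem _) hf) (C_mem _)) hm
  refine mem_conjStab_of K σ d _ (key w) ?_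
  have := key w⁻¹
  rwa [map_inv, inv_inv] at this

theorem one_add_X_ne_zero : (1 + RatFunc.X : RatFunc E) ≠ 0 := by
  intro h
  have := congrArg (ratToLaurent E) h
  rw [map_add, map_one, map_zero, ratToLaurent_X] at this
  have := congrArg (fun z : E⸨X⸩ => z.coeff 0) this
  simp at this

/-- The generator `t` as a unit of `𝒜`. -/
def tUnit (hd : 0 < d) : (AlgA K σ d)ˣ where
  val := t K σ d
  inv := t K σ d ^ (d - 1) * ofHom K σ d (1 + RatFunc.X)⁻¹
  val_inv := by
    rw [← mul_assoc, ← pow_succ', Nat.sub_add_cancel hd, t_pow_degree, ← map_mul,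
      mul_inv_cancel₀ one_add_X_ne_zero, map_one]
  inv_val := by
    have := commute_base K σ d (1 + RatFunc.X)⁻¹ (t K σ d)
    rw [map_inv₀, map_add, map_one, ratMap_X] at this
    rw [mul_assoc, this.eq, ← mul_assoc, ← pow_succ, Nat.sub_add_cancel hd, t_pow_degree,
      ← map_mul, mul_inv_cancel₀ one_add_X_ne_zero, map_one]

theorem tUnit_val (hd : 0 < d) : (tUnit K σ d hd : AlgA K σ d) = t K σ d := rfl

theorem ratMap_symm (f : RatFunc E) :
    ratMap (σ : E →+* E) (ratMap (σ.symm : E →+* E) f) = f := by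
  suffices h : (ratMap (σ : E →+* E)).comp (ratMap (σ.symm : E →+* E)) = RingHom.id _ from
    RingHom.congr_fun h f
  refine IsLocalization.ringHom_ext (nonZeroDivisors (Polynomial E)) ?_
  refine Polynomial.ringHom_ext (fun c => ?_) ?_
  · simp [ratMap_C]
  · simp [ratMap_X]

theorem tUnit_mem (hd : 0 < d) : tUnit K σ d hd ∈ conjStab K σ d := by
  refine mem_conjStab_of K σ d _ (fun f hf m hm => ?_) fun f hf m hm => ?_
  · have : tUnit K σ d hd * (ofHom K σ d f * t K σ d ^ m) * ((tUnit K σ d hd)⁻¹ : (AlgA K σ d)ˣ) =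
        ofHom K σ d (ratMap (σ : E →+* E) f) * t K σ d ^ m := by
      rw [Units.mul_inv_eq_iff_eq_mul, tUnit_val, ← mul_assoc, t_mul_of, mul_assoc, mul_assoc,
        ← pow_succ, ← pow_succ']
    rw [this]
    exact of_mul_pow_mem K σ d (ratMap_mem _ hf) hm
  · have : ((tUnit K σ d hd)⁻¹ : (AlgA K σ d)ˣ) * (ofHom K σ d f * t K σ d ^ m) * tUnit K σ d hd =
        ofHom K σ d (ratMap (σ.symm : E →+* E) f) * t K σ d ^ m := by
      rw [mul_assoc, Units.inv_mul_eq_iff_eq_mul, tUnit_val, ← mul_assoc, t_mul_of, ratMap_symm,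
        mul_assoc, mul_assoc, ← pow_succ, ← pow_succ']
    rw [this]
    exact of_mul_pow_mem K σ d (ratMap_mem _ hf) hm

theorem one_sub_t_mul_geom : (1 - t K σ d) * ∑ k ∈ Finset.range d, t K σ d ^ k =
    -ofHom K σ d RatFunc.X := by
  rw [mul_neg_geom_sum, t_pow_degree, map_add, map_one]
  abel

theorem geom_mul_one_sub_t : (∑ k ∈ Finset.range d, t K σ d ^ k) * (1 - t K σ d) =
    -ofHom K σ d RatFunc.X := by
  rw [geom_sum_mul_neg, t_pow_degree, map_add, map_one]
  abel

/-- The element `1 - t` as a unit of `𝒜`; its inverse is `-Y⁻¹ ∑_{k < d} t ^ k`. -/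
def oneSubT : (AlgA K σ d)ˣ where
  val := 1 - t K σ d
  inv := ofHom K σ d RatFunc.X⁻¹ * -∑ k ∈ Finset.range d, t K σ d ^ k
  val_inv := by
    rw [← mul_assoc, ← (commute_inv_X K σ d (1 - t K σ d)).eq, mul_assoc, mul_neg,
      one_sub_t_mul_geom, neg_neg, ← map_mul, inv_mul_cancel₀ RatFunc.X_ne_zero, map_one]
  inv_val := by
    rw [mul_assoc, neg_mul, geom_mul_one_sub_t, neg_neg, ← map_mul,
      inv_mul_cancel₀ RatFunc.X_ne_zero, map_one]

theorem oneSubT_val : (oneSubT K σ d : AlgA K σ d) = 1 - t K σ d := rfl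

theorem oneSubT_inv_val : (((oneSubT K σ d)⁻¹ : (AlgA K σ d)ˣ) : AlgA K σ d) =
    ofHom K σ d RatFunc.X⁻¹ * -∑ k ∈ Finset.range d, t K σ d ^ k := rfl

theorem inv_X_mul_pow_mem {f : RatFunc E} (hf : f ∈ invPoly E) {n : ℕ} (hn : n < 2 * d) :
    ofHom K σ d (RatFunc.X⁻¹ * f) * t K σ d ^ n ∈ zeroAddSubgroup K σ d :=
  of_mul_pow_mem_of_lt_two_mul K σ d (mul_mem inv_X_mem hf) (inv_X_mul_mem hf) hn

/-- The inverse of `1 - t` carries a factor `Y⁻¹`, and conjugating `f t ^ m` produces exponents at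
most `m + k + 1 < 2 * d`. One reduction by `t ^ d = 1 + Y` suffices, and `Y⁻¹ (1 + Y)` is still in
`E[Y⁻¹]`. -/
theorem oneSubT_mem : oneSubT K σ d ∈ conjStab K σ d := by
  refine mem_conjStab_of K σ d _ (fun f hf m hm => ?_) fun f hf m hm => ?_
  · rw [oneSubT_inv_val, oneSubT_val, ← mul_assoc, ← (commute_inv_X K σ d _).eq, mul_neg]
    refine neg_mem ?_
    rw [Finset.mul_sum]
    refine sum_mem fun k hk => ?_
    rw [Finset.mem_range] at hk
    have : ofHom K σ d RatFunc.X⁻¹ * ((1 - t K σ d) * (ofHom K σ d f * t K σ d ^ m)) * t K σ d ^ k =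
        ofHom K σ d (RatFunc.X⁻¹ * f) * t K σ d ^ (m + k) -
          ofHom K σ d (RatFunc.X⁻¹ * ratMap (σ : E →+* E) f) * t K σ d ^ (m + k + 1) := by
      rw [sub_mul, ← mul_assoc (t K σ d), t_mul_of, map_mul, map_mul, pow_succ' _ (m + k), pow_add]
      noncomm_ring
    rw [this]
    exact sub_mem (inv_X_mul_pow_mem K σ d hf (by omega))
      (inv_X_mul_pow_mem K σ d (ratMap_mem _ hf) (by omega))
  · rw [oneSubT_inv_val, oneSubT_val, mul_neg, neg_mul, neg_mul]
    refine neg_mem ?_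
    rw [Finset.mul_sum, Finset.sum_mul, Finset.sum_mul]
    refine sum_mem fun k hk => ?_
    rw [Finset.mem_range] at hk
    have : ofHom K σ d RatFunc.X⁻¹ * t K σ d ^ k * (ofHom K σ d f * t K σ d ^ m) * (1 - t K σ d) =
        ofHom K σ d (RatFunc.X⁻¹ * (ratMap (σ : E →+* E) ^ k) f) * t K σ d ^ (k + m) -
          ofHom K σ d (RatFunc.X⁻¹ * (ratMap (σ : E →+* E) ^ k) f) * t K σ d ^ (k + m + 1) := by
      rw [mul_assoc (ofHom K σ d _), ← mul_assoc (t K σ d ^ k), t_pow_mul_of, map_mul,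
        pow_succ _ (k + m), pow_add]
      noncomm_ring
    rw [this]
    exact sub_mem (inv_X_mul_pow_mem K σ d (ratMap_pow_mem _ _ hf) (by omega))
      (inv_X_mul_pow_mem K σ d (ratMap_pow_mem _ _ hf) (by omega))

/-- The central element `Y` as a unit of `𝒜`. -/
def uniformizerUnit : (AlgA K σ d)ˣ :=
  Units.map (ofHom K σ d).toMonoidHom (Units.mk0 RatFunc.X RatFunc.X_ne_zero)

theorem uniformizerUnit_val :
    (uniformizerUnit K σ d : AlgA K σ d) = ofHom K σ d RatFunc.X := rfl

theorem uniformizerUnit_mem : uniformizerUnit K σ d ∈ conjStab K σ d := by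
  have h : ∀ z, Commute (uniformizerUnit K σ d : AlgA K σ d) z := fun z => by
    have := commute_base K σ d RatFunc.X z
    rwa [ratMap_X] at this
  intro z hz
  rw [(h z).eq, Units.mul_inv_cancel_right, mul_assoc, ← (h z).eq, Units.inv_mul_cancel_left]
  exact ⟨hz, hz⟩

end AlgA

/-! ### Valuations and the partial norms of `x`. -/

theorem exists_single_mul_unit {F : Type*} [Field F] {f : F⸨X⸩} (hf : f ≠ 0) :
    ∃ (n : ℤ) (u : F⸨X⸩), f = HahnSeries.single n 1 * u ∧ u ∈ integers F ∧ u.coeff 0 ≠ 0 := by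
  have hc : ∀ m, (HahnSeries.single (-f.order) 1 * f).coeff m = f.coeff (m + f.order) := fun m => by
    rw [show m = (m + f.order) + -f.order by ring, HahnSeries.coeff_single_mul_add, one_mul]
    ring_nf
  refine ⟨f.order, HahnSeries.single (-f.order) 1 * f, ?_, ?_, ?_⟩
  · rw [← mul_assoc, HahnSeries.single_mul_single]
    simp
  · rw [mem_integers_iff]
    intro m hm
    rw [hc]
    exact HahnSeries.coeff_eq_zero_of_lt_order (by omega)
  · rw [hc, zero_add]
    exact fun h => hf (HahnSeries.coeff_order_eq_zero.mp h)

section Norm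

variable {K E : Type*} [Field K] [Field E] [Algebra K E] (σ : E ≃ₐ[K] E) {d : ℕ}

/-- The partial norm `∏_{i < k} σ^i(x)`, so that `t ^ k` acts as `y ↦ twist x k * σ^k(y)`. -/
def twist (x : E⸨X⸩) (k : ℕ) : E⸨X⸩ := ∏ i ∈ Finset.range k, (sigmaLin σ ^ i) x

theorem twist_mem {x : E⸨X⸩} (hx : x ∈ integers E) (k : ℕ) : twist σ x k ∈ integers E :=
  prod_mem fun i _ => sigmaLin_pow_mem_integers σ i hx

theorem twist_coeff_zero_ne {x : E⸨X⸩} (hx : x ∈ integers E) (h0 : x.coeff 0 ≠ 0) (k : ℕ) :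
    (twist σ x k).coeff 0 ≠ 0 := by
  rw [twist, coeff_zero_prod _ _ fun i _ => sigmaLin_pow_mem_integers σ i hx]
  refine Finset.prod_ne_zero_iff.mpr fun i _ => ?_
  rw [sigmaLin_pow_coeff]
  exact (map_ne_zero_iff _ (σ ^ i).injective).mpr h0

theorem twist_mul (x y : E⸨X⸩) (k : ℕ) : twist σ (x * y) k = twist σ x k * twist σ y k := by
  simp only [twist, sigmaLin_pow_mul, Finset.prod_mul_distrib]

/-- If `x = Y ^ n u` with `u` a unit of `E[[Y]]`, its norm has valuation `d * n`, while `1 + Y` has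
valuation `0`; so `n = 0`. -/
theorem unit_of_laurentNorm (hd : 0 < d) {x : E⸨X⸩}
    (hx : laurentNorm σ d x = 1 + HahnSeries.single 1 1) : x ∈ integers E ∧ x.coeff 0 ≠ 0 := by
  change twist σ x d = _ at hx
  have hx0 : x ≠ 0 := by
    rintro rfl
    have h1 : twist σ (0 : E⸨X⸩) d = 0 :=
      Finset.prod_eq_zero (Finset.mem_range.mpr hd) (map_zero _)
    rw [h1] at hx
    simpa using congrArg (fun z : E⸨X⸩ => z.coeff 0) hx
  obtain ⟨n, u, rfl, hu, hu0⟩ := exists_single_mul_unit hx0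
  have hs : twist σ (HahnSeries.single n (1 : E)) d = HahnSeries.single (d * n) 1 := by
    simp only [twist, sigmaLin_single, map_one, Finset.prod_const, Finset.card_range,
      HahnSeries.single_pow, one_pow, nsmul_eq_mul]
  rw [twist_mul, hs] at hx
  have hN := mem_integers_iff.mp (twist_mem σ hu d)
  have hc : ∀ m, (twist σ u d).coeff m = (1 + HahnSeries.single 1 1 : E⸨X⸩).coeff (m + d * n) := by
    intro m
    rw [← hx, HahnSeries.coeff_single_mul_add, one_mul]
  have hn : n = 0 := by
    have hd' : (0 : ℤ) < d := by exact_mod_cast hd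
    rcases lt_trichotomy n 0 with h | h | h
    · exfalso
      have hneg : (d : ℤ) * n < 0 := mul_neg_of_pos_of_neg hd' h
      apply twist_coeff_zero_ne σ hu hu0 d
      rw [hc, zero_add, HahnSeries.coeff_add, HahnSeries.coeff_one, if_neg hneg.ne,
        HahnSeries.coeff_single_of_ne (by omega), add_zero]
    · exact h
    · exfalso
      have hpos : 0 < (d : ℤ) * n := mul_pos hd' h
      have := hc (-(d * n))
      rw [hN _ (by omega)] at this
      simp at this
  subst hn
  rw [show (HahnSeries.single 0 (1 : E) : E⸨X⸩) = 1 from rfl, one_mul]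
  exact ⟨hu, hu0⟩

end Norm

/-! ### The representation `Ψ` on explicit elements. -/

section PsiFormulas

variable {K E : Type*} [Field K] [Field E] [Algebra K E] (σ : E ≃ₐ[K] E) (d : ℕ)
  (hσ : σ ^ d = 1) (x : E⸨X⸩) (hx : laurentNorm σ d x = 1 + HahnSeries.single 1 1)

theorem Psi_of (f : RatFunc E) (y : E⸨X⸩) :
    Psi σ d hσ x hx (AlgA.ofHom K σ d f) y = ratToLaurent E f * y :=
  LinearMap.congr_fun (CyclicAlgebra.lift_of _ _ _ _ _ _ _ _ _ f) y

theorem Psi_const (c : E) (y : E⸨X⸩) :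
    Psi σ d hσ x hx (AlgA.ofHom K σ d (RatFunc.C c)) y = HahnSeries.single 0 c * y := by
  rw [Psi_of, ratToLaurent_C]

theorem Psi_t (y : E⸨X⸩) : Psi σ d hσ x hx (AlgA.t K σ d) y = x * sigmaLin σ y :=
  LinearMap.congr_fun (CyclicAlgebra.lift_t _ _ _ _ _ _ _ _ _) y

theorem Psi_t_pow (k : ℕ) (y : E⸨X⸩) :
    Psi σ d hσ x hx (AlgA.t K σ d ^ k) y = twist σ x k * (sigmaLin σ ^ k) y := by
  induction k generalizing y with
  | zero => simp [twist]
  | succ k ih =>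
    rw [pow_succ, map_mul, Module.End.mul_apply, ih, Psi_t, sigmaLin_pow_mul, ← mul_assoc, twist,
      twist, Finset.prod_range_succ, pow_succ]
    rfl

theorem Psi_sum (f : Fin d → RatFunc E) (y : E⸨X⸩) :
    Psi σ d hσ x hx (∑ m, AlgA.ofHom K σ d (f m) * AlgA.t K σ d ^ (m : ℕ)) y =
      ∑ m, ratToLaurent E (f m) * twist σ x m * (sigmaLin σ ^ (m : ℕ)) y := by
  simp only [map_sum, map_mul, LinearMap.sum_apply, Module.End.mul_apply, Psi_t_pow, Psi_of,
    mul_assoc]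

variable {σ d}

theorem Psi_eq_sum_unique (hord : orderOf σ = d) (f g : Fin d → E⸨X⸩)
    (h : ∀ y, ∑ m, f m * (sigmaLin σ ^ (m : ℕ)) y = ∑ m, g m * (sigmaLin σ ^ (m : ℕ)) y) :
    f = g := by
  funext m
  refine sub_eq_zero.mp (eq_zero_of_sum_mul_sigmaLin σ hord (fun m => f m - g m) (fun y => ?_) m)
  simp only [sub_mul, Finset.sum_sub_distrib, h, sub_self]

include hσ hx in
/-- The powers `t ^ m`, `m < d`, are linearly independent over `E(Y)`. -/
theorem AlgA.coeff_unique (hord : orderOf σ = d) (hd : 0 < d) (f g : Fin d → RatFunc E)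
    (h : ∑ m, AlgA.ofHom K σ d (f m) * AlgA.t K σ d ^ (m : ℕ) =
      ∑ m, AlgA.ofHom K σ d (g m) * AlgA.t K σ d ^ (m : ℕ)) : f = g := by
  obtain ⟨hxi, hx0⟩ := unit_of_laurentNorm σ hd hx
  funext m
  have := congrFun (Psi_eq_sum_unique hord (fun m => ratToLaurent E (f m) * twist σ x m)
    (fun m => ratToLaurent E (g m) * twist σ x m) fun y => by
      rw [← Psi_sum σ d hσ x hx, ← Psi_sum σ d hσ x hx, h]) m
  have hne : twist σ x m ≠ 0 := fun h => twist_coeff_zero_ne σ hxi hx0 m (by rw [h]; rfl)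
  exact (ratToLaurent E).injective (mul_right_cancel₀ hne this)

include hσ hx in
theorem ofHom_injective : Function.Injective (AlgA.ofHom K σ d) := by
  intro f g h
  have := congrArg (fun z => Psi σ d hσ x hx z 1) h
  simp only [Psi_of, mul_one] at this
  exact (ratToLaurent E).injective this

end PsiFormulas

/-! ### The span `V` of the `t ^ m` over `E`. -/

section ConstantPart

variable (K : Type*) {E : Type*} [Field K] [Field E] [Algebra K E] (σ : E ≃ₐ[K] E) (d : ℕ)

/-- The `E`-span of the elements `t ^ m`, `m < d`, in `𝒜`. -/
def constPart : Set (AlgA K σ d) :=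
  Set.range fun c : Fin d → E => ∑ m, AlgA.ofHom K σ d (RatFunc.C (c m)) * AlgA.t K σ d ^ (m : ℕ)

theorem constPart_subset : constPart K σ d ⊆ AlgA.zero K σ d := by
  rintro _ ⟨c, rfl⟩
  exact ⟨_, fun m => C_mem (c m), rfl⟩

theorem const_mul_pow_mem (c : E) {n : ℕ} (hn : n < d) :
    AlgA.ofHom K σ d (RatFunc.C c) * AlgA.t K σ d ^ n ∈ constPart K σ d := by
  classical
  refine ⟨fun m => if m = ⟨n, hn⟩ then c else 0, ?_⟩
  dsimp only
  rw [Finset.sum_eq_single ⟨n, hn⟩]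
  · simp
  · intro m _ hm
    simp [hm]
  · simp

theorem const_mem (c : E) (hd : 0 < d) : AlgA.ofHom K σ d (RatFunc.C c) ∈ constPart K σ d := by
  simpa using const_mul_pow_mem K σ d c hd

theorem t_pow_mem {n : ℕ} (hn : n < d) : AlgA.t K σ d ^ n ∈ constPart K σ d := by
  simpa using const_mul_pow_mem K σ d 1 hn

theorem const_mul_mem (c : E) {v : AlgA K σ d} (hv : v ∈ constPart K σ d) :
    AlgA.ofHom K σ d (RatFunc.C c) * v ∈ constPart K σ d := by
  obtain ⟨e, rfl⟩ := hv
  refine ⟨fun m => c * e m, ?_⟩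
  simp only [Finset.mul_sum, map_mul, mul_assoc]

variable {K σ}
variable {d} (hσ : σ ^ d = 1) (x : E⸨X⸩) (hx : laurentNorm σ d x = 1 + HahnSeries.single 1 1)

theorem Psi_mem_of_constPart (hd : 0 < d) {v : AlgA K σ d} (hv : v ∈ constPart K σ d)
    {y : E⸨X⸩} (hy : y ∈ integers E) : Psi σ d hσ x hx v y ∈ integers E := by
  obtain ⟨hxi, hx0⟩ := unit_of_laurentNorm σ hd hx
  obtain ⟨c, rfl⟩ := hv
  dsimp only
  rw [Psi_sum]
  refine sum_mem fun m _ => mul_mem (mul_mem ?_ (twist_mem σ hxi m))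
    (sigmaLin_pow_mem_integers σ m hy)
  rw [ratToLaurent_C]
  exact single_mem_integers _ le_rfl

/-- Together with `Psi_mem_of_constPart` this identifies `V` with the elements of `𝒜₀` preserving
`E[[Y]]`. By independence of the powers of `σ` each `f m` times a unit of `E[[Y]]` is integral, so
`f m ∈ E[Y⁻¹] ∩ E[[Y]] = E`. -/
theorem mem_constPart_of_Psi (hord : orderOf σ = d) (hd : 0 < d) {v : AlgA K σ d}
    (hv : v ∈ AlgA.zero K σ d)
    (h : ∀ y ∈ integers E, Psi σ d hσ x hx v y ∈ integers E) : v ∈ constPart K σ d := by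
  obtain ⟨hxi, hx0⟩ := unit_of_laurentNorm σ hd hx
  obtain ⟨f, hf, rfl⟩ := hv
  have key : ∀ m, ∃ c, f m = RatFunc.C c := by
    intro m
    have h1 := mem_integers_of_sum_mul_pow σ hord (fun m => ratToLaurent E (f m) * twist σ x m)
      (fun y hy => by
        rw [← Psi_sum σ d hσ x hx]
        exact h y hy) m
    refine eq_C_of_mem_integers (hf m) ?_
    have h0 := twist_coeff_zero_ne σ hxi hx0 m
    have hne : twist σ x m ≠ 0 := fun h => h0 (by rw [h]; rfl)
    rw [← mul_inv_cancel_right₀ hne (ratToLaurent E (f m))]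
    exact mul_mem h1 (inv_mem_integers (twist_mem σ hxi m) h0)
  choose c hc using key
  refine ⟨c, ?_⟩
  simp only [hc]
  rfl

include hσ hx in
/-- The elements of `E` are characterised in the span `V` of the `t ^ m` by `v V ⊆ V`. -/
theorem exists_const_of_mul_mem (hord : orderOf σ = d) (hd : 0 < d) {v : AlgA K σ d}
    (hv : v ∈ constPart K σ d) (h : ∀ v' ∈ constPart K σ d, v * v' ∈ constPart K σ d) :
    ∃ c, v = AlgA.ofHom K σ d (RatFunc.C c) := by
  obtain ⟨n, rfl⟩ : ∃ n, d = n + 1 := ⟨d - 1, by omega⟩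
  obtain ⟨c, rfl⟩ := hv
  -- The test element is `t ^ (d - 1)`. Multiplying once more by `t` turns the left side into `v (1
  -- + Y)`, while on the right only the last coefficient acquires a factor `1 + Y`.
  obtain ⟨e, he⟩ := h _ (t_pow_mem K σ (n + 1) (Nat.lt_succ_self n))
  dsimp only at he
  have key := congrArg (· * AlgA.t K σ (n + 1)) he
  simp only [mul_assoc, ← pow_succ] at key
  rw [AlgA.t_pow_degree] at key
  have h1 : (∑ m, AlgA.ofHom K σ (n + 1) (RatFunc.C (c m)) * AlgA.t K σ (n + 1) ^ (m : ℕ)) *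
      AlgA.ofHom K σ (n + 1) (1 + RatFunc.X) =
      ∑ m, AlgA.ofHom K σ (n + 1) (RatFunc.C (c m) * (1 + RatFunc.X)) *
        AlgA.t K σ (n + 1) ^ (m : ℕ) := by
    rw [Finset.sum_mul]
    refine Finset.sum_congr rfl fun m _ => ?_
    have hcomm := AlgA.commute_base K σ (n + 1) (1 + RatFunc.X) (AlgA.t K σ (n + 1) ^ (m : ℕ))
    rw [map_add, map_one, ratMap_X] at hcomm
    rw [mul_assoc, ← hcomm.eq, ← mul_assoc, ← map_mul]
  have h2 : (∑ m, AlgA.ofHom K σ (n + 1) (RatFunc.C (e m)) * AlgA.t K σ (n + 1) ^ (m : ℕ)) *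
      AlgA.t K σ (n + 1) = ∑ m, AlgA.ofHom K σ (n + 1)
        ((Fin.cons (RatFunc.C (e (Fin.last n)) * (1 + RatFunc.X))
          (fun i => RatFunc.C (e i.castSucc)) : Fin (n + 1) → RatFunc E) m) *
        AlgA.t K σ (n + 1) ^ (m : ℕ) := by
    rw [Fin.sum_univ_castSucc, Fin.sum_univ_succ, add_mul, Finset.sum_mul, add_comm (∑ i, _)]
    congr 1
    · rw [Fin.cons_zero, Fin.val_last, mul_assoc, ← pow_succ, AlgA.t_pow_degree, map_mul]
      simp
    · refine Finset.sum_congr rfl fun m _ => ?_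
      rw [Fin.cons_succ, Fin.val_succ, Fin.val_castSucc, mul_assoc, ← pow_succ]
  rw [h1] at key
  have key' := AlgA.coeff_unique hσ x hx hord hd _ _ (key.symm.trans h2)
  -- In positive index the comparison reads `c (i + 1) * (1 + Y) = e i`, and the coefficient of `Y`
  -- forces `c (i + 1) = 0`.
  have hc : ∀ i : Fin n, c i.succ = 0 := by
    intro i
    have := congrFun key' i.succ
    rw [Fin.cons_succ] at this
    have h3 := congrArg (fun f => (ratToLaurent E f).coeff 1) this
    simp only [map_mul, map_add, map_one, ratToLaurent_C, ratToLaurent_X,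
      HahnSeries.coeff_single_zero_mul, HahnSeries.coeff_add] at h3
    simpa [HahnSeries.coeff_one] using h3
  refine ⟨c 0, ?_⟩
  dsimp only
  rw [Fin.sum_univ_succ]
  simp [hc]

end ConstantPart

/-! ### Units of `𝒜` stabilising `𝒜₀` and `E[[Y]]`. -/

section Stabilizer

variable {K E : Type*} [Field K] [Field E] [Algebra K E] {σ : E ≃ₐ[K] E} {d : ℕ}
  (hσ : σ ^ d = 1) (x : E⸨X⸩) (hx : laurentNorm σ d x = 1 + HahnSeries.single 1 1)

/-- An endomorphism commuting with multiplication by constants is a multiplication. -/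
theorem eq_mulLeft_of_commute [FiniteDimensional K E] (T : Module.End K⸨X⸩ E⸨X⸩)
    (h : ∀ (c : E) (y : E⸨X⸩), T (HahnSeries.single 0 c * y) = HahnSeries.single 0 c * T y)
    (y : E⸨X⸩) : T y = T 1 * y := by
  have : T = LinearMap.mulLeft K⸨X⸩ (T 1) := by
    refine (constantBasis (Module.finBasis K E)).ext fun i => ?_
    rw [constantBasis_apply, LinearMap.mulLeft_apply, mul_comm (T 1), ← h, mul_one]
  exact LinearMap.congr_fun this y

variable [Finite E]

theorem finite_constPart : (constPart K σ d).Finite := Set.finite_range _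

include hσ hx in
/-- Conjugations preserving the span of the `t ^ m` over `E` restrict to automorphisms of `E`. -/
theorem exists_algEquiv_of_conj (hord : orderOf σ = d) (hd : 0 < d) (y : (AlgA K σ d)ˣ)
    (hV : ∀ v ∈ constPart K σ d, y * v * (y⁻¹ : (AlgA K σ d)ˣ) ∈ constPart K σ d) :
    ∃ τ : E ≃ₐ[K] E, ∀ c, y * AlgA.ofHom K σ d (RatFunc.C c) * (y⁻¹ : (AlgA K σ d)ˣ) =
      AlgA.ofHom K σ d (RatFunc.C (τ c)) := by
  have : Finite K := Finite.of_injective _ (algebraMap K E).injective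
  -- `V` is finite, so the injective conjugation `V → V` is onto.
  have hsurj : ∀ v ∈ constPart K σ d, ∃ v' ∈ constPart K σ d,
      y * v' * (y⁻¹ : (AlgA K σ d)ˣ) = v := by
    have : Finite (constPart K σ d) := finite_constPart
    let φ : constPart K σ d → constPart K σ d := fun v => ⟨_, hV v v.2⟩
    have hφ : Function.Injective φ := by
      intro v v' h
      have := congrArg Subtype.val h
      exact Subtype.ext (by simpa [φ] using this)
    intro v hv
    obtain ⟨v', h⟩ := Finite.injective_iff_surjective.mp hφ ⟨v, hv⟩
    exact ⟨v', v'.2, congrArg Subtype.val h⟩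
  -- Since `c V ⊆ V` and `y V y⁻¹ = V`, the conjugate of `c` also multiplies `V` into itself, which
  -- characterises `E`.
  have hex : ∀ c, ∃ c', y * AlgA.ofHom K σ d (RatFunc.C c) * (y⁻¹ : (AlgA K σ d)ˣ) =
      AlgA.ofHom K σ d (RatFunc.C c') := by
    intro c
    refine exists_const_of_mul_mem hσ x hx hord hd (hV _ (const_mem K σ d c hd)) fun v hv => ?_
    obtain ⟨v', hv', rfl⟩ := hsurj v hv
    have := hV _ (const_mul_mem K σ d c hv')
    convert this using 1
    simp only [mul_assoc, Units.inv_mul_cancel_left]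
  choose τ hτ using hex
  have hinj : Function.Injective fun c : E => AlgA.ofHom K σ d (RatFunc.C c) :=
    (ofHom_injective hσ x hx).comp RatFunc.C_injective
  let τ' : E →ₐ[K] E :=
    { toFun := τ
      map_one' := hinj (by
        dsimp only
        rw [← hτ]
        simp)
      map_zero' := hinj (by
        dsimp only
        rw [← hτ]
        simp)
      map_mul' := fun a b => hinj (by
        dsimp only
        rw [← hτ, map_mul, map_mul, map_mul, map_mul, ← hτ, ← hτ]
        simp only [mul_assoc, Units.inv_mul_cancel_left])
      map_add' := fun a b => hinj (by
        dsimp only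
        rw [← hτ, map_add, map_add, map_add, map_add, ← hτ, ← hτ, mul_add, add_mul])
      commutes' := fun k => hinj (by
        dsimp only
        rw [← hτ, ← ratMap_C (algebraMap K E) k, ← (AlgA.commute_base K σ d _ _).eq,
          Units.mul_inv_cancel_right]) }
  exact ⟨AlgEquiv.ofBijective τ' (Finite.injective_iff_bijective.mp τ'.toRingHom.injective), hτ⟩


/-- A unit of `𝒜` whose conjugation maps `𝒜₀` into itself and `End(E[[Y]])` into itself acts, up to
a scalar, as `w t ^ j` with `w ∈ Eˣ`. -/
theorem exists_eq_smul_of_conj (hord : orderOf σ = d) (hd : 2 ≤ d)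
    (hgen : ∀ τ : E ≃ₐ[K] E, τ ∈ Subgroup.zpowers σ) (y : (AlgA K σ d)ˣ)
    (hy : ∀ z ∈ AlgA.zero K σ d, y * z * (y⁻¹ : (AlgA K σ d)ˣ) ∈ AlgA.zero K σ d)
    (hL : ∀ T : Module.End K⸨X⸩ E⸨X⸩, (∀ w ∈ integers E, T w ∈ integers E) → ∀ w ∈ integers E,
      (Psi σ d hσ x hx y * T * Psi σ d hσ x hx (y⁻¹ : (AlgA K σ d)ˣ)) w ∈ integers E) :
    ∃ j < d, ∃ (w : Eˣ) (k : K⸨X⸩), k ≠ 0 ∧ Psi σ d hσ x hx y =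
      k • Psi σ d hσ x hx (AlgA.constUnit K σ d w * AlgA.t K σ d ^ j) := by
  have hd0 : 0 < d := by omega
  have : Finite K := Finite.of_injective _ (algebraMap K E).injective
  have : FiniteDimensional K E := Module.Finite.of_finite
  obtain ⟨hxi, hx0⟩ := unit_of_laurentNorm σ hd0 hx
  have hV : ∀ v ∈ constPart K σ d, y * v * (y⁻¹ : (AlgA K σ d)ˣ) ∈ constPart K σ d := by
    intro v hv
    refine mem_constPart_of_Psi hσ x hx hord hd0 (hy v (constPart_subset K σ d hv)) fun w hw => ?_
    rw [map_mul, map_mul]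
    exact hL _ (fun w hw => Psi_mem_of_constPart hσ x hx hd0 hv hw) w hw
  obtain ⟨τ, hτ⟩ := exists_algEquiv_of_conj hσ x hx hord hd0 y hV
  obtain ⟨j, hj, rfl⟩ := exists_pow_eq σ hord hd0 hgen τ
  -- Conjugation by `t ^ j` also acts as `σ ^ j` on `E`, so the remaining factor `y'` centralises
  -- `E`.
  obtain ⟨y', rfl⟩ : ∃ y', y = y' * AlgA.tUnit K σ d hd0 ^ j :=
    ⟨y * (AlgA.tUnit K σ d hd0 ^ j)⁻¹, by simp⟩
  have hconst : ∀ c, Commute (y' : AlgA K σ d) (AlgA.ofHom K σ d (RatFunc.C c)) := by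
    intro c
    have h := hτ ((σ ^ j).symm c)
    rw [AlgEquiv.apply_symm_apply, Units.mul_inv_eq_iff_eq_mul, Units.val_mul, Units.val_pow_eq_pow_val,
      AlgA.tUnit_val, mul_assoc, AlgA.t_pow_mul_of, AlgA.ratMap_pow_C, AlgEquiv.apply_symm_apply, ← mul_assoc,
      ← mul_assoc, ← AlgA.tUnit_val K σ d hd0, ← Units.val_pow_eq_pow_val, Units.mul_left_inj] at h
    exact h
  have ht : (y' : AlgA K σ d) * AlgA.t K σ d * (y'⁻¹ : (AlgA K σ d)ˣ) ∈ constPart K σ d := by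
    have h := hV _ (t_pow_mem K σ d (n := 1) (by omega))
    rw [pow_one] at h
    convert h using 1
    rw [mul_inv_rev, Units.val_mul, Units.val_mul, ← AlgA.tUnit_val K σ d hd0, ← Units.val_mul,
      ← Units.val_mul, ← Units.val_mul, ← Units.val_mul, ← Units.val_mul, ← Units.val_mul]
    congr 1
    group
  set T := Psi σ d hσ x hx y' with hT
  have hmul : ∀ z, T z = T 1 * z := by
    refine eq_mulLeft_of_commute T fun c z => ?_
    rw [← Psi_const σ d hσ x hx, ← Psi_const σ d hσ x hx, ← Module.End.mul_apply,
      ← Module.End.mul_apply, hT, ← map_mul, ← map_mul, (hconst c).eq]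
  obtain ⟨c, hc⟩ := ht
  dsimp only at hc
  -- Apply `Ψ` to `y' t = (∑ c_m t ^ m) y'` and compare the coefficients of `σ ^ 1`, both sides
  -- being combinations of the powers of `σ`. The index `1` exists because `2 ≤ d`.
  have hr : T 1 = HahnSeries.single 0 (c ⟨1, by omega⟩) * sigmaLin σ (T 1) := by
    have h1 : ∀ z, ∑ m : Fin d, (if m = ⟨1, by omega⟩ then T 1 * x else 0) *
        (sigmaLin σ ^ (m : ℕ)) z = ∑ m : Fin d, (HahnSeries.single 0 (c m) * twist σ x m *
          (sigmaLin σ ^ (m : ℕ)) (T 1)) * (sigmaLin σ ^ (m : ℕ)) z := by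
      intro z
      have h2 := congrArg (fun v => Psi σ d hσ x hx (v * y') z) hc
      rw [Units.inv_mul_cancel_right, map_mul, map_mul, Module.End.mul_apply,
        Module.End.mul_apply, Psi_sum, Psi_t, ← hT, hmul z,
        hmul (x * sigmaLin σ z)] at h2
      rw [Finset.sum_eq_single ⟨1, by omega⟩ (fun m _ hm => by simp [hm]) (by simp), if_pos rfl,
        pow_one, mul_assoc, ← h2]
      refine Finset.sum_congr rfl fun m _ => ?_
      rw [sigmaLin_pow_mul, ratToLaurent_C, ← mul_assoc]
    have h3 := congrFun (Psi_eq_sum_unique hord _ _ h1) ⟨1, by omega⟩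
    have hx' : x ≠ 0 := fun h => hx0 (by rw [h]; rfl)
    have h4 : twist σ x 1 = x := by simp [twist]
    rw [if_pos rfl, h4, pow_one] at h3
    refine mul_right_cancel₀ hx' (h3.trans ?_)
    ring
  have hT1 : T 1 ≠ 0 := by
    intro h
    have h1 : T = 0 := LinearMap.ext fun z => by rw [hmul, h, zero_mul, LinearMap.zero_apply]
    have h2 : T * Psi σ d hσ x hx (y'⁻¹ : (AlgA K σ d)ˣ) = 1 := by
      rw [hT, ← map_mul, Units.mul_inv, map_one]
    rw [h1, zero_mul] at h2
    exact zero_ne_one (α := E⸨X⸩) (LinearMap.congr_fun h2 1)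
  obtain ⟨n, hn⟩ : ∃ n, (T 1).coeff n ≠ 0 := by
    by_contra! h
    exact hT1 (HahnSeries.ext (funext h))
  have hcoeff : ∀ m, (T 1).coeff m = c ⟨1, by omega⟩ * σ ((T 1).coeff m) := by
    intro m
    conv_lhs => rw [hr, HahnSeries.coeff_single_zero_mul]
    rfl
  have hc1 : c ⟨1, by omega⟩ ≠ 0 := fun h => hn (by rw [hcoeff, h, zero_mul])
  let w : Eˣ := Units.mk0 _ hn
  -- All coefficients of `T 1` satisfy the same equation `a = c₁ σ(a)`, so dividing by one nonzero
  -- coefficient `w` gives a series fixed by `σ`.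
  obtain ⟨k, hk⟩ : ∃ k : K⸨X⸩, laurentMap (algebraMap K E) k =
      HahnSeries.single 0 ((w⁻¹ : Eˣ) : E) * T 1 := by
    refine exists_laurentMap_eq σ hgen ?_
    ext m
    rw [sigmaLin_mul, show sigmaLin σ (HahnSeries.single 0 ((w⁻¹ : Eˣ) : E)) =
      HahnSeries.single 0 (σ ((w⁻¹ : Eˣ) : E)) from laurentMap_single _ _ _,
      HahnSeries.coeff_single_zero_mul, HahnSeries.coeff_single_zero_mul]
    change σ ((w⁻¹ : Eˣ) : E) * σ ((T 1).coeff m) = _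
    have hw : (w : E) = c ⟨1, by omega⟩ * σ (w : E) := hcoeff n
    have hσw : σ (w : E) ≠ 0 := by simp
    rw [Units.val_inv_eq_inv_val, map_inv₀]
    conv_rhs => rw [hw, hcoeff m]
    field_simp
  have hTk : T 1 = HahnSeries.single 0 (w : E) * laurentMap (algebraMap K E) k := by
    rw [hk, ← mul_assoc, HahnSeries.single_mul_single, Units.mul_inv, add_zero]
    exact (one_mul _).symm
  refine ⟨j, hj, w, k, ?_, ?_⟩
  · rintro rfl
    rw [map_zero, mul_zero] at hTk
    exact hT1 hTk
  · refine LinearMap.ext fun z => ?_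
    rw [Units.val_mul, Units.val_pow_eq_pow_val, AlgA.tUnit_val, map_mul, ← hT,
      LinearMap.smul_apply, map_mul, Module.End.mul_apply, Module.End.mul_apply, hmul,
      AlgA.constUnit_val, Psi_const, hTk, laurent_smul_def]
    ring

end Stabilizer

/-! ### Integral matrices and `GL_d(F[[t]])`. -/

section IntegralMatrices

variable {d : ℕ} {F : Type*} [Field F]

variable (d F) in
/-- The subgroup `GL_d(F[[t]])` of `GL_d(F((t)))`. -/
def intGL : Subgroup (GL (Fin d) F⸨X⸩) :=
  (Matrix.GeneralLinearGroup.map (n := Fin d) (algebraMap (PowerSeries F) F⸨X⸩)).range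

theorem exists_map_eq {A : Matrix (Fin d) (Fin d) F⸨X⸩} (hA : ∀ i j, A i j ∈ integers F) :
    ∃ A' : Matrix (Fin d) (Fin d) (PowerSeries F), A'.map (algebraMap _ F⸨X⸩) = A := by
  choose A' hA' using hA
  exact ⟨Matrix.of A', Matrix.ext hA'⟩

theorem det_map_algebraMap (A : Matrix (Fin d) (Fin d) (PowerSeries F)) :
    (A.map (algebraMap (PowerSeries F) F⸨X⸩)).det = algebraMap (PowerSeries F) F⸨X⸩ A.det :=
  (RingHom.map_det _ A).symm

theorem det_mem_integers {A : Matrix (Fin d) (Fin d) F⸨X⸩} (hA : ∀ i j, A i j ∈ integers F) :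
    A.det ∈ integers F := by
  obtain ⟨A, rfl⟩ := exists_map_eq hA
  exact ⟨A.det, (det_map_algebraMap A).symm⟩

theorem mem_intGL_of_det {g : GL (Fin d) F⸨X⸩} (hg : ∀ i j, g i j ∈ integers F)
    (h0 : (g : Matrix (Fin d) (Fin d) F⸨X⸩).det.coeff 0 ≠ 0) : g ∈ intGL d F := by
  obtain ⟨A, hA⟩ := exists_map_eq (A := (g : Matrix (Fin d) (Fin d) F⸨X⸩)) hg
  rw [← hA, det_map_algebraMap, coeff_zero_algebraMap] at h0
  have : IsUnit A.det := by
    rw [PowerSeries.isUnit_iff_constantCoeff]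
    exact h0.isUnit
  refine ⟨Matrix.GeneralLinearGroup.mk'' A this, Units.ext ?_⟩
  rw [← hA]
  rfl

theorem apply_mem_of_mem_intGL {g : GL (Fin d) F⸨X⸩} (hg : g ∈ intGL d F) (i j : Fin d) :
    g i j ∈ integers F := by
  obtain ⟨A, rfl⟩ := hg
  exact ⟨A i j, rfl⟩

theorem mem_intGL_iff {g : GL (Fin d) F⸨X⸩} :
    g ∈ intGL d F ↔ (∀ i j, g i j ∈ integers F) ∧
      ∀ i j, (g⁻¹ : GL (Fin d) F⸨X⸩) i j ∈ integers F := by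
  refine ⟨fun h => ⟨apply_mem_of_mem_intGL h, apply_mem_of_mem_intGL (inv_mem h)⟩, fun h => ?_⟩
  refine mem_intGL_of_det h.1 fun h0 => ?_
  have h1 := coeff_zero_mul (det_mem_integers h.1) (det_mem_integers h.2)
  rw [← Matrix.det_mul, Units.mul_inv, Matrix.det_one, h0, zero_mul] at h1
  simp at h1

variable {ι V : Type*} [Fintype ι] [DecidableEq ι] [AddCommGroup V] [Module F V]

theorem toMatrix_mul_apply (B : Module.Basis ι F V) (f : Module.End F V) (M : Matrix ι ι F)
    (i j : ι) : (LinearMap.toMatrixAlgEquiv B f * M) i j =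
      B.repr (f (∑ k, M k j • B k)) i := by
  obtain ⟨f', rfl⟩ := (LinearMap.toMatrixAlgEquiv B).surjective M
  rw [← map_mul, LinearMap.toMatrixAlgEquiv_apply, Module.End.mul_apply]
  congr 3
  conv_lhs => rw [← B.sum_repr (f' (B j))]
  simp only [LinearMap.toMatrixAlgEquiv_apply]

end IntegralMatrices

/-! ### The action of `1 - t` on `E[[Y]]`. -/

section Transitivity

variable {K E : Type*} [Field K] [Field E] [Algebra K E] {σ : E ≃ₐ[K] E} {d : ℕ}
  (hσ : σ ^ d = 1) (x : E⸨X⸩) (hx : laurentNorm σ d x = 1 + HahnSeries.single 1 1)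

/-- The representation `Ψ` on the units of `𝒜`, in a basis. -/
def psiGL (β : Module.Basis (Fin d) K⸨X⸩ E⸨X⸩) : (AlgA K σ d)ˣ →* GL (Fin d) K⸨X⸩ :=
  Units.map (psiMatrix σ d hσ x hx β).toMonoidHom

theorem psiGL_val (β : Module.Basis (Fin d) K⸨X⸩ E⸨X⸩) (y : (AlgA K σ d)ˣ) :
    (psiGL hσ x hx β y : Matrix (Fin d) (Fin d) K⸨X⸩) =
      LinearMap.toMatrixAlgEquiv β (Psi σ d hσ x hx y) := rfl

/-- The geometric sum `∑_{k < d} t ^ k`. -/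
def geomT (K : Type*) {E : Type*} [Field K] [Field E] [Algebra K E] (σ : E ≃ₐ[K] E) (d : ℕ) :
    AlgA K σ d := ∑ k ∈ Finset.range d, AlgA.t K σ d ^ k

theorem Psi_geomT (y : E⸨X⸩) : Psi σ d hσ x hx (geomT K σ d) y =
    ∑ m : Fin d, twist σ x m * (sigmaLin σ ^ (m : ℕ)) y := by
  rw [geomT, map_sum, LinearMap.sum_apply, ← Fin.sum_univ_eq_sum_range
    (fun m => Psi σ d hσ x hx (AlgA.t K σ d ^ m) y)]
  simp only [Psi_t_pow]

theorem Psi_geomT_mem (hd : 0 < d) {y : E⸨X⸩} (hy : y ∈ integers E) :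
    Psi σ d hσ x hx (geomT K σ d) y ∈ integers E := by
  obtain ⟨hxi, -⟩ := unit_of_laurentNorm σ hd hx
  rw [Psi_geomT]
  exact sum_mem fun m _ => mul_mem (twist_mem σ hxi m) (sigmaLin_pow_mem_integers σ m hy)

/-- This yields `Y E[[Y]] ⊆ (1 - t) E[[Y]]`, so the image of `1 - t` is determined by its reduction
modulo `Y`. -/
theorem Psi_oneSubT_geomT (y : E⸨X⸩) :
    Psi σ d hσ x hx (AlgA.oneSubT K σ d) (Psi σ d hσ x hx (geomT K σ d) y) =
      -(HahnSeries.single 1 1 * y) := by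
  rw [← Module.End.mul_apply, ← map_mul, AlgA.oneSubT_val, geomT, AlgA.one_sub_t_mul_geom, map_neg,
    LinearMap.neg_apply, Psi_of, ratToLaurent_X]

theorem Psi_geomT_oneSubT (y : E⸨X⸩) :
    Psi σ d hσ x hx (geomT K σ d) (Psi σ d hσ x hx (AlgA.oneSubT K σ d) y) =
      -(HahnSeries.single 1 1 * y) := by
  rw [← Module.End.mul_apply, ← map_mul, AlgA.oneSubT_val, geomT, AlgA.geom_mul_one_sub_t, map_neg,
    LinearMap.neg_apply, Psi_of, ratToLaurent_X]

theorem Psi_oneSubT (y : E⸨X⸩) :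
    Psi σ d hσ x hx (AlgA.oneSubT K σ d) y = y - x * sigmaLin σ y := by
  rw [AlgA.oneSubT_val, map_sub, map_one, LinearMap.sub_apply, Psi_t, Module.End.one_apply]

/-- `1 - t` does not map `E[[Y]]` onto itself. -/
theorem not_surjective_oneSubT (hord : orderOf σ = d) (hd : 0 < d)
    (h : ∀ y ∈ integers E, ∃ z ∈ integers E, Psi σ d hσ x hx (AlgA.oneSubT K σ d) z = y) :
    False := by
  obtain ⟨hxi, hx0⟩ := unit_of_laurentNorm σ hd hx
  -- If `1 - t` were onto, then `∑ t ^ k = -Y (1 - t)⁻¹` would vanish modulo `Y`, against the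
  -- independence of the powers of `σ`.
  have hker : ∀ c : E, ∑ m : Fin d, (twist σ x m).coeff 0 * (σ ^ (m : ℕ)) c = 0 := by
    intro c
    obtain ⟨z, hz, hzc⟩ := h _ (single_mem_integers c le_rfl)
    have h1 := Psi_geomT_oneSubT hσ x hx z
    rw [hzc, Psi_geomT] at h1
    have h2 := congrArg (fun w : E⸨X⸩ => w.coeff 0) h1
    have h3 : (HahnSeries.single 1 1 * z : E⸨X⸩).coeff 0 = 0 := by
      rw [show (0 : ℤ) = -1 + 1 by norm_num, HahnSeries.coeff_single_mul_add, one_mul]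
      exact mem_integers_iff.mp hz _ (by norm_num)
    rw [HahnSeries.coeff_neg, h3, neg_zero, HahnSeries.coeff_sum] at h2
    simpa only [sigmaLin_single, HahnSeries.coeff_mul_single_zero] using h2
  have := congrFun (eq_zero_of_sum_mul_pow σ hord _ hker) ⟨0, hd⟩
  exact twist_coeff_zero_ne σ hxi hx0 0 this

/-- The `K`-linear map `c ↦ c - a σ(c)` of `E`. -/
def oneSubTwist (σ : E ≃ₐ[K] E) (a : E) : E →ₗ[K] E :=
  LinearMap.id - LinearMap.mulLeft K a ∘ₗ σ.toLinearMap

theorem oneSubTwist_apply (a c : E) : oneSubTwist σ a c = c - a * σ c := rfl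

variable [Finite E]

/-- The quotient of two nonzero solutions of `a σ(c) = c` is fixed by `σ`, hence lies in `K`. -/
theorem finrank_ker_oneSubTwist_le (hgen : ∀ τ : E ≃ₐ[K] E, τ ∈ Subgroup.zpowers σ) {a : E}
    (ha : a ≠ 0) : Module.finrank K (LinearMap.ker (oneSubTwist σ a)) ≤ 1 := by
  have hker : ∀ c, c ∈ LinearMap.ker (oneSubTwist σ a) ↔ a * σ c = c := fun c => by
    rw [LinearMap.mem_ker, oneSubTwist_apply, sub_eq_zero, eq_comm]
  rw [finrank_le_one_iff]
  by_cases h : ∀ v : LinearMap.ker (oneSubTwist σ a), v = 0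
  · exact ⟨0, fun w => ⟨0, by rw [h w, smul_zero]⟩⟩
  · push Not at h
    obtain ⟨v, hv⟩ := h
    refine ⟨v, fun w => ?_⟩
    have hv0 : (v : E) ≠ 0 := fun h => hv (Subtype.ext h)
    have hσv : σ (v : E) ≠ 0 := by simpa using hv0
    obtain ⟨k, hk⟩ := exists_algebraMap_eq σ hgen (c := (w : E) / v) (by
      conv_rhs => rw [← (hker w).mp w.2, ← (hker v).mp v.2]
      rw [map_div₀]
      field_simp)
    refine ⟨k, Subtype.ext ?_⟩
    rw [Submodule.coe_smul, Algebra.smul_def, hk, div_mul_cancel₀ _ hv0]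

/-- By rank-nullity the range has codimension at most one. If it is everything, any nonzero
functional serves. -/
theorem exists_ker_le_range_oneSubTwist (hgen : ∀ τ : E ≃ₐ[K] E, τ ∈ Subgroup.zpowers σ) {a : E}
    (ha : a ≠ 0) : ∃ φ : Module.Dual K E, φ ≠ 0 ∧
      LinearMap.ker φ ≤ LinearMap.range (oneSubTwist σ a) := by
  have : Finite K := Finite.of_injective _ (algebraMap K E).injective
  have : FiniteDimensional K E := Module.Finite.of_finite
  by_cases htop : LinearMap.range (oneSubTwist σ a) = ⊤
  · obtain ⟨φ, hφ⟩ := exists_ne (0 : Module.Dual K E)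
    exact ⟨φ, hφ, htop ▸ le_top⟩
  · obtain ⟨φ, hφ, hle⟩ := Submodule.exists_le_ker_of_lt_top _ (lt_top_iff_ne_top.mpr htop)
    refine ⟨φ, hφ, (Submodule.eq_of_le_of_finrank_le hle ?_).ge⟩
    have h1 := LinearMap.finrank_range_add_finrank_ker (oneSubTwist σ a)
    have h2 := LinearMap.finrank_range_add_finrank_ker φ
    have h3 := finrank_ker_oneSubTwist_le hgen ha
    have h4 : 0 < Module.finrank K (LinearMap.range φ) := by
      rw [LinearMap.range_eq_top.mpr (LinearMap.surjective hφ), finrank_top]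
      exact Module.finrank_pos
    omega

/-- Every functional on `E` is of the form `c ↦ φ (a c)`, for any given nonzero functional `φ`. -/
theorem exists_eq_comp_mulLeft {φ : Module.Dual K E} (hφ : φ ≠ 0) (ψ : Module.Dual K E) :
    ∃ a : E, ∀ c, ψ c = φ (a * c) := by
  have : Finite K := Finite.of_injective _ (algebraMap K E).injective
  have : FiniteDimensional K E := Module.Finite.of_finite
  let f : E →ₗ[K] Module.Dual K E := (LinearMap.mul K E).compr₂ φ
  have hf : Function.Injective f := by
    rw [injective_iff_map_eq_zero]
    intro a ha
    by_contra ha0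
    refine hφ (LinearMap.ext fun c => ?_)
    have := LinearMap.congr_fun ha (a⁻¹ * c)
    simpa [f, mul_inv_cancel_left₀ ha0] using this
  obtain ⟨a, ha⟩ := (LinearMap.injective_iff_surjective_of_finrank_eq_finrank
    Subspace.dual_finrank_eq.symm).mp hf ψ
  exact ⟨a, fun c => (LinearMap.congr_fun ha c).symm⟩

/-- Every hyperplane of `E[[Y]] / Y E[[Y]]` contains the reduction of some `u (1 - t) E[[Y]]`. -/
theorem exists_unit_of_functional (hd : 0 < d)
    (hgen : ∀ τ : E ≃ₐ[K] E, τ ∈ Subgroup.zpowers σ) {ψ : Module.Dual K E} (hψ : ψ ≠ 0) :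
    ∃ u : Eˣ, ∀ y ∈ integers E, ψ (y.coeff 0) = 0 → ∃ z ∈ integers E,
      Psi σ d hσ x hx (AlgA.constUnit K σ d u * AlgA.oneSubT K σ d : (AlgA K σ d)ˣ) z = y := by
  obtain ⟨hxi, hx0⟩ := unit_of_laurentNorm σ hd hx
  obtain ⟨φ, hφ, hker⟩ := exists_ker_le_range_oneSubTwist hgen hx0
  -- Multiplication by `a` carries the kernel of `ψ` into the kernel of `φ`, hence into the
  -- reduction of `(1 - t) E[[Y]]`; so the required unit is `a⁻¹`.
  obtain ⟨a, ha⟩ := exists_eq_comp_mulLeft hφ ψ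
  have ha0 : a ≠ 0 := by
    rintro rfl
    exact hψ (LinearMap.ext fun c => by simp [ha])
  refine ⟨(Units.mk0 a ha0)⁻¹, fun y hy h0 => ?_⟩
  rw [ha] at h0
  obtain ⟨e, he⟩ := hker h0
  rw [oneSubTwist_apply] at he
  have hsingle : ∀ c : E, (HahnSeries.single 0 c : E⸨X⸩) ∈ integers E := fun c =>
    single_mem_integers c le_rfl
  have hσe : sigmaLin σ (HahnSeries.single 0 e) = HahnSeries.single 0 (σ e) :=
    laurentMap_single _ _ _
  -- The constant `e` solves `(1 - t) z = a y` modulo `Y`. The error is `Y g`, which equals `-(1 -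
  -- t) (∑ t ^ k) g`, so `z = e - (∑ t ^ k) g` is an exact solution.
  obtain ⟨g, hg, hgy⟩ := exists_eq_single_mul
    (f := HahnSeries.single 0 a * y - Psi σ d hσ x hx (AlgA.oneSubT K σ d) (HahnSeries.single 0 e))
    (by
      rw [Psi_oneSubT, hσe]
      exact sub_mem (mul_mem (hsingle _) hy) (sub_mem (hsingle _) (mul_mem hxi (hsingle _))))
    (by
      rw [Psi_oneSubT, hσe, HahnSeries.coeff_sub, HahnSeries.coeff_sub,
        HahnSeries.coeff_single_zero_mul, HahnSeries.coeff_mul_single_zero,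
        HahnSeries.coeff_single_same, he, sub_self])
  refine ⟨HahnSeries.single 0 e - Psi σ d hσ x hx (geomT K σ d) g,
    sub_mem (hsingle _) (Psi_geomT_mem hσ x hx hd hg), ?_⟩
  rw [Units.val_mul, map_mul, Module.End.mul_apply, map_sub, Psi_oneSubT_geomT, ← hgy,
    AlgA.constUnit_val, Psi_const, sub_neg_eq_add, add_sub_cancel, ← mul_assoc,
    HahnSeries.single_mul_single, Units.val_inv_eq_inv_val, Units.val_mk0, inv_mul_cancel₀ ha0,
    add_zero]
  exact one_mul y

end Transitivity

/-! ### Factorisation of `GL_d(K((Y)))` by reduction of determinants. -/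

section Orbit

variable {K E : Type*} [Field K] [Field E] [Algebra K E] {σ : E ≃ₐ[K] E} {d : ℕ}
  (hσ : σ ^ d = 1) (x : E⸨X⸩) (hx : laurentNorm σ d x = 1 + HahnSeries.single 1 1)
  (b : Module.Basis (Fin d) K E)

theorem toMatrix_apply_mem (f : Module.End K⸨X⸩ E⸨X⸩) (hf : ∀ y ∈ integers E, f y ∈ integers E)
    (i j : Fin d) : LinearMap.toMatrixAlgEquiv (constantBasis b) f i j ∈ integers K := by
  rw [LinearMap.toMatrixAlgEquiv_apply]
  refine (mem_integers_iff_repr b _).mp (hf _ ?_) i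
  rw [constantBasis_apply]
  exact single_mem_integers _ le_rfl

theorem apply_mem_of_toMatrix (f : Module.End K⸨X⸩ E⸨X⸩)
    (hf : ∀ i j, LinearMap.toMatrixAlgEquiv (constantBasis b) f i j ∈ integers K) {y : E⸨X⸩}
    (hy : y ∈ integers E) : f y ∈ integers E := by
  rw [mem_integers_iff_repr b] at hy ⊢
  intro i
  have : (constantBasis b).repr (f y) i =
      ∑ j, LinearMap.toMatrixAlgEquiv (constantBasis b) f i j * (constantBasis b).repr y j :=
    (congrFun (LinearMap.toMatrix_mulVec_repr (constantBasis b) (constantBasis b) f y) i).symm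
  rw [this]
  exact sum_mem fun j _ => mul_mem (hf i j) (hy j)

theorem constUnit_mul_apply_mem (hd : 0 < d) (u : Eˣ) {y : E⸨X⸩} (hy : y ∈ integers E) :
    Psi σ d hσ x hx (AlgA.constUnit K σ d u * AlgA.oneSubT K σ d : (AlgA K σ d)ˣ) y ∈
      integers E := by
  obtain ⟨hxi, -⟩ := unit_of_laurentNorm σ hd hx
  rw [Units.val_mul, map_mul, Module.End.mul_apply, Psi_oneSubT, AlgA.constUnit_val, Psi_const]
  refine mul_mem (single_mem_integers _ le_rfl) (sub_mem hy (mul_mem hxi ?_))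
  simpa using sigmaLin_pow_mem_integers σ 1 hy

/-- The determinant of `u (1 - t)` is an integral non-unit. -/
theorem coeff_zero_det_step (hord : orderOf σ = d) (hd : 0 < d) (u : Eˣ) :
    (psiGL hσ x hx (constantBasis b) (AlgA.constUnit K σ d u * AlgA.oneSubT K σ d) :
      Matrix (Fin d) (Fin d) K⸨X⸩).det.coeff 0 = 0 := by
  by_contra h0
  -- A unit determinant would make the inverse matrix integral, so `1 - t` would be onto on
  -- `E[[Y]]`.
  have hmem := mem_intGL_of_det (fun i j => toMatrix_apply_mem b _
    (fun y hy => constUnit_mul_apply_mem hσ x hx hd u hy) i j) h0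
  have hinv := inv_mem hmem
  rw [← map_inv] at hinv
  refine not_surjective_oneSubT hσ x hx hord hd fun y hy => ?_
  refine ⟨_, apply_mem_of_toMatrix b _ (apply_mem_of_mem_intGL hinv)
    (mul_mem (single_mem_integers (u : E) le_rfl) hy), ?_⟩
  have h1 := Psi_const σ d hσ x hx ((u⁻¹ : Eˣ) : E)
  have hone : (1 : AlgA K σ d) = AlgA.constUnit K σ d u⁻¹ * AlgA.constUnit K σ d u := by
    rw [map_inv, Units.inv_mul]
  have h2 : (AlgA.oneSubT K σ d : AlgA K σ d) = AlgA.constUnit K σ d u⁻¹ *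
      (AlgA.constUnit K σ d u * AlgA.oneSubT K σ d : (AlgA K σ d)ˣ) := by
    rw [Units.val_mul, ← mul_assoc, ← hone, one_mul]
  rw [← Module.End.mul_apply, ← map_mul, h2, mul_assoc, Units.mul_inv, mul_one,
    AlgA.constUnit_val, Psi_const, ← mul_assoc, HahnSeries.single_mul_single, Units.inv_mul,
    add_zero]
  exact one_mul y

variable [Finite E]

/-- One step of the reduction of an integral matrix whose determinant is not a unit. -/
theorem exists_reduction (hd : 0 < d) (hgen : ∀ τ : E ≃ₐ[K] E, τ ∈ Subgroup.zpowers σ)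
    {T : Matrix (Fin d) (Fin d) K⸨X⸩} (hT : ∀ i j, T i j ∈ integers K) (h0 : T.det.coeff 0 = 0) :
    ∃ (u : Eˣ) (T' : Matrix (Fin d) (Fin d) K⸨X⸩), (∀ i j, T' i j ∈ integers K) ∧
      T = psiGL hσ x hx (constantBasis b) (AlgA.constUnit K σ d u * AlgA.oneSubT K σ d) * T' := by
  obtain ⟨A, rfl⟩ := exists_map_eq hT
  rw [det_map_algebraMap, coeff_zero_algebraMap, RingHom.map_det] at h0
  -- The reduction of `T` is singular. A left null vector is a functional `ψ` on `E` killing the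
  -- constant term of every column.
  obtain ⟨v, hv, hvA⟩ := Matrix.exists_vecMul_eq_zero_iff.mpr h0
  let ψ : Module.Dual K E := b.constr K v
  have hψ : ψ ≠ 0 := by
    intro h
    refine hv (funext fun i => ?_)
    rw [← b.constr_basis K v i]
    exact LinearMap.congr_fun h (b i)
  obtain ⟨u, hu⟩ := exists_unit_of_functional hσ x hx hd hgen hψ
  -- The columns of `T`, read as elements of `E[[Y]]`. Each has a preimage `z j` under `u (1 - t)`
  -- in `E[[Y]]`, and these preimages are the columns of `T'`.
  let w : Fin d → E⸨X⸩ := fun j => ∑ k, algebraMap _ K⸨X⸩ (A k j) • constantBasis b k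
  have hw : ∀ j, w j ∈ integers E := fun j => sum_mem fun k _ =>
    smul_mem_integers ⟨A k j, rfl⟩ (by
      rw [constantBasis_apply]
      exact single_mem_integers _ le_rfl)
  have hw0 : ∀ j, ψ ((w j).coeff 0) = 0 := by
    intro j
    have : (w j).coeff 0 = ∑ k, PowerSeries.constantCoeff (A k j) • b k := by
      simp only [w, HahnSeries.coeff_sum, constantBasis_apply, coeff_smul_single,
        coeff_zero_algebraMap]
    rw [this, map_sum]
    simp only [map_smul, ψ, b.constr_basis, smul_eq_mul]
    rw [← show (Matrix.vecMul v (A.map PowerSeries.constantCoeff)) j = 0 from congrFun hvA j]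
    simp only [Matrix.vecMul, dotProduct, Matrix.map_apply]
    exact Finset.sum_congr rfl fun k _ => mul_comm _ _
  choose z hz hzw using fun j => hu (w j) (hw j) (hw0 j)
  refine ⟨u, Matrix.of fun i j => (constantBasis b).repr (z j) i,
    fun i j => (mem_integers_iff_repr b _).mp (hz j) i, ?_⟩
  ext1 i j
  rw [psiGL_val, toMatrix_mul_apply]
  have : ∑ k, (Matrix.of fun i j => (constantBasis b).repr (z j) i) k j • constantBasis b k = z j :=
    (constantBasis b).sum_repr (z j)
  rw [this, hzw]
  exact (congrFun ((constantBasis b).repr_sum_self fun k => algebraMap _ K⸨X⸩ (A k j)) i).symm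

/-- Strong induction on the valuation `n` of the determinant. If it is not a unit, split off a
factor `u (1 - t)`, whose determinant is divisible by `Y`; otherwise `T` itself lies in
`GL_d(K[[Y]])`. -/
theorem exists_eq_mul_of_integral (hord : orderOf σ = d) (hd : 0 < d)
    (hgen : ∀ τ : E ≃ₐ[K] E, τ ∈ Subgroup.zpowers σ) (n : ℕ) :
    ∀ T : GL (Fin d) K⸨X⸩, (∀ i j, T i j ∈ integers K) →
      (∃ u : K⸨X⸩, u ∈ integers K ∧ u.coeff 0 ≠ 0 ∧
        (T : Matrix (Fin d) (Fin d) K⸨X⸩).det = HahnSeries.single (n : ℤ) 1 * u) →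
      ∃ y ∈ AlgA.conjStab K σ d, ∃ R ∈ intGL d K, T = psiGL hσ x hx (constantBasis b) y * R := by
  induction n using Nat.strong_induction_on with
  | _ n ih =>
    rintro T hT ⟨u, hu, hu0, hdet⟩
    by_cases h0 : (T : Matrix (Fin d) (Fin d) K⸨X⸩).det.coeff 0 = 0
    · obtain ⟨w, T', hT', hTT'⟩ := exists_reduction hσ x hx b hd hgen hT h0
      set y := AlgA.constUnit K σ d w * AlgA.oneSubT K σ d with hy
      have hT'eq : ((psiGL hσ x hx (constantBasis b) y)⁻¹ * T : GL (Fin d) K⸨X⸩) = T' := by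
        rw [Units.val_mul, hTT', ← mul_assoc, Units.inv_mul, one_mul]
      have hD := congrArg Matrix.det hTT'
      rw [Matrix.det_mul] at hD
      have hD1 := coeff_zero_det_step hσ x hx b hord hd w
      have hD2 : (psiGL hσ x hx (constantBasis b) y : Matrix (Fin d) (Fin d) K⸨X⸩).det ∈
          integers K := det_mem_integers fun i j => toMatrix_apply_mem b _
            (fun y hy => constUnit_mul_apply_mem hσ x hx hd w hy) i j
      obtain ⟨g, hg, hDg⟩ := exists_eq_single_mul hD2 hD1
      have hdet0 : T'.det ≠ 0 := by
        rw [← hT'eq]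
        exact ((Matrix.isUnit_iff_isUnit_det _).mp (Units.isUnit _)).ne_zero
      obtain ⟨m, v, hv, hvi, hv0⟩ := exists_single_mul_unit hdet0
      have hm0 : 0 ≤ m := by
        by_contra hm
        refine hv0 ?_
        have := mem_integers_iff.mp (det_mem_integers hT') (0 + m) (by omega)
        rwa [hv, HahnSeries.coeff_single_mul_add, one_mul] at this
      -- If `n ≤ m`, cancelling `Y ^ n` exhibits the unit `u` as `Y ^ (m - n + 1)` times an integral
      -- series, so its constant term would vanish.
      have hmn : m < n := by
        by_contra hm
        refine hu0 ?_
        have h1 : HahnSeries.single (n : ℤ) (1 : K) * u =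
            HahnSeries.single (n : ℤ) 1 * (HahnSeries.single (m - n + 1) 1 * (g * v)) := by
          rw [← hdet, hD, hDg, hv, ← mul_assoc (HahnSeries.single (n : ℤ) (1 : K)),
            HahnSeries.single_mul_single, mul_one, mul_mul_mul_comm,
            HahnSeries.single_mul_single, mul_one]
          congr 2
          ring_nf
        have h2 := mul_left_cancel₀ (HahnSeries.single_ne_zero one_ne_zero) h1
        rw [h2, show (0 : ℤ) = (-(m - n + 1)) + (m - n + 1) by ring,
          HahnSeries.coeff_single_mul_add, one_mul]
        exact mem_integers_iff.mp (mul_mem hg hvi) _ (by omega)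
      lift m to ℕ using hm0
      obtain ⟨y', hy', R, hR, hyR⟩ := ih m (by exact_mod_cast hmn)
        ((psiGL hσ x hx (constantBasis b) y)⁻¹ * T) (by rw [hT'eq]; exact hT')
        ⟨v, hvi, hv0, by rw [hT'eq]; exact hv⟩
      refine ⟨y * y', mul_mem (mul_mem (AlgA.constUnit_mem K σ d w) (AlgA.oneSubT_mem K σ d)) hy',
        R, hR, ?_⟩
      rw [map_mul, mul_assoc, ← hyR, mul_inv_cancel_left]
    · exact ⟨1, one_mem _, T, mem_intGL_of_det hT h0, by rw [map_one, one_mul]⟩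

/-- The normaliser of `𝒜₀` acts transitively on the lattices, up to `GL_d(K[[Y]])`. -/
theorem exists_eq_psiGL_mul (hord : orderOf σ = d) (hd : 0 < d)
    (hgen : ∀ τ : E ≃ₐ[K] E, τ ∈ Subgroup.zpowers σ) (T : GL (Fin d) K⸨X⸩) :
    ∃ y ∈ AlgA.conjStab K σ d, ∃ R ∈ intGL d K,
      T = psiGL hσ x hx (constantBasis b) y * R := by
  -- Denominators are cleared by a power of the central unit `Y`, which normalises `𝒜₀`. The sum `M`
  -- of all exponents bounds each of them.
  choose N hN using fun i j => exists_single_mul_mem (T i j)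
  let M : ℕ := ∑ i, ∑ j, N i j
  have hM : ∀ i j, N i j ≤ M := fun i j =>
    (Finset.single_le_sum (f := fun j => N i j) (fun _ _ => Nat.zero_le _) (Finset.mem_univ j)).trans
      (Finset.single_le_sum (f := fun i => ∑ j, N i j) (fun _ _ => Nat.zero_le _)
        (Finset.mem_univ i))
  have hU : (psiGL hσ x hx (constantBasis b) (AlgA.uniformizerUnit K σ d ^ M) :
      Matrix (Fin d) (Fin d) K⸨X⸩) = (HahnSeries.single (M : ℤ) 1 : K⸨X⸩) • 1 := by
    have h1 : Psi σ d hσ x hx (AlgA.uniformizerUnit K σ d ^ M : (AlgA K σ d)ˣ) =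
        (HahnSeries.single (M : ℤ) 1 : K⸨X⸩) • 1 := by
      refine LinearMap.ext fun z => ?_
      rw [Units.val_pow_eq_pow_val, AlgA.uniformizerUnit_val, ← map_pow, Psi_of, map_pow,
        ratToLaurent_X, HahnSeries.single_pow, LinearMap.smul_apply, Module.End.one_apply,
        laurent_smul_def, laurentMap_single]
      simp
    rw [psiGL_val, h1, map_smul, map_one (LinearMap.toMatrixAlgEquiv _)]
  have hint : ∀ i j, (psiGL hσ x hx (constantBasis b) (AlgA.uniformizerUnit K σ d ^ M) * T) i j ∈
      integers K := by
    intro i j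
    rw [Units.val_mul, hU, smul_mul_assoc, one_mul]
    exact hN i j M (hM i j)
  set T' := psiGL hσ x hx (constantBasis b) (AlgA.uniformizerUnit K σ d ^ M) * T with hT'
  have hdet0 : (T' : Matrix (Fin d) (Fin d) K⸨X⸩).det ≠ 0 :=
    ((Matrix.isUnit_iff_isUnit_det _).mp (Units.isUnit _)).ne_zero
  obtain ⟨m, v, hv, hvi, hv0⟩ := exists_single_mul_unit hdet0
  have hm0 : 0 ≤ m := by
    by_contra hm
    refine hv0 ?_
    have := mem_integers_iff.mp (det_mem_integers hint) (0 + m) (by omega)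
    rwa [hv, HahnSeries.coeff_single_mul_add, one_mul] at this
  lift m to ℕ using hm0
  obtain ⟨y, hy, R, hR, h⟩ := exists_eq_mul_of_integral hσ x hx b hord hd hgen m T' hint
    ⟨v, hvi, hv0, hv⟩
  refine ⟨(AlgA.uniformizerUnit K σ d ^ M)⁻¹ * y,
    mul_mem (inv_mem (pow_mem (AlgA.uniformizerUnit_mem K σ d) M)) hy, R, hR, ?_⟩
  rw [map_mul, mul_assoc, ← h, hT', map_inv, inv_mul_cancel_left]

end Orbit

open Matrix.ProjGenLinGroup (mk)

/-! ### Lattices, vertices and their stabilisers. -/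

section StandardVertex

variable {d : ℕ} {F : Type*} [Field F]

theorem smul_fun_integers (c : PowerSeries F) (f : F⸨X⸩) (hf : f ∈ integers F) :
    c • f ∈ integers F := by
  rw [Algebra.smul_def]
  exact mul_mem ⟨c, rfl⟩ hf

theorem mem_stdLattice {v : Fin d → F⸨X⸩} :
    v ∈ (stdLattice d F).1 ↔ ∀ i, v i ∈ integers F := by
  constructor
  · intro hv
    induction hv using Submodule.span_induction with
    | mem v hv =>
      obtain ⟨j, rfl⟩ := hv
      intro i
      rw [Pi.basisFun_apply]
      by_cases h : i = j
      · subst h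
        rw [Pi.single_eq_same]
        exact one_mem _
      · rw [Pi.single_eq_of_ne h]
        exact zero_mem _
    | zero => exact fun i => zero_mem _
    | add v w _ _ hv hw => exact fun i => add_mem (hv i) (hw i)
    | smul c v _ hv => exact fun i => smul_fun_integers c _ (hv i)
  · intro hv
    choose c hc using hv
    have : v = ∑ i, c i • Pi.basisFun F⸨X⸩ (Fin d) i := by
      funext j
      rw [Finset.sum_apply, Finset.sum_eq_single j]
      · rw [Pi.smul_apply, Pi.basisFun_apply, Pi.single_eq_same, Algebra.smul_def, mul_one, hc]
      · intro i _ hij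
        rw [Pi.smul_apply, Pi.basisFun_apply, Pi.single_eq_of_ne hij.symm, smul_zero]
      · simp
    rw [this]
    exact sum_mem fun i _ => Submodule.smul_mem _ _ (Submodule.subset_span ⟨i, rfl⟩)

theorem smul_lattice_val (g : GL (Fin d) F⸨X⸩) (M : LatticeIn d F) :
    (g • M).1 = M.1.map (glLin g) := rfl

theorem glLin_basis (g : GL (Fin d) F⸨X⸩) (i j : Fin d) :
    glLin g (Pi.basisFun F⸨X⸩ (Fin d) j) i = g i j := by
  rw [Pi.basisFun_apply]
  exact congrFun (Matrix.mulVec_single_one (g : Matrix (Fin d) (Fin d) F⸨X⸩) j) i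

theorem mulVec_mem_stdLattice {g : GL (Fin d) F⸨X⸩} (hg : ∀ i j, g i j ∈ integers F)
    {v : Fin d → F⸨X⸩} (hv : v ∈ (stdLattice d F).1) : glLin g v ∈ (stdLattice d F).1 := by
  rw [mem_stdLattice] at hv ⊢
  intro i
  have : glLin g v i = ∑ j, g i j * v j := rfl
  rw [this]
  exact sum_mem fun j _ => mul_mem (hg i j) (hv j)

theorem apply_mem_of_smul_stdLattice {g : GL (Fin d) F⸨X⸩} (h : g • stdLattice d F = stdLattice d F)
    (i j : Fin d) : g i j ∈ integers F := by
  have h1 : glLin g (Pi.basisFun F⸨X⸩ (Fin d) j) ∈ (stdLattice d F).1 := by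
    rw [← h, smul_lattice_val]
    exact Submodule.mem_map_of_mem (Submodule.subset_span ⟨j, rfl⟩)
  have h2 := mem_stdLattice.mp h1 i
  rwa [glLin_basis] at h2

theorem smul_stdLattice_iff {g : GL (Fin d) F⸨X⸩} :
    g • stdLattice d F = stdLattice d F ↔ g ∈ intGL d F := by
  rw [mem_intGL_iff]
  constructor
  · intro h
    exact ⟨apply_mem_of_smul_stdLattice h, apply_mem_of_smul_stdLattice (inv_smul_eq_iff.mpr h.symm)⟩
  · rintro ⟨h1, h2⟩
    refine Subtype.ext (le_antisymm ?_ fun v hv => ?_)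
    · rw [smul_lattice_val, Submodule.map_le_iff_le_comap]
      exact fun v hv => mulVec_mem_stdLattice h1 hv
    · rw [smul_lattice_val]
      refine ⟨_, mulVec_mem_stdLattice h2 hv, ?_⟩
      rw [← LinearMap.comp_apply, ← glLin_mul, mul_inv_cancel, glLin_one, LinearMap.id_apply]

theorem smul_stdVertex_iff {g : GL (Fin d) F⸨X⸩} :
    g • stdVertex d F = stdVertex d F ↔
      ∃ c : (F⸨X⸩)ˣ, Matrix.GeneralLinearGroup.scalar (Fin d) c * g ∈ intGL d F := by
  have h : g • stdVertex d F = stdVertex d F ↔ ∃ c : (F⸨X⸩)ˣ,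
      stdLattice d F = Matrix.GeneralLinearGroup.scalar (Fin d) c • g • stdLattice d F :=
    ⟨fun h => Quotient.exact h, fun h => Quotient.sound h⟩
  rw [h]
  refine exists_congr fun c => ?_
  rw [← smul_stdLattice_iff, mul_smul, eq_comm]

theorem mk_smul_vertex (g : GL (Fin d) F⸨X⸩) (v : Vertex d F) : mk g • v = g • v := rfl

/-- A lattice is free of rank `d` over `F[[t]]`; a basis of it, written in columns, is the matrix
`T`. -/
theorem exists_smul_stdVertex (v : Vertex d F) : ∃ T : GL (Fin d) F⸨X⸩, T • stdVertex d F = v := by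
  obtain ⟨M⟩ := v
  have : M.1.IsLattice F⸨X⸩ := M.2
  have hfr := Submodule.IsLattice.finrank_of_pi (R := PowerSeries F) F⸨X⸩ M.1
  rw [Fintype.card_fin] at hfr
  let b : Module.Basis (Fin d) (PowerSeries F) M.1 :=
    (Module.finBasis (PowerSeries F) M.1).reindex (finCongr hfr)
  let b' := b.extendOfIsLattice F⸨X⸩
  have hunit : IsUnit ((Pi.basisFun F⸨X⸩ (Fin d)).toMatrix b') :=
    IsUnit.of_mul_eq_one _ ((Pi.basisFun F⸨X⸩ (Fin d)).toMatrix_mul_toMatrix_flip b')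
  obtain ⟨T, hT⟩ := hunit
  refine ⟨T, congrArg (Quotient.mk _) (Subtype.ext ?_)⟩
  have hcol : ∀ j, glLin T (Pi.basisFun F⸨X⸩ (Fin d) j) = (b j : Fin d → F⸨X⸩) := by
    intro j
    rw [← Module.Basis.extendOfIsLattice_apply F⸨X⸩ b j]
    funext i
    rw [glLin_basis, hT]
    rfl
  rw [smul_lattice_val, stdLattice, Submodule.map_span, ← Set.range_comp]
  have hr : Set.range (⇑(glLin T) ∘ ⇑(Pi.basisFun F⸨X⸩ (Fin d))) = M.1.subtype '' Set.range b := by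
    rw [← Set.range_comp]
    exact congrArg Set.range (funext hcol)
  rw [hr, ← Submodule.map_span, b.span_eq, Submodule.map_top, Submodule.range_subtype]

/-- `PGL` is the quotient by the centre, and `GL_d(F[[t]])` embeds in `GL_d(F((t)))`. A matrix whose
image is central commutes with all of `GL_d(F[[t]])`, so it is already central there. -/
theorem map_algebraMap_injective : Function.Injective
    (Matrix.ProjGenLinGroup.map (n := Fin d) (algebraMap (PowerSeries F) F⸨X⸩)) := by
  have hinj : Function.Injective
      (Matrix.GeneralLinearGroup.map (n := Fin d) (algebraMap (PowerSeries F) F⸨X⸩)) := by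
    intro A B h
    ext i j : 2
    exact IsFractionRing.injective (PowerSeries F) F⸨X⸩
      (congrArg (fun g : GL (Fin d) F⸨X⸩ => g i j) h)
  rw [injective_iff_map_eq_one]
  intro a ha
  induction a using Matrix.ProjGenLinGroup.induction_on with
  | mk A =>
    rw [Matrix.ProjGenLinGroup.map_mk, Matrix.ProjGenLinGroup.mk_eq_one,
      Subgroup.mem_center_iff] at ha
    rw [Matrix.ProjGenLinGroup.mk_eq_one, Subgroup.mem_center_iff]
    intro B
    refine hinj ?_
    rw [map_mul, map_mul]
    exact ha _

theorem mk_scalar_mul (c : (F⸨X⸩)ˣ) (g : GL (Fin d) F⸨X⸩) :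
    mk (Matrix.GeneralLinearGroup.scalar (Fin d) c * g) = mk g := by
  rw [map_mul, Matrix.ProjGenLinGroup.mk_scalar, one_mul]

theorem smul_stdVertex_iff_mem_range {g : Matrix.ProjGenLinGroup (Fin d) F⸨X⸩} :
    g • stdVertex d F = stdVertex d F ↔ g ∈ (Matrix.ProjGenLinGroup.map (n := Fin d)
      (algebraMap (PowerSeries F) F⸨X⸩)).range := by
  induction g using Matrix.ProjGenLinGroup.induction_on with
  | mk g =>
    rw [mk_smul_vertex, smul_stdVertex_iff]
    constructor
    · rintro ⟨c, A, hA⟩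
      exact ⟨mk A, by rw [Matrix.ProjGenLinGroup.map_mk, hA, mk_scalar_mul]⟩
    · rintro ⟨a, ha⟩
      induction a using Matrix.ProjGenLinGroup.induction_on with
      | mk A =>
        rw [Matrix.ProjGenLinGroup.map_mk, eq_comm, Matrix.ProjGenLinGroup.mk_eq_mk_iff] at ha
        obtain ⟨u, hu⟩ := ha
        exact ⟨u, A, by rw [← hu, scalar_comm]⟩

/-- The stabiliser of a vertex `g v₀` is a conjugate of `PGL_d(F[[t]])`. -/
theorem exists_stabilizer_mulEquiv (g : Matrix.ProjGenLinGroup (Fin d) F⸨X⸩) {v : Vertex d F}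
    (hg : g • stdVertex d F = v) :
    ∃ e : MulAction.stabilizer (Matrix.ProjGenLinGroup (Fin d) F⸨X⸩) v ≃*
        Matrix.ProjGenLinGroup (Fin d) (PowerSeries F),
      ∀ h : MulAction.stabilizer (Matrix.ProjGenLinGroup (Fin d) F⸨X⸩) v,
        Matrix.ProjGenLinGroup.map (algebraMap (PowerSeries F) F⸨X⸩) (e h) = g⁻¹ * h * g := by
  let φ : Matrix.ProjGenLinGroup (Fin d) (PowerSeries F) →*
      MulAction.stabilizer (Matrix.ProjGenLinGroup (Fin d) F⸨X⸩) v :=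
    ((MulAut.conj g).toMonoidHom.comp
      (Matrix.ProjGenLinGroup.map (algebraMap (PowerSeries F) F⸨X⸩))).codRestrict _ fun r => by
        rw [MulAction.mem_stabilizer_iff, ← hg]
        change (g * _ * g⁻¹) • g • _ = _
        rw [← mul_smul, inv_mul_cancel_right, mul_smul,
          smul_stdVertex_iff_mem_range.mpr ⟨r, rfl⟩]
  have hφ : ∀ r, (φ r : Matrix.ProjGenLinGroup (Fin d) F⸨X⸩) =
      g * Matrix.ProjGenLinGroup.map (algebraMap (PowerSeries F) F⸨X⸩) r * g⁻¹ := fun _ => rfl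
  have hbij : Function.Bijective φ := by
    constructor
    · intro r s h
      have := congrArg Subtype.val h
      rw [hφ, hφ] at this
      exact map_algebraMap_injective (mul_left_cancel (mul_right_cancel this))
    · intro h
      have h1 : (g⁻¹ * h * g) • stdVertex d F = stdVertex d F := by
        rw [mul_smul, mul_smul, hg, MulAction.mem_stabilizer_iff.mp h.2, ← hg, inv_smul_smul]
      obtain ⟨r, hr⟩ := smul_stdVertex_iff_mem_range.mp h1
      refine ⟨r, Subtype.ext ?_⟩
      rw [hφ, hr]
      group
  refine ⟨(MulEquiv.ofBijective φ hbij).symm, fun h => ?_⟩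
  obtain ⟨r, rfl⟩ := hbij.2 h
  have : (MulEquiv.ofBijective φ hbij).symm (φ r) = r :=
    (MulEquiv.ofBijective φ hbij).symm_apply_apply r
  rw [this, hφ]
  group

end StandardVertex

/-! ### The Singer cycle `Eˣ / Kˣ` and its normaliser. -/

section SemilinearGroup

variable {K E : Type*} [Field K] [Field E] [Algebra K E] {d : ℕ} (b : Module.Basis (Fin d) K E)

/-- The matrix of the map `c ↦ w τ(c)` of `E`. -/
def semiGL (w : Eˣ) (τ : E ≃ₐ[K] E) : GL (Fin d) K :=
  Units.map (LinearMap.toMatrixAlgEquiv b : Module.End K E ≃ₐ[K] _).toAlgHom.toRingHom.toMonoidHom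
    (Units.map (Algebra.lmul K E).toRingHom.toMonoidHom w *
      LinearMap.GeneralLinearGroup.ofLinearEquiv τ.toLinearEquiv)

theorem semiGL_val (w : Eˣ) (τ : E ≃ₐ[K] E) : (semiGL b w τ : Matrix (Fin d) (Fin d) K) =
    LinearMap.toMatrixAlgEquiv b (LinearMap.mulLeft K (w : E) ∘ₗ τ.toLinearMap) := rfl

theorem eq_semiGL_iff (g : GL (Fin d) K) (w : Eˣ) (τ : E ≃ₐ[K] E) : g = semiGL b w τ ↔
    ∀ c, Matrix.toLinAlgEquiv b (g : Matrix (Fin d) (Fin d) K) c = w * τ c := by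
  rw [Units.ext_iff, semiGL_val, ← Matrix.toLinAlgEquiv_symm, AlgEquiv.eq_symm_apply,
    LinearMap.ext_iff]
  rfl

theorem toLin_semiGL (w : Eˣ) (τ : E ≃ₐ[K] E) (c : E) :
    Matrix.toLinAlgEquiv b (semiGL b w τ : Matrix (Fin d) (Fin d) K) c = w * τ c :=
  (eq_semiGL_iff b _ w τ).mp rfl c

theorem semiGL_mul (w w' : Eˣ) (τ τ' : E ≃ₐ[K] E) :
    semiGL b w τ * semiGL b w' τ' = semiGL b (w * Units.map τ.toRingHom.toMonoidHom w') (τ * τ') := by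
  rw [eq_semiGL_iff]
  intro c
  rw [Units.val_mul, map_mul, Module.End.mul_apply, toLin_semiGL, toLin_semiGL, map_mul, Units.val_mul,
    ← mul_assoc]
  rfl

/-- The regular representation of `Eˣ`. -/
def singerHom : Eˣ →* GL (Fin d) K where
  toFun w := semiGL b w 1
  map_one' := by
    refine ((eq_semiGL_iff b 1 1 1).mpr fun c => ?_).symm
    rw [Units.val_one, map_one, Module.End.one_apply, Units.val_one, one_mul, AlgEquiv.one_apply]
  map_mul' w w' := by
    rw [semiGL_mul, mul_one]
    congr 2

theorem singerHom_apply (w : Eˣ) : singerHom b w = semiGL b w 1 := rfl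

theorem toLin_singerHom (w : Eˣ) (c : E) :
    Matrix.toLinAlgEquiv b (singerHom b w : Matrix (Fin d) (Fin d) K) c = w * c := toLin_semiGL b w 1 c

theorem semiGL_mul_singerHom (w u : Eˣ) (τ : E ≃ₐ[K] E) :
    semiGL b w τ * singerHom b u =
      singerHom b (Units.map τ.toRingHom.toMonoidHom u) * semiGL b w τ := by
  rw [singerHom_apply, singerHom_apply, semiGL_mul, semiGL_mul, mul_one, one_mul, mul_comm w]
  congr 2

theorem mulVec_equivFun (g : Matrix (Fin d) (Fin d) K) (c : E) :
    g.mulVec (b.equivFun c) = b.equivFun (Matrix.toLinAlgEquiv b g c) := by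
  obtain ⟨f, rfl⟩ := (LinearMap.toMatrixAlgEquiv b).surjective g
  rw [Matrix.toLinAlgEquiv_toMatrixAlgEquiv]
  exact LinearMap.toMatrix_mulVec_repr b b f c

theorem toLin_scalar (k : Kˣ) (c : E) : Matrix.toLinAlgEquiv b
    (Matrix.GeneralLinearGroup.scalar (Fin d) k : Matrix (Fin d) (Fin d) K) c =
      algebraMap K E k * c := by
  have h : (Matrix.GeneralLinearGroup.scalar (Fin d) k : Matrix (Fin d) (Fin d) K) =
      algebraMap K _ (k : K) := by
    ext i j
    simp [Matrix.algebraMap_matrix_apply, Matrix.diagonal_apply]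
  rw [h, AlgEquiv.commutes, Module.algebraMap_end_apply, Algebra.smul_def]

/-- Two semilinear maps differing by a scalar `k` are compared first at `c = 1`, which gives `w' = w
k`; cancelling leaves `τ = τ'`. -/
theorem mk_semiGL_eq {w w' : Eˣ} {τ τ' : E ≃ₐ[K] E}
    (h : mk (semiGL b w τ) = mk (semiGL b w' τ')) :
    τ = τ' ∧ ∃ k : Kˣ, w' = w * Units.map (algebraMap K E).toMonoidHom k := by
  rw [Matrix.ProjGenLinGroup.mk_eq_mk_iff] at h
  obtain ⟨k, hk⟩ := h
  rw [eq_semiGL_iff] at hk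
  have hc : ∀ c, (w : E) * (algebraMap K E k * τ c) = w' * τ' c := fun c => by
    rw [← hk, Units.val_mul, map_mul, Module.End.mul_apply, toLin_semiGL, toLin_scalar, map_mul,
      τ.commutes]
  have hw : (w' : E) = w * algebraMap K E k := by
    have := hc 1
    rw [map_one, map_one, mul_one, mul_one] at this
    exact this.symm
  refine ⟨AlgEquiv.ext fun c => mul_left_cancel₀ w'.ne_zero ?_, k, Units.ext hw⟩
  rw [← hc, hw, mul_assoc]

theorem semiGL_one_one : semiGL b 1 1 = 1 := (singerHom b).map_one

theorem singerHom_algebraMap (k : Kˣ) :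
    singerHom b (Units.map (algebraMap K E).toMonoidHom k) =
      Matrix.GeneralLinearGroup.scalar (Fin d) k := by
  rw [eq_comm, singerHom_apply, eq_semiGL_iff]
  exact fun c => toLin_scalar b k c

/-- The Singer cycle of `PGL_d(K)` coming from the multiplicative group of `E`. -/
def singer : Subgroup (Matrix.ProjGenLinGroup (Fin d) K) :=
  (singerHom b).range.map mk

theorem mem_singer_iff {n : Matrix.ProjGenLinGroup (Fin d) K} :
    n ∈ singer b ↔ ∃ w, n = mk (singerHom b w) := by
  constructor
  · rintro ⟨_, ⟨w, rfl⟩, rfl⟩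
    exact ⟨w, rfl⟩
  · rintro ⟨w, rfl⟩
    exact ⟨_, ⟨w, rfl⟩, rfl⟩

variable [Finite E]

theorem isSingerPGL_singer : IsSingerPGL (singer b) := by
  refine ⟨(singerHom b).range, ⟨?_, fun v w hv hw => ?_⟩, rfl⟩
  · exact isCyclic_of_surjective (singerHom b).rangeRestrict (singerHom b).rangeRestrict_surjective
  · obtain ⟨v, rfl⟩ := b.equivFun.surjective v
    obtain ⟨w, rfl⟩ := b.equivFun.surjective w
    rw [ne_eq, LinearEquiv.map_eq_zero_iff] at hv hw
    refine ⟨⟨_, Units.mk0 (w / v) (div_ne_zero hw hv), rfl⟩, ?_, ?_⟩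
    · dsimp only
      rw [mulVec_equivFun, toLin_singerHom, Units.val_mk0, div_mul_cancel₀ _ hv]
    · rintro ⟨_, u, rfl⟩ hu
      dsimp only at hu
      rw [mulVec_equivFun, toLin_singerHom, b.equivFun.injective.eq_iff] at hu
      refine Subtype.ext (congrArg (singerHom b) (Units.ext ?_))
      rw [Units.val_mk0, eq_div_iff hv, hu]

/-- Matrices normalising `Eˣ` are semilinear. -/
theorem exists_eq_semiGL (n : GL (Fin d) K)
    (hn : ∀ w : Eˣ, ∃ w' : Eˣ, n * singerHom b w = singerHom b w' * n) :
    ∃ (w : Eˣ) (τ : E ≃ₐ[K] E), n = semiGL b w τ := by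
  have : Finite K := Finite.of_injective _ (algebraMap K E).injective
  set f := Matrix.toLinAlgEquiv b (n : Matrix (Fin d) (Fin d) K) with hf
  have hfinj : Function.Injective f := by
    have h1 : Matrix.toLinAlgEquiv b ((n⁻¹ : GL (Fin d) K) : Matrix (Fin d) (Fin d) K) * f = 1 := by
      rw [hf, ← map_mul, Units.inv_mul, map_one]
    exact Function.LeftInverse.injective (g := Matrix.toLinAlgEquiv b ((n⁻¹ : GL (Fin d) K) :
      Matrix (Fin d) (Fin d) K)) fun c => LinearMap.congr_fun h1 c
  -- The action on `Eˣ` is extended by `0 ↦ 0`. The resulting `τ` equals `w ↦ f w / f 1`, so it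
  -- inherits additivity from `f`.
  have hex : ∀ w : E, ∃ w' : E, ∀ c, f (w * c) = w' * f c := by
    intro w
    by_cases hw : w = 0
    · exact ⟨0, fun c => by rw [hw, zero_mul, map_zero, zero_mul]⟩
    · obtain ⟨w', h⟩ := hn (Units.mk0 w hw)
      refine ⟨w', fun c => ?_⟩
      have h1 := congrArg (fun g : GL (Fin d) K =>
        Matrix.toLinAlgEquiv b (g : Matrix (Fin d) (Fin d) K) c) h
      simp only [Units.val_mul, map_mul, Module.End.mul_apply] at h1
      rwa [toLin_singerHom, toLin_singerHom] at h1
  choose τ hτ using hex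
  have hf1 : f 1 ≠ 0 := fun h => one_ne_zero (hfinj (h.trans (map_zero f).symm))
  have hτ1 : ∀ w, f w = τ w * f 1 := fun w => by
    conv_lhs => rw [← mul_one w, hτ]
  let τ' : E →ₐ[K] E :=
    { toFun := τ
      map_one' := mul_right_cancel₀ hf1 (by rw [← hτ1, one_mul])
      map_zero' := mul_right_cancel₀ hf1 (by rw [← hτ1, map_zero, zero_mul])
      map_mul' := fun a c => mul_right_cancel₀ hf1 (by rw [← hτ1, hτ, hτ1 c, mul_assoc])
      map_add' := fun a c => mul_right_cancel₀ hf1 (by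
        rw [← hτ1, map_add, add_mul, ← hτ1, ← hτ1])
      commutes' := fun k => mul_right_cancel₀ hf1 (by
        rw [← hτ1, Algebra.algebraMap_eq_smul_one, map_smul, smul_mul_assoc, one_mul]) }
  refine ⟨Units.mk0 (f 1) hf1,
    AlgEquiv.ofBijective τ' (Finite.injective_iff_bijective.mp τ'.toRingHom.injective), ?_⟩
  rw [eq_semiGL_iff]
  intro c
  rw [← hf, hτ1, Units.val_mk0, mul_comm]
  rfl

/-- A representative of a class normalising the Singer cycle normalises `Eˣ` in `GL_d(K)` only up to
scalars. As `Kˣ ⊆ Eˣ`, the scalars are absorbed and `exists_eq_semiGL` applies. Conversely, a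
semilinear map `w τ` conjugates multiplication by `u` to multiplication by `τ(u)`. -/
theorem mem_normalizer_singer_iff {n : Matrix.ProjGenLinGroup (Fin d) K} :
    n ∈ Subgroup.normalizer (singer b : Set (Matrix.ProjGenLinGroup (Fin d) K)) ↔
      ∃ (w : Eˣ) (τ : E ≃ₐ[K] E), n = mk (semiGL b w τ) := by
  constructor
  · intro hn
    induction n using Matrix.ProjGenLinGroup.induction_on with
    | mk n =>
      obtain ⟨w, τ, rfl⟩ := exists_eq_semiGL b n fun w => by
        have h := (Subgroup.mem_normalizer_iff.mp hn (mk (singerHom b w))).mp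
          ((mem_singer_iff b).mpr ⟨w, rfl⟩)
        obtain ⟨w', hw'⟩ := (mem_singer_iff b).mp h
        rw [mul_inv_eq_iff_eq_mul, ← map_mul, ← map_mul, eq_comm,
          Matrix.ProjGenLinGroup.mk_eq_mk_iff] at hw'
        obtain ⟨k, hk⟩ := hw'
        refine ⟨Units.map (algebraMap K E).toMonoidHom k * w', ?_⟩
        have hcomm : Commute (n : GL (Fin d) K) (Matrix.GeneralLinearGroup.scalar (Fin d) k) := by
          have : Matrix.GeneralLinearGroup.scalar (Fin d) k ∈ Subgroup.center (GL (Fin d) K) := by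
            rw [Matrix.GeneralLinearGroup.center_eq_range_scalar]
            exact ⟨k, rfl⟩
          exact Subgroup.mem_center_iff.mp this n
        rw [← hk, mul_assoc, hcomm.eq, ← singerHom_algebraMap b, ← mul_assoc, ← map_mul, mul_comm w']
      exact ⟨w, τ, rfl⟩
  · rintro ⟨w, τ, rfl⟩
    have key : ∀ u, mk (semiGL b w τ) * mk (singerHom b u) * (mk (semiGL b w τ))⁻¹ =
        mk (singerHom b (Units.map τ.toRingHom.toMonoidHom u)) := fun u => by
      rw [mul_inv_eq_iff_eq_mul, ← map_mul, ← map_mul, semiGL_mul_singerHom]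
    rw [Subgroup.mem_normalizer_iff]
    intro h
    constructor
    · intro hh
      obtain ⟨u, rfl⟩ := (mem_singer_iff b).mp hh
      exact (mem_singer_iff b).mpr ⟨_, key u⟩
    · intro hh
      obtain ⟨u, hu⟩ := (mem_singer_iff b).mp hh
      refine (mem_singer_iff b).mpr ⟨Units.map τ.symm.toRingHom.toMonoidHom u, ?_⟩
      have h1 := key (Units.map τ.symm.toRingHom.toMonoidHom u)
      have h2 : Units.map τ.toRingHom.toMonoidHom (Units.map τ.symm.toRingHom.toMonoidHom u) = u :=
        Units.ext (τ.apply_symm_apply u)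
      rw [h2, ← hu] at h1
      exact (mul_left_cancel (mul_right_cancel h1)).symm

end SemilinearGroup

/-! ### The classes of `w t ^ j` and the group `Γ̃`. -/

section Gamma

variable {K E : Type*} [Field K] [Field E] [Algebra K E] {σ : E ≃ₐ[K] E} {d : ℕ}
  (hσ : σ ^ d = 1) (x : E⸨X⸩) (hx : laurentNorm σ d x = 1 + HahnSeries.single 1 1)
  (b : Module.Basis (Fin d) K E)

/-- The projective representation of the units of `𝒜`, in a basis. -/
def psiPGL (β : Module.Basis (Fin d) K⸨X⸩ E⸨X⸩) :
    (AlgA K σ d)ˣ →* Matrix.ProjGenLinGroup (Fin d) K⸨X⸩ :=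
  mk.comp (psiGL hσ x hx β)

theorem psiPGL_apply (β : Module.Basis (Fin d) K⸨X⸩ E⸨X⸩) (y : (AlgA K σ d)ˣ) :
    psiPGL hσ x hx β y = mk (psiGL hσ x hx β y) := rfl

/-- Two matrix forms of `Ψ` are conjugate. -/
theorem exists_conj_psiPGL (β β' : Module.Basis (Fin d) K⸨X⸩ E⸨X⸩) :
    ∃ P : Matrix.ProjGenLinGroup (Fin d) K⸨X⸩,
      ∀ y, psiPGL hσ x hx β y = P * psiPGL hσ x hx β' y * P⁻¹ := by
  let P : GL (Fin d) K⸨X⸩ := ⟨β.toMatrix β', β'.toMatrix β, β.toMatrix_mul_toMatrix_flip β',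
    β'.toMatrix_mul_toMatrix_flip β⟩
  refine ⟨mk P, fun y => ?_⟩
  rw [psiPGL_apply, psiPGL_apply, ← map_inv, ← map_mul, ← map_mul]
  refine congrArg mk (Units.ext ?_)
  rw [Units.val_mul, Units.val_mul, psiGL_val, psiGL_val]
  exact (basis_toMatrix_mul_linearMap_toMatrix_mul_basis_toMatrix β β' β β'
    (Psi σ d hσ x hx (y : AlgA K σ d))).symm

theorem mk_psiGL_eq_of_smul (β : Module.Basis (Fin d) K⸨X⸩ E⸨X⸩) {y y' : (AlgA K σ d)ˣ}
    {k : K⸨X⸩} (hk : k ≠ 0) (h : Psi σ d hσ x hx y = k • Psi σ d hσ x hx y') :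
    psiPGL hσ x hx β y = psiPGL hσ x hx β y' := by
  rw [psiPGL_apply, psiPGL_apply, eq_comm, Matrix.ProjGenLinGroup.mk_eq_mk_iff]
  refine ⟨Units.mk0 k hk, ?_⟩
  rw [scalar_comm]
  ext i j
  rw [Units.val_mul, psiGL_val, psiGL_val, h, map_smul]
  simp

/-- The elements `w t ^ j` of `𝒜`. -/
def monomialUnit (K : Type*) {E : Type*} [Field K] [Field E] [Algebra K E] (σ : E ≃ₐ[K] E) {d : ℕ}
    (hd : 0 < d) (w : Eˣ) (j : ℕ) : (AlgA K σ d)ˣ :=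
  AlgA.constUnit K σ d w * AlgA.tUnit K σ d hd ^ j

theorem monomialUnit_val (hd : 0 < d) (w : Eˣ) (j : ℕ) :
    (monomialUnit K σ hd w j : AlgA K σ d) = AlgA.constUnit K σ d w * AlgA.t K σ d ^ j := by
  rw [monomialUnit, Units.val_mul, Units.val_pow_eq_pow_val, AlgA.tUnit_val]

theorem monomialUnit_mem (hd : 0 < d) (w : Eˣ) (j : ℕ) :
    monomialUnit K σ hd w j ∈ AlgA.conjStab K σ d :=
  mul_mem (AlgA.constUnit_mem K σ d w) (pow_mem (AlgA.tUnit_mem K σ d hd) j)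

theorem Psi_monomialUnit (hd : 0 < d) (w : Eˣ) (j : ℕ) (y : E⸨X⸩) :
    Psi σ d hσ x hx (monomialUnit K σ hd w j) y =
      HahnSeries.single 0 (w : E) * (twist σ x j * (sigmaLin σ ^ j) y) := by
  rw [monomialUnit_val, map_mul, Module.End.mul_apply, Psi_t_pow, AlgA.constUnit_val, Psi_const]

theorem psiGL_constUnit_mem (w : Eˣ) :
    psiGL hσ x hx (constantBasis b) (AlgA.constUnit K σ d w) ∈ intGL d K := by
  have key : ∀ w : Eˣ, ∀ i j,
      psiGL hσ x hx (constantBasis b) (AlgA.constUnit K σ d w) i j ∈ integers K := by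
    intro w
    refine toMatrix_apply_mem b _ fun y hy => ?_
    rw [AlgA.constUnit_val, Psi_const]
    exact mul_mem (single_mem_integers _ le_rfl) hy
  rw [mem_intGL_iff, ← map_inv, ← map_inv]
  exact ⟨key w, key w⁻¹⟩

theorem psiGL_tUnit_mem (hd : 0 < d) :
    psiGL hσ x hx (constantBasis b) (AlgA.tUnit K σ d hd) ∈ intGL d K := by
  obtain ⟨hxi, -⟩ := unit_of_laurentNorm σ hd hx
  rw [mem_intGL_iff, ← map_inv]
  refine ⟨toMatrix_apply_mem b _ fun y hy => ?_, toMatrix_apply_mem b _ fun y hy => ?_⟩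
  · rw [AlgA.tUnit_val, ← pow_one (AlgA.t K σ d), Psi_t_pow]
    exact mul_mem (twist_mem σ hxi _) (sigmaLin_pow_mem_integers σ _ hy)
  · have h : (((AlgA.tUnit K σ d hd)⁻¹ : (AlgA K σ d)ˣ) : AlgA K σ d) =
      AlgA.t K σ d ^ (d - 1) * AlgA.ofHom K σ d (1 + RatFunc.X)⁻¹ := rfl
    rw [h, map_mul, Module.End.mul_apply, Psi_t_pow, Psi_of, map_inv₀, map_add, map_one,
      ratToLaurent_X]
    refine mul_mem (twist_mem σ hxi _) (sigmaLin_pow_mem_integers σ _ (mul_mem ?_ hy))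
    refine inv_mem_integers (add_mem (one_mem _) (single_mem_integers _ zero_le_one)) ?_
    simp

theorem psiGL_monomialUnit_mem (hd : 0 < d) (w : Eˣ) (j : ℕ) :
    psiGL hσ x hx (constantBasis b) (monomialUnit K σ hd w j) ∈ intGL d K := by
  rw [monomialUnit, map_mul, map_pow]
  exact mul_mem (psiGL_constUnit_mem hσ x hx b w) (pow_mem (psiGL_tUnit_mem hσ x hx b hd) j)

/-- The constant term of `x σ(x) ⋯ σ^(j-1)(x)`. -/
def twistUnit (hd : 0 < d) (hx : laurentNorm σ d x = 1 + HahnSeries.single 1 1) (j : ℕ) : Eˣ :=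
  Units.mk0 ((twist σ x j).coeff 0) (twist_coeff_zero_ne σ (unit_of_laurentNorm σ hd hx).1
    (unit_of_laurentNorm σ hd hx).2 j)

/-- The reduction modulo `Y` of the class of `w t ^ j`. -/
theorem exists_reduction_monomialUnit (hd : 0 < d) (w : Eˣ) (j : ℕ) :
    ∃ r : Matrix.ProjGenLinGroup (Fin d) (PowerSeries K),
      Matrix.ProjGenLinGroup.map (algebraMap (PowerSeries K) K⸨X⸩) r =
        psiPGL hσ x hx (constantBasis b) (monomialUnit K σ hd w j) ∧
      Matrix.ProjGenLinGroup.map (PowerSeries.constantCoeff (R := K)) r =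
        mk (semiGL b (w * twistUnit x hd hx j) (σ ^ j)) := by
  obtain ⟨R, hR⟩ := psiGL_monomialUnit_mem hσ x hx b hd w j
  refine ⟨mk R, by rw [Matrix.ProjGenLinGroup.map_mk, hR, psiPGL_apply], ?_⟩
  rw [Matrix.ProjGenLinGroup.map_mk]
  refine congrArg mk ?_
  ext i k
  have h1 : algebraMap (PowerSeries K) K⸨X⸩ (R i k) =
      psiGL hσ x hx (constantBasis b) (monomialUnit K σ hd w j) i k :=
    congrArg (fun g : GL (Fin d) K⸨X⸩ => g i k) hR
  have h2 : (algebraMap (PowerSeries K) K⸨X⸩ (R i k)).coeff 0 =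
      (psiGL hσ x hx (constantBasis b) (monomialUnit K σ hd w j) i k).coeff 0 := by rw [h1]
  rw [coeff_zero_algebraMap, psiGL_val, LinearMap.toMatrixAlgEquiv_apply,
    coeff_constantBasis_repr, constantBasis_apply, Psi_monomialUnit, sigmaLin_single,
    HahnSeries.coeff_single_zero_mul, HahnSeries.coeff_mul_single_zero] at h2
  rw [semiGL_val, LinearMap.toMatrixAlgEquiv_apply]
  refine h2.trans ?_
  rw [← mul_assoc]
  rfl

/-- In a constant basis a constant `w` acts through its matrix over `K`, so the Singer cycle lifted
along `K → K((Y))` is the image of `Eˣ ⊆ 𝒜`. -/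
theorem map_C_singerHom (w : Eˣ) :
    Matrix.GeneralLinearGroup.map (n := Fin d) (HahnSeries.C : K →+* K⸨X⸩) (singerHom b w) =
      psiGL hσ x hx (constantBasis b) (AlgA.constUnit K σ d w) := by
  ext i k n
  rw [psiGL_val, LinearMap.toMatrixAlgEquiv_apply, coeff_constantBasis_repr, constantBasis_apply,
    AlgA.constUnit_val, Psi_const, HahnSeries.single_mul_single, add_zero]
  change (HahnSeries.single 0 ((singerHom b w : Matrix (Fin d) (Fin d) K) i k)).coeff n = _
  rw [singerHom_apply, semiGL_val, LinearMap.toMatrixAlgEquiv_apply]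
  by_cases hn : n = 0
  · subst hn
    rw [HahnSeries.coeff_single_same, HahnSeries.coeff_single_same]
    rfl
  · rw [HahnSeries.coeff_single_of_ne hn, HahnSeries.coeff_single_of_ne hn, map_zero]
    rfl

variable [Finite E]

/-- The stabiliser of the standard vertex consists of the classes of the elements `w t ^ j`. -/
theorem exists_eq_monomialUnit (hord : orderOf σ = d) (hd : 2 ≤ d)
    (hgen : ∀ τ : E ≃ₐ[K] E, τ ∈ Subgroup.zpowers σ) (y : (AlgA K σ d)ˣ)
    (hy : ∀ z ∈ AlgA.zero K σ d, y * z * (y⁻¹ : (AlgA K σ d)ˣ) ∈ AlgA.zero K σ d)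
    (hv : psiPGL hσ x hx (constantBasis b) y • stdVertex d K = stdVertex d K) :
    ∃ j < d, ∃ w : Eˣ, psiPGL hσ x hx (constantBasis b) y =
      psiPGL hσ x hx (constantBasis b) (monomialUnit K σ (by omega) w j) := by
  rw [psiPGL_apply, mk_smul_vertex, smul_stdVertex_iff] at hv
  obtain ⟨c, hc⟩ := hv
  obtain ⟨j, hj, w, k, hk, h⟩ := exists_eq_smul_of_conj hσ x hx hord hd hgen y hy (by
    intro T hT w hw
    refine apply_mem_of_toMatrix b _ (fun i j => ?_) hw
    rw [map_mul, map_mul]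
    set g := psiGL hσ x hx (constantBasis b) y with hg
    have h1 : LinearMap.toMatrixAlgEquiv (constantBasis b) (Psi σ d hσ x hx y) = g := rfl
    have h2 : LinearMap.toMatrixAlgEquiv (constantBasis b)
      (Psi σ d hσ x hx (y⁻¹ : (AlgA K σ d)ˣ)) = (g⁻¹ : GL (Fin d) K⸨X⸩) := by
      rw [hg, ← map_inv]
      rfl
    set s := Matrix.GeneralLinearGroup.scalar (Fin d) c with hs
    set M := LinearMap.toMatrixAlgEquiv (constantBasis b) T with hM
    -- Fixing `v₀` makes `g` integral only after a scalar factor, but conjugation does not see the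
    -- scalar, so it preserves integral matrices.
    have h3 : (g : Matrix (Fin d) (Fin d) K⸨X⸩) * M * (g⁻¹ : GL (Fin d) K⸨X⸩) =
        (s * g : GL (Fin d) K⸨X⸩) * M * ((s * g)⁻¹ : GL (Fin d) K⸨X⸩) := by
      have hsc : ∀ N : Matrix (Fin d) (Fin d) K⸨X⸩, (s : Matrix (Fin d) (Fin d) K⸨X⸩) * N = N * s :=
        fun N => (Matrix.scalar_commute (c : K⸨X⸩) (fun r => Commute.all _ r) N).eq
      calc _ = ((g : Matrix (Fin d) (Fin d) K⸨X⸩) * M * (g⁻¹ : GL (Fin d) K⸨X⸩)) * s *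
            (s⁻¹ : GL (Fin d) K⸨X⸩) := (Units.mul_inv_cancel_right _ _).symm
        _ = _ := by
          rw [← hsc, mul_inv_rev, Units.val_mul, Units.val_mul]
          simp only [mul_assoc]
    rw [h1, h2, h3]
    have hMi : ∀ i j, M i j ∈ integers K := toMatrix_apply_mem b T hT
    rw [Matrix.mul_apply]
    refine sum_mem fun l _ => mul_mem ?_ (apply_mem_of_mem_intGL (inv_mem hc) l j)
    rw [Matrix.mul_apply]
    exact sum_mem fun m _ => mul_mem (apply_mem_of_mem_intGL hc i m) (hMi m l))
  refine ⟨j, hj, w, mk_psiGL_eq_of_smul hσ x hx _ hk ?_⟩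
  rw [h, monomialUnit_val]

/-- The image of the units normalising `𝒜₀`. -/
def gamma (β : Module.Basis (Fin d) K⸨X⸩ E⸨X⸩) : Subgroup (Matrix.ProjGenLinGroup (Fin d) K⸨X⸩) :=
  (AlgA.conjStab K σ d).map (psiPGL hσ x hx β)

/-- A conjugation mapping `𝒜₀` into itself has the same class as a unit normalising `𝒜₀`. -/
theorem exists_mem_conjStab (hord : orderOf σ = d) (hd : 2 ≤ d)
    (hgen : ∀ τ : E ≃ₐ[K] E, τ ∈ Subgroup.zpowers σ) (y : (AlgA K σ d)ˣ)
    (hy : ∀ z ∈ AlgA.zero K σ d, y * z * (y⁻¹ : (AlgA K σ d)ˣ) ∈ AlgA.zero K σ d)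
    (β : Module.Basis (Fin d) K⸨X⸩ E⸨X⸩) :
    ∃ y' ∈ AlgA.conjStab K σ d, psiPGL hσ x hx β y = psiPGL hσ x hx β y' := by
  have : Finite K := Finite.of_injective _ (algebraMap K E).injective
  have : FiniteDimensional K E := Module.Finite.of_finite
  obtain ⟨b⟩ : Nonempty (Module.Basis (Fin d) K E) := by
    have h : Module.finrank K E = d := by
      rw [← hord, ← IsGalois.card_aut_eq_finrank K E, ← Nat.card_zpowers,
        (Subgroup.eq_top_iff' _).mpr hgen, Subgroup.card_top]
    exact ⟨(Module.finBasis K E).reindex (finCongr h)⟩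
  -- By transitivity some `y₁` normalising `𝒜₀` moves `v₀` to the same vertex as `y`. Then `y₁⁻¹ y`
  -- fixes `v₀` and has the class of some `w t ^ j`, so `y` has the class of `y₁ w t ^ j`.
  obtain ⟨y₁, hy₁, R, hR, h⟩ := exists_eq_psiGL_mul hσ x hx b hord (by omega) hgen
    (psiGL hσ x hx (constantBasis b) y)
  have hstab : psiPGL hσ x hx (constantBasis b) (y₁⁻¹ * y) • stdVertex d K = stdVertex d K := by
    rw [psiPGL_apply, mk_smul_vertex, smul_stdVertex_iff]
    refine ⟨1, ?_⟩
    rwa [map_one, one_mul, map_mul, map_inv, h, inv_mul_cancel_left]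
  obtain ⟨j, -, w, hw⟩ := exists_eq_monomialUnit hσ x hx b hord hd hgen (y₁⁻¹ * y) (fun z hz => by
    have := (hy₁ _ (hy z hz)).2
    convert this using 1
    simp only [mul_inv_rev, inv_inv, Units.val_mul, mul_assoc]) hstab
  refine ⟨y₁ * monomialUnit K σ (by omega) w j, mul_mem hy₁ (monomialUnit_mem _ w j), ?_⟩
  obtain ⟨P, hP⟩ := exists_conj_psiPGL hσ x hx β (constantBasis b)
  rw [hP, hP, map_mul, ← hw, map_mul, map_inv, mul_inv_cancel_left]

/-- Conjugation by a unit, as an algebra automorphism. -/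
def conjAlgEquiv {R A : Type*} [CommSemiring R] [Semiring A] [Algebra R A] (y : Aˣ) : A ≃ₐ[R] A :=
  MulSemiringAction.toAlgEquiv R A (ConjAct.toConjAct y)

theorem conjAlgEquiv_apply {R A : Type*} [CommSemiring R] [Semiring A] [Algebra R A] (y : Aˣ)
    (z : A) : (conjAlgEquiv y : A ≃ₐ[R] A) z = y * z * (y⁻¹ : Aˣ) := rfl

/-- The definition of `Γ̃` only asks for `γ(𝒜₀) ⊆ 𝒜₀`. By `exists_mem_conjStab` the one-sided
condition gives no new classes, so its image is a subgroup. -/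
theorem coe_gamma (hord : orderOf σ = d) (hd : 2 ≤ d)
    (hgen : ∀ τ : E ≃ₐ[K] E, τ ∈ Subgroup.zpowers σ) (β : Module.Basis (Fin d) K⸨X⸩ E⸨X⸩) :
    (gamma hσ x hx β : Set (Matrix.ProjGenLinGroup (Fin d) K⸨X⸩)) = gammaTilde σ d hσ x hx β := by
  ext g
  constructor
  · rintro ⟨y, hy, rfl⟩
    exact ⟨conjAlgEquiv y, fun z hz => (hy z hz).1, y, conjAlgEquiv_apply y, rfl⟩
  · rintro ⟨γ, hγ, y, hy, rfl⟩
    obtain ⟨y', hy', h⟩ := exists_mem_conjStab hσ x hx hord hd hgen y (fun z hz => by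
      rw [← hy]
      exact hγ z hz) β
    exact ⟨y', hy', h.symm⟩

end Gamma

/-! ### Powers and roots of one-units in characteristic `p`. -/

section OneUnits

open PowerSeries in
/-- A one-unit of `K[[X]]` of finite order is trivial if the order is prime to `p`. -/
theorem eq_one_of_pow_eq_one_of_ne_zero {K : Type*} [Field K] {u : PowerSeries K}
    (hu : constantCoeff u = 1) {m : ℕ} (hm : (m : K) ≠ 0) (h : u ^ m = 1) : u = 1 := by
  have h1 : (u - 1) * ∑ i ∈ Finset.range m, u ^ i = 0 := by rw [mul_geom_sum, h, sub_self]
  rcases mul_eq_zero.mp h1 with h2 | h2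
  · exact sub_eq_zero.mp h2
  · exfalso
    apply hm
    have := congrArg (constantCoeff (R := K)) h2
    simpa [hu] using this

-- Write `d = p ^ a * m` with `m` prime to `p`. The prime-to-`p` case gives `u ^ p ^ a = 1`, and
-- then `(u - 1) ^ p ^ a = 0`.
open PowerSeries in
theorem eq_one_of_pow_eq_one {K : Type*} [Field K] (p : ℕ) (hp : p.Prime) [CharP K p]
    {u : PowerSeries K} (hu : constantCoeff u = 1) {d : ℕ} (hd : d ≠ 0) (h : u ^ d = 1) :
    u = 1 := by
  have : Fact p.Prime := ⟨hp⟩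
  have : CharP (PowerSeries K) p := charP_of_injective_algebraMap
    (algebraMap K (PowerSeries K)).injective p
  obtain ⟨a, m, hm, rfl⟩ := Nat.exists_eq_pow_mul_and_not_dvd hd p hp.ne_one
  rw [pow_mul] at h
  have h1 := eq_one_of_pow_eq_one_of_ne_zero (by rw [map_pow, hu, one_pow])
    (fun h0 => hm ((CharP.cast_eq_zero_iff K p m).mp h0)) h
  refine sub_eq_zero.mp (pow_eq_zero_iff (pow_ne_zero a hp.ne_zero) |>.mp ?_)
  rw [sub_pow_char_pow, h1, one_pow, sub_self]

open PowerSeries in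
/-- The series `1 + X` is not a `p`-th power, and more generally `(1 + X) ^ j` is a `p ^ a`-th power
only if `p ^ a` divides `j`. -/
theorem pow_dvd_of_pow_eq {K : Type*} [Field K] (p : ℕ) (hp : p.Prime) [CharP K p] {a j : ℕ}
    {h : PowerSeries K} (hh : h ^ p ^ a = (1 + X) ^ j) : p ^ a ∣ j := by
  have : Fact p.Prime := ⟨hp⟩
  have : CharP (PowerSeries K) p := charP_of_injective_algebraMap
    (algebraMap K (PowerSeries K)).injective p
  by_contra hdvd
  have hj : j ≠ 0 := fun h0 => hdvd (h0 ▸ dvd_zero _)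
  obtain ⟨c, m, hm, rfl⟩ := Nat.exists_eq_pow_mul_and_not_dvd hj p hp.ne_one
  have hca : c < a := by
    by_contra hca
    exact hdvd ((pow_dvd_pow p (not_lt.mp hca)).mul_right m)
  obtain ⟨e, rfl⟩ : ∃ e, a = e + 1 + c := ⟨a - 1 - c, by omega⟩
  -- Frobenius is injective, so the common factor `p ^ c` of the exponents cancels. The left side is
  -- still a `p`-th power, with derivative `0`, whereas the derivative of `(1 + X) ^ m` has constant
  -- term `m ≠ 0`.
  have h1 : h ^ p ^ (e + 1) = (1 + X) ^ m := by
    refine iterateFrobenius_inj (PowerSeries K) p c ?_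
    rw [iterateFrobenius_def, iterateFrobenius_def, ← pow_mul, ← pow_mul, ← pow_add, hh, mul_comm]
  have h2 := congrArg (derivative K) h1
  rw [derivative_pow, derivative_pow, map_add, derivative_one, derivative_X, zero_add, mul_one,
    pow_succ, Nat.cast_mul, CharP.cast_eq_zero (PowerSeries K) p, mul_zero, zero_mul, zero_mul,
    eq_comm] at h2
  have h3 := congrArg (constantCoeff (R := K)) h2
  simp only [map_mul, map_pow, map_add, map_one, map_natCast, constantCoeff_X, add_zero, one_pow,
    mul_one, map_zero] at h3
  exact hm ((CharP.cast_eq_zero_iff K p m).mp h3)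

open PowerSeries in
/-- `1 + X` has an `m`-th root if `p` does not divide `m`. -/
theorem exists_pow_eq_one_add_X {K : Type*} [Field K] (p : ℕ) (hp : p.Prime) [CharP K p] {m : ℕ}
    (hm : ¬ p ∣ m) : ∃ s : PowerSeries K, s ^ m = 1 + X := by
  have : Fact p.Prime := ⟨hp⟩
  -- The root is the binomial series `(1 + X) ^ r` with `r = 1 / m` in `ℤ_[p]`, whose binomial
  -- coefficients are mapped to `K` through the residue field.
  let f : ℤ_[p] →+* K := (ZMod.castHom (dvd_refl p) K).comp PadicInt.toZMod
  let _ : Algebra ℤ_[p] K := f.toAlgebra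
  have hunit : IsUnit (m : ℤ_[p]) := by
    rw [PadicInt.isUnit_iff, PadicInt.norm_natCast_eq_one_iff]
    exact (Nat.Prime.coprime_iff_not_dvd hp).mpr hm
  obtain ⟨r, hr⟩ := hunit.exists_right_inv
  have key : ∀ n : ℕ, binomialSeries K r ^ n = binomialSeries K ((n : ℤ_[p]) * r) := by
    intro n
    induction n with
    | zero => rw [pow_zero, Nat.cast_zero, zero_mul, binomialSeries_zero]
    | succ n ih => rw [pow_succ, ih, ← binomialSeries_add, Nat.cast_succ, add_mul, one_mul]
  refine ⟨binomialSeries K r, ?_⟩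
  rw [key, hr, ← Nat.cast_one, binomialSeries_nat, pow_one]

-- A Laurent series with a power in `K[[X]]` is integral over this integrally closed ring.
open PowerSeries in
theorem exists_algebraMap_eq_of_pow {K : Type*} [Field K] {d : ℕ} (hd : 0 < d) {f : K⸨X⸩}
    {g : PowerSeries K} (h : f ^ d = algebraMap (PowerSeries K) K⸨X⸩ g) :
    ∃ f', algebraMap (PowerSeries K) K⸨X⸩ f' = f ∧ f' ^ d = g := by
  obtain ⟨f', rfl⟩ := IsIntegrallyClosed.exists_algebraMap_eq_of_isIntegral_pow
    (R := PowerSeries K) hd (h ▸ isIntegral_algebraMap)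
  refine ⟨f', rfl, IsFractionRing.injective (PowerSeries K) K⸨X⸩ ?_⟩
  rw [map_pow, h]

open PowerSeries in
/-- The `d`-th powers among the series `e (1 + X) ^ j`. -/
theorem exists_pow_eq_iff {K : Type*} [Field K] (p : ℕ) (hp : p.Prime) [CharP K p] {d : ℕ}
    (hd : d ≠ 0) (e : Kˣ) (j : ℕ) :
    (∃ f : K⸨X⸩, f ^ d = algebraMap (PowerSeries K) K⸨X⸩ (C (e : K) * (1 + X) ^ j)) ↔
      p ^ padicValNat p d ∣ j ∧ ∃ k : Kˣ, k ^ d = e := by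
  have : Fact p.Prime := ⟨hp⟩
  obtain ⟨m, hm⟩ : p ^ padicValNat p d ∣ d := pow_padicValNat_dvd (p := p)
  have hpm : ¬ p ∣ m := by
    rintro ⟨m', rfl⟩
    refine pow_succ_padicValNat_not_dvd (p := p) hd ?_
    rw [pow_succ]
    exact ⟨m', by rw [mul_assoc]; exact hm⟩
  constructor
  · rintro ⟨f, hf⟩
    obtain ⟨g, -, hg⟩ := exists_algebraMap_eq_of_pow (Nat.pos_of_ne_zero hd) hf
    have h0 := congrArg (constantCoeff (R := K)) hg
    simp only [map_pow, map_mul, constantCoeff_C, map_add, map_one, constantCoeff_X, add_zero,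
      one_pow, mul_one] at h0
    have hk0 : constantCoeff g ≠ 0 := by
      intro h
      rw [h, zero_pow hd] at h0
      exact e.ne_zero h0.symm
    refine ⟨?_, Units.mk0 _ hk0, Units.ext h0⟩
    -- With `d = p ^ a * m`, the normalised root `g / g(0)` has `d`-th power `(1 + X) ^ j`, so its
    -- `m`-th power is a `p ^ a`-th root of `(1 + X) ^ j`.
    refine pow_dvd_of_pow_eq p hp (h := (C (constantCoeff g)⁻¹ * g) ^ m) ?_
    rw [← pow_mul, mul_comm m, ← hm, mul_pow, hg, ← h0, ← mul_assoc, ← map_pow, ← map_mul, inv_pow,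
      inv_mul_cancel₀ (pow_ne_zero _ hk0), map_one, one_mul]
  · rintro ⟨⟨i, rfl⟩, k, rfl⟩
    obtain ⟨s, hs⟩ := exists_pow_eq_one_add_X (K := K) p hp hpm
    refine ⟨algebraMap (PowerSeries K) K⸨X⸩ (C (k : K) * s ^ i), ?_⟩
    rw [← map_pow, mul_pow, ← map_pow, Units.val_pow_eq_pow_val, ← pow_mul, mul_comm i]
    nth_rewrite 2 [hm]
    rw [mul_comm _ m, mul_assoc, pow_mul, hs]

end OneUnits

/-! ### Determinants of `w t ^ j` and membership in `PSL`. -/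

section Determinants

open Matrix.ProjGenLinGroup (mk)

variable {K E : Type*} [Field K] [Field E] [Algebra K E] {σ : E ≃ₐ[K] E} {d : ℕ}
  (hσ : σ ^ d = 1) (x : E⸨X⸩) (hx : laurentNorm σ d x = 1 + HahnSeries.single 1 1)
  (b : Module.Basis (Fin d) K E)

theorem det_constUnit (w : Eˣ) :
    (psiGL hσ x hx (constantBasis b) (AlgA.constUnit K σ d w) :
      Matrix (Fin d) (Fin d) K⸨X⸩).det =
      algebraMap (PowerSeries K) K⸨X⸩ (PowerSeries.C (Algebra.norm K (w : E))) := by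
  rw [← map_C_singerHom]
  have h1 : (singerHom b w : Matrix (Fin d) (Fin d) K).det = Algebra.norm K (w : E) := by
    rw [singerHom_apply, semiGL_val, Algebra.norm_apply]
    exact LinearMap.det_toMatrix b _
  refine ((RingHom.map_det (HahnSeries.C : K →+* K⸨X⸩) _).symm).trans ?_
  rw [h1, LaurentSeries.coe_algebraMap, HahnSeries.ofPowerSeries_C]

/-- `t ^ d` is the scalar `1 + Y`, of determinant `(1 + Y) ^ d`; this determines `det t` up to a
`d`-th root of unity. -/
theorem det_tUnit_pow (hd : 0 < d) :
    (psiGL hσ x hx (constantBasis b) (AlgA.tUnit K σ d hd) :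
      Matrix (Fin d) (Fin d) K⸨X⸩).det ^ d =
      algebraMap (PowerSeries K) K⸨X⸩ (1 + PowerSeries.X) ^ d := by
  have h1 : Psi σ d hσ x hx (AlgA.tUnit K σ d hd ^ d : (AlgA K σ d)ˣ) =
      algebraMap (PowerSeries K) K⸨X⸩ (1 + PowerSeries.X) • 1 := by
    refine LinearMap.ext fun y => ?_
    rw [Units.val_pow_eq_pow_val, AlgA.tUnit_val, AlgA.t_pow_degree, Psi_of, LinearMap.smul_apply,
      Module.End.one_apply, laurent_smul_def, map_add (ratToLaurent E), map_one (ratToLaurent E),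
      ratToLaurent_X, LaurentSeries.coe_algebraMap, map_add (HahnSeries.ofPowerSeries ℤ K),
      map_one (HahnSeries.ofPowerSeries ℤ K), HahnSeries.ofPowerSeries_X,
      map_add (laurentMap (algebraMap K E)), map_one (laurentMap (algebraMap K E)),
      laurentMap_single, map_one (algebraMap K E)]
  rw [← Matrix.det_pow, ← Units.val_pow_eq_pow_val, ← map_pow, psiGL_val, h1, map_smul,
    map_one (LinearMap.toMatrixAlgEquiv _), Matrix.det_smul, Matrix.det_one, mul_one,
    Fintype.card_fin]

/-- Dividing `det t` by its constant term and by `1 + Y` leaves a one-unit whose `d`-th power is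
`1`, hence `1` itself. -/
theorem exists_det_tUnit (p : ℕ) (hp : p.Prime) [CharP K p] (hd : 0 < d) :
    ∃ ε : Kˣ, (psiGL hσ x hx (constantBasis b) (AlgA.tUnit K σ d hd) :
      Matrix (Fin d) (Fin d) K⸨X⸩).det =
      algebraMap (PowerSeries K) K⸨X⸩ (PowerSeries.C (ε : K) * (1 + PowerSeries.X)) := by
  obtain ⟨D, hD, hDd⟩ := exists_algebraMap_eq_of_pow hd
    ((det_tUnit_pow hσ x hx b hd).trans (map_pow _ _ _).symm)
  have h0 := congrArg (PowerSeries.constantCoeff (R := K)) hDd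
  simp only [map_pow, map_add, map_one, PowerSeries.constantCoeff_X, add_zero, one_pow] at h0
  have hne : PowerSeries.constantCoeff D ≠ 0 := by
    intro h
    rw [h, zero_pow hd.ne'] at h0
    exact zero_ne_one h0
  have hX : PowerSeries.constantCoeff (1 + PowerSeries.X : PowerSeries K) ≠ 0 := by simp
  have h1 : PowerSeries.C (PowerSeries.constantCoeff D)⁻¹ * D * (1 + PowerSeries.X)⁻¹ = 1 := by
    refine eq_one_of_pow_eq_one p hp ?_ hd.ne' ?_
    · rw [map_mul, map_mul, PowerSeries.constantCoeff_C, inv_mul_cancel₀ hne,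
        PowerSeries.constantCoeff_inv]
      simp
    · rw [mul_pow, mul_pow, hDd, ← map_pow, inv_pow, h0, inv_one, map_one, one_mul, ← mul_pow,
        PowerSeries.mul_inv_cancel _ hX, one_pow]
  refine ⟨Units.mk0 _ hne, ?_⟩
  rw [← hD, Units.val_mk0]
  congr 1
  have h2 : PowerSeries.C (PowerSeries.constantCoeff D)⁻¹ * D = 1 + PowerSeries.X := by
    have h3 := congrArg (· * (1 + PowerSeries.X)) h1
    rwa [one_mul, mul_assoc _ (1 + PowerSeries.X)⁻¹, PowerSeries.inv_mul_cancel _ hX, mul_one] at h3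
  rw [← h2, ← mul_assoc, ← map_mul, mul_inv_cancel₀ hne, map_one, one_mul]

/-- Rescaling a matrix by `c` multiplies its determinant by `c ^ d`, so a representative of
determinant `1` exists exactly when the determinant is a `d`-th power. -/
theorem mem_range_toPGL_iff {F : Type*} [Field F] (hd : 0 < d) (g : GL (Fin d) F) :
    mk g ∈ (Matrix.ProjectiveSpecialLinearGroup.toPGL (n := Fin d) (R := F)).range ↔
      ∃ c : F, c ^ d = (g : Matrix (Fin d) (Fin d) F).det := by
  constructor
  · rintro ⟨s, hs⟩
    obtain ⟨s, rfl⟩ := QuotientGroup.mk_surjective s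
    rw [Matrix.ProjectiveSpecialLinearGroup.toPGL_mk, Matrix.ProjGenLinGroup.mk_eq_mk_iff] at hs
    obtain ⟨u, rfl⟩ := hs
    refine ⟨u, ?_⟩
    rw [Units.val_mul, Matrix.det_mul]
    have h1 : ((Matrix.SpecialLinearGroup.toGL s : GL (Fin d) F) : Matrix (Fin d) (Fin d) F).det =
        1 := s.2
    have h2 := congrArg Units.val (Matrix.GeneralLinearGroup.det_scalar (n := Fin d) u)
    rw [Fintype.card_fin] at h2
    rw [h1, one_mul]
    exact h2.symm
  · rintro ⟨c, hc⟩
    have hc0 : c ≠ 0 := by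
      rintro rfl
      rw [zero_pow hd.ne'] at hc
      exact ((Matrix.isUnit_iff_isUnit_det _).mp g.isUnit).ne_zero hc.symm
    let u : Fˣ := (Units.mk0 c hc0)⁻¹
    have h2 := congrArg Units.val (Matrix.GeneralLinearGroup.det_scalar (n := Fin d) u)
    rw [Fintype.card_fin] at h2
    have hdet : (g * Matrix.GeneralLinearGroup.scalar (Fin d) u : GL (Fin d) F).1.det = 1 := by
      rw [Units.val_mul, Matrix.det_mul, ← hc]
      refine (congrArg (c ^ d * ·) h2).trans ?_
      rw [Units.val_pow_eq_pow_val, Units.val_inv_eq_inv_val, Units.val_mk0, ← mul_pow,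
        mul_inv_cancel₀ hc0, one_pow]
    let s : Matrix.SpecialLinearGroup (Fin d) F := ⟨_, hdet⟩
    refine ⟨s, ?_⟩
    rw [Matrix.ProjectiveSpecialLinearGroup.toPGL_mk, eq_comm, Matrix.ProjGenLinGroup.mk_eq_mk_iff]
    exact ⟨u, Units.ext rfl⟩

/-- The classes `w t ^ j` which lie in the projective special linear group. -/
theorem exists_psiPGL_monomialUnit_mem_range_iff (p : ℕ) (hp : p.Prime) [CharP K p] (hd : 0 < d) :
    ∃ ε : Kˣ, ∀ (w : Eˣ) (j : ℕ), psiPGL hσ x hx (constantBasis b) (monomialUnit K σ hd w j) ∈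
      (Matrix.ProjectiveSpecialLinearGroup.toPGL (n := Fin d) (R := K⸨X⸩)).range ↔
        p ^ padicValNat p d ∣ j ∧ ∃ k : Kˣ, k ^ d = Units.map (Algebra.norm K) w * ε ^ j := by
  obtain ⟨ε, hε⟩ := exists_det_tUnit hσ x hx b p hp hd
  refine ⟨ε, fun w j => ?_⟩
  rw [psiPGL_apply, mem_range_toPGL_iff hd, ← exists_pow_eq_iff p hp hd.ne']
  have : (psiGL hσ x hx (constantBasis b) (monomialUnit K σ hd w j) :
      Matrix (Fin d) (Fin d) K⸨X⸩).det = algebraMap (PowerSeries K) K⸨X⸩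
        (PowerSeries.C ((Units.map (Algebra.norm K) w * ε ^ j : Kˣ) : K) *
          (1 + PowerSeries.X) ^ j) := by
    rw [monomialUnit, map_mul, map_pow, Units.val_mul, Units.val_pow_eq_pow_val, Matrix.det_mul,
      Matrix.det_pow, det_constUnit, hε, ← map_pow, ← map_mul, mul_pow, ← mul_assoc, ← map_pow,
      ← map_mul]
    rfl
  rw [this]

end Determinants

/-! ### Structure and order of the stabilisers. -/

section Stabilizers

variable {K E : Type*} [Field K] [Field E] [Algebra K E] {σ : E ≃ₐ[K] E} {d : ℕ}
  (hσ : σ ^ d = 1) (x : E⸨X⸩) (hx : laurentNorm σ d x = 1 + HahnSeries.single 1 1)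
  (b : Module.Basis (Fin d) K E)

theorem psiPGL_monomialUnit_zero (hd : 0 < d) (β : Module.Basis (Fin d) K⸨X⸩ E⸨X⸩) (w : Eˣ) :
    psiPGL hσ x hx β (monomialUnit K σ hd w 0) =
      psiPGL hσ x hx β (AlgA.constUnit K σ d w) := by
  rw [monomialUnit, pow_zero, mul_one]

theorem map_C_mk_singerHom (w : Eˣ) :
    Matrix.ProjGenLinGroup.map (HahnSeries.C : K →+* K⸨X⸩) (mk (singerHom b w)) =
      psiPGL hσ x hx (constantBasis b) (AlgA.constUnit K σ d w) := by
  rw [Matrix.ProjGenLinGroup.map_mk, map_C_singerHom hσ x hx, psiPGL_apply]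

theorem psiPGL_constUnit_algebraMap (k : Kˣ) :
    psiPGL hσ x hx (constantBasis b)
      (AlgA.constUnit K σ d (Units.map (algebraMap K E).toMonoidHom k)) = 1 := by
  rw [← map_C_mk_singerHom, singerHom_algebraMap, Matrix.ProjGenLinGroup.mk_scalar, map_one]

theorem monomialUnit_mul (hd : 0 < d) (u w : Eˣ) (j : ℕ) :
    monomialUnit K σ hd (u * w) j = AlgA.constUnit K σ d u * monomialUnit K σ hd w j := by
  rw [monomialUnit, monomialUnit, map_mul, mul_assoc]

theorem monomialUnit_mul_constUnit (hd : 0 < d) (w u : Eˣ) (j : ℕ) :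
    monomialUnit K σ hd w j * AlgA.constUnit K σ d u =
      AlgA.constUnit K σ d (Units.map (σ ^ j).toRingHom.toMonoidHom u) *
        monomialUnit K σ hd w j := by
  have h : AlgA.tUnit K σ d hd ^ j * AlgA.constUnit K σ d u =
      AlgA.constUnit K σ d (Units.map (σ ^ j).toRingHom.toMonoidHom u) *
        AlgA.tUnit K σ d hd ^ j := by
    refine Units.ext ?_
    rw [Units.val_mul, Units.val_mul, Units.val_pow_eq_pow_val, AlgA.tUnit_val, AlgA.constUnit_val,
      AlgA.constUnit_val, AlgA.t_pow_mul_of, AlgA.ratMap_pow_C]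
    rfl
  rw [monomialUnit, mul_assoc, h, ← mul_assoc, ← mul_assoc, ← map_mul, ← map_mul, mul_comm w]

/-- The classes of `w t ^ j` and `w' t ^ j'`, with `j, j' < d`, agree only if `j = j'` and
`w' ∈ w Kˣ`. -/
theorem psiPGL_monomialUnit_inj (hord : orderOf σ = d) (hd : 0 < d) {w w' : Eˣ} {j j' : ℕ}
    (hj : j < d) (hj' : j' < d) (h : psiPGL hσ x hx (constantBasis b) (monomialUnit K σ hd w j) =
      psiPGL hσ x hx (constantBasis b) (monomialUnit K σ hd w' j')) :
    j = j' ∧ ∃ k : Kˣ, w' = w * Units.map (algebraMap K E).toMonoidHom k := by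
  obtain ⟨r, hr, hr'⟩ := exists_reduction_monomialUnit hσ x hx b hd w j
  obtain ⟨s, hs, hs'⟩ := exists_reduction_monomialUnit hσ x hx b hd w' j'
  obtain rfl := map_algebraMap_injective (hr.trans (h.trans hs.symm))
  obtain ⟨h1, k, hk⟩ := mk_semiGL_eq b (hr'.symm.trans hs')
  obtain rfl : j = j' := pow_injOn_Iio_orderOf (by simpa [hord]) (by simpa [hord]) h1
  refine ⟨rfl, k, mul_right_cancel (b := twistUnit x hd hx j) ?_⟩
  rw [hk]
  exact mul_right_comm _ _ _

theorem psiPGL_mul_algebraMap (hd : 0 < d) (w : Eˣ) (j : ℕ) (k : Kˣ) :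
    psiPGL hσ x hx (constantBasis b)
      (monomialUnit K σ hd (w * Units.map (algebraMap K E).toMonoidHom k) j) =
      psiPGL hσ x hx (constantBasis b) (monomialUnit K σ hd w j) := by
  rw [mul_comm, monomialUnit_mul, map_mul, psiPGL_constUnit_algebraMap, one_mul]

/-- The lift of the Singer cycle of `PGL_d(K)` to `PGL_d(K((t)))`, conjugated by `g`. -/
def singerConj (g : Matrix.ProjGenLinGroup (Fin d) K⸨X⸩) :
    Eˣ →* Matrix.ProjGenLinGroup (Fin d) K⸨X⸩ :=
  (MulAut.conj g).toMonoidHom.comp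
    ((psiPGL hσ x hx (constantBasis b)).comp (AlgA.constUnit K σ d))

theorem singerConj_apply (g : Matrix.ProjGenLinGroup (Fin d) K⸨X⸩) (w : Eˣ) :
    singerConj hσ x hx b g w =
      g * psiPGL hσ x hx (constantBasis b) (AlgA.constUnit K σ d w) * g⁻¹ := rfl

theorem range_singerConj (g : Matrix.ProjGenLinGroup (Fin d) K⸨X⸩) :
    ((singer b).map (Matrix.ProjGenLinGroup.map (HahnSeries.C : K →+* K⸨X⸩))).map
      (MulAut.conj g).toMonoidHom = (singerConj hσ x hx b g).range := by
  ext s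
  constructor
  · rintro ⟨_, ⟨n, hn, rfl⟩, rfl⟩
    obtain ⟨w, rfl⟩ := (mem_singer_iff b).mp hn
    exact ⟨w, by rw [map_C_mk_singerHom hσ x hx]; rfl⟩
  · rintro ⟨w, rfl⟩
    refine ⟨_, ⟨_, (mem_singer_iff b).mpr ⟨w, rfl⟩, rfl⟩, ?_⟩
    rw [map_C_mk_singerHom hσ x hx]
    rfl

theorem ker_singerConj (hord : orderOf σ = d) (hd : 0 < d)
    (g : Matrix.ProjGenLinGroup (Fin d) K⸨X⸩) :
    (singerConj hσ x hx b g).ker = (Units.map (algebraMap K E).toMonoidHom).range := by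
  ext w
  rw [MonoidHom.mem_ker, singerConj_apply]
  constructor
  · intro h
    rw [mul_inv_eq_one, mul_eq_left] at h
    have h1 : psiPGL hσ x hx (constantBasis b) (monomialUnit K σ hd 1 0) =
        psiPGL hσ x hx (constantBasis b) (monomialUnit K σ hd w 0) := by
      rw [psiPGL_monomialUnit_zero, psiPGL_monomialUnit_zero, h, map_one, map_one]
    obtain ⟨-, k, hk⟩ := psiPGL_monomialUnit_inj hσ x hx b hord hd hd hd h1
    exact ⟨k, by rw [hk, one_mul]⟩
  · rintro ⟨k, rfl⟩
    rw [psiPGL_constUnit_algebraMap, mul_one, mul_inv_cancel]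

theorem card_range_singerConj (hord : orderOf σ = d) (hd : 0 < d)
    (g : Matrix.ProjGenLinGroup (Fin d) K⸨X⸩) :
    Nat.card (singerConj hσ x hx b g).range * Nat.card Kˣ = Nat.card Eˣ := by
  have hker : Nat.card (singerConj hσ x hx b g).ker = Nat.card Kˣ := by
    rw [ker_singerConj hσ x hx b hord hd]
    refine Nat.card_congr (MonoidHom.ofInjective ?_).symm.toEquiv
    exact Units.map_injective (algebraMap K E).injective
  rw [← hker, ← Subgroup.index_ker, mul_comm, Subgroup.card_mul_index]

variable {H : Subgroup (Matrix.ProjGenLinGroup (Fin d) K⸨X⸩)}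
  {g : Matrix.ProjGenLinGroup (Fin d) K⸨X⸩}

theorem range_singerConj_le (hd : 0 < d) (hH : ∀ h, h ∈ H ↔ ∃ j < d, ∃ w : Eˣ,
    h = g * psiPGL hσ x hx (constantBasis b) (monomialUnit K σ hd w j) * g⁻¹) :
    (singerConj hσ x hx b g).range ≤ H := by
  rintro _ ⟨w, rfl⟩
  refine (hH _).mpr ⟨0, hd, w, ?_⟩
  rw [psiPGL_monomialUnit_zero, singerConj_apply]

theorem normal_range_singerConj (hd : 0 < d) (hH : ∀ h, h ∈ H ↔ ∃ j < d, ∃ w : Eˣ,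
    h = g * psiPGL hσ x hx (constantBasis b) (monomialUnit K σ hd w j) * g⁻¹) :
    ((singerConj hσ x hx b g).range.subgroupOf H).Normal := by
  refine ⟨?_⟩
  rintro ⟨s, hs⟩ ⟨u, hu⟩ ⟨h, hh⟩
  obtain ⟨j, -, w, rfl⟩ := (hH h).mp hh
  rw [Subgroup.mem_subgroupOf]
  refine ⟨Units.map (σ ^ j).toRingHom.toMonoidHom u, ?_⟩
  have hu' : s = singerConj hσ x hx b g u := hu.symm
  have hc := congrArg (psiPGL hσ x hx (constantBasis b)) (monomialUnit_mul_constUnit hd w u j)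
  rw [map_mul, map_mul] at hc
  simp only [Subgroup.coe_mul, Subgroup.coe_inv]
  rw [hu', singerConj_apply, singerConj_apply, eq_mul_inv_of_mul_eq hc.symm]
  group

variable [Finite E]

/-- The stabiliser of a vertex is isomorphic to the normaliser of the Singer cycle, by reduction
modulo the uniformizer. -/
theorem nonempty_mulEquiv_normalizer (hord : orderOf σ = d) (hd : 0 < d)
    (hgen : ∀ τ : E ≃ₐ[K] E, τ ∈ Subgroup.zpowers σ)
    {Gv : Subgroup (Matrix.ProjGenLinGroup (Fin d) K⸨X⸩)} (hle : H ≤ Gv)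
    (e : Gv ≃* Matrix.ProjGenLinGroup (Fin d) (PowerSeries K))
    (he : ∀ h : Gv, Matrix.ProjGenLinGroup.map (algebraMap (PowerSeries K) K⸨X⸩) (e h) =
      g⁻¹ * h * g)
    (hH : ∀ h, h ∈ H ↔ ∃ j < d, ∃ w : Eˣ,
      h = g * psiPGL hσ x hx (constantBasis b) (monomialUnit K σ hd w j) * g⁻¹) :
    Nonempty (H ≃* Subgroup.normalizer (singer b : Set (Matrix.ProjGenLinGroup (Fin d) K))) := by
  let φ : H →* Matrix.ProjGenLinGroup (Fin d) K :=
    ((Matrix.ProjGenLinGroup.map (PowerSeries.constantCoeff (R := K))).comp e.toMonoidHom).comp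
      (Subgroup.inclusion hle)
  have hφ : ∀ (h : H) (j : ℕ) (w : Eˣ),
      (h : Matrix.ProjGenLinGroup (Fin d) K⸨X⸩) =
        g * psiPGL hσ x hx (constantBasis b) (monomialUnit K σ hd w j) * g⁻¹ →
      φ h = mk (semiGL b (w * twistUnit x hd hx j) (σ ^ j)) := by
    intro h j w hw
    obtain ⟨r, hr, hr'⟩ := exists_reduction_monomialUnit hσ x hx b hd w j
    have h1 : e (Subgroup.inclusion hle h) = r := by
      refine map_algebraMap_injective ?_
      rw [he, hr, Subgroup.coe_inclusion, hw]
      group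
    rw [← hr', ← h1]
    rfl
  have hinj : Function.Injective φ := by
    rw [injective_iff_map_eq_one]
    intro h h1
    obtain ⟨j, hj, w, hw⟩ := (hH h).mp h.2
    rw [hφ h j w hw, ← Matrix.ProjGenLinGroup.mk_one, ← semiGL_one_one b] at h1
    obtain ⟨h2, k, hk⟩ := mk_semiGL_eq b h1.symm
    obtain rfl : 0 = j := pow_injOn_Iio_orderOf (by simpa [hord]) (by simpa [hord])
      ((pow_zero σ).trans h2)
    have h3 : twistUnit x hd hx 0 = 1 := Units.ext (by simp [twistUnit, twist])
    rw [h3, mul_one, one_mul] at hk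
    refine Subtype.ext (hw.trans ?_)
    rw [psiPGL_monomialUnit_zero, hk, psiPGL_constUnit_algebraMap, mul_one, mul_inv_cancel]
    rfl
  have hrange : φ.range =
      Subgroup.normalizer (singer b : Set (Matrix.ProjGenLinGroup (Fin d) K)) := by
    ext n
    rw [mem_normalizer_singer_iff]
    constructor
    · rintro ⟨h, rfl⟩
      obtain ⟨j, hj, w, hw⟩ := (hH h).mp h.2
      exact ⟨_, _, hφ h j w hw⟩
    · rintro ⟨w, τ, rfl⟩
      obtain ⟨j, hj, rfl⟩ := exists_pow_eq σ hord hd hgen τ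
      -- The inverse compensates the constant term of the partial norm that appears when `t ^ j` is
      -- reduced modulo `Y`.
      refine ⟨⟨_, (hH _).mpr ⟨j, hj, w * (twistUnit x hd hx j)⁻¹, rfl⟩⟩, ?_⟩
      rw [hφ _ j (w * (twistUnit x hd hx j)⁻¹) rfl, inv_mul_cancel_right]
  exact ⟨(MonoidHom.ofInjective hinj).trans (MulEquiv.subgroupCongr hrange)⟩

theorem card_fin_dvd {m : ℕ} (hm : 0 < m) (hmd : m ∣ d) :
    Nat.card {j : Fin d // m ∣ (j : ℕ)} = d / m := by
  obtain ⟨n, rfl⟩ := hmd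
  rw [Nat.mul_div_cancel_left _ hm]
  refine (Nat.card_congr (Equiv.ofBijective (fun i : Fin n =>
    (⟨⟨m * i, Nat.mul_lt_mul_of_pos_left i.2 hm⟩, dvd_mul_right m i⟩ :
      {j : Fin (m * n) // m ∣ (j : ℕ)})) ⟨fun i i' h => ?_, ?_⟩)).symm.trans (by simp)
  · have : m * (i : ℕ) = m * i' := congrArg (fun z => ((z.1 : Fin (m * n)) : ℕ)) h
    exact Fin.ext (Nat.eq_of_mul_eq_mul_left hm this)
  · rintro ⟨⟨j, hj⟩, i, hi⟩
    dsimp only at hi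
    subst hi
    exact ⟨⟨i, Nat.lt_of_mul_lt_mul_left hj⟩, rfl⟩

/-- The number of units of `E` whose norm is a `d`-th power. -/
theorem card_norm_pow (d : ℕ) :
    Nat.card ((powMonoidHom d : Kˣ →* Kˣ).range.comap (Units.map (Algebra.norm K (S := E)))) *
      (Nat.card Kˣ).gcd d = Nat.card Eˣ := by
  have : Finite K := Finite.of_injective _ (algebraMap K E).injective
  rw [← IsCyclic.index_powMonoidHom_range,
    ← Subgroup.index_comap_of_surjective _ (FiniteField.unitsMap_norm_surjective K E),
    Subgroup.card_mul_index]

/-- The order of the intersection of the stabiliser of a vertex with the projective special linear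
group. -/
theorem card_inf_range_toPGL (p : ℕ) (hp : p.Prime) [CharP K p] (hord : orderOf σ = d) (hd : 0 < d)
    (hH : ∀ h, h ∈ H ↔ ∃ j < d, ∃ w : Eˣ,
      h = g * psiPGL hσ x hx (constantBasis b) (monomialUnit K σ hd w j) * g⁻¹) :
    Nat.card (H ⊓ (Matrix.ProjectiveSpecialLinearGroup.toPGL
      (n := Fin d) (R := K⸨X⸩)).range : Subgroup _) * Nat.card Kˣ * (Nat.card Kˣ).gcd d =
        d / p ^ padicValNat p d * Nat.card Eˣ := by
  have : Finite K := Finite.of_injective _ (algebraMap K E).injective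
  have : Fact p.Prime := ⟨hp⟩
  obtain ⟨ε, hε⟩ := exists_psiPGL_monomialUnit_mem_range_iff hσ x hx b p hp hd
  set N := Units.map (Algebra.norm K (S := E)) with hN
  set P := (powMonoidHom d : Kˣ →* Kˣ).range.comap N with hP
  -- The pairs `(w, j)` whose class lies in `PSL`. This set is counted in two ways: over the group
  -- elements and over the exponents `j`.
  let A := {z : Eˣ × Fin d // p ^ padicValNat p d ∣ (z.2 : ℕ) ∧ ∃ k : Kˣ, k ^ d = N z.1 * ε ^ (z.2 : ℕ)}
  set Y := (H ⊓ (Matrix.ProjectiveSpecialLinearGroup.toPGL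
      (n := Fin d) (R := K⸨X⸩)).range : Subgroup _) with hY
  have hnormal : ∀ z, g * z * g⁻¹ ∈ (Matrix.ProjectiveSpecialLinearGroup.toPGL
      (n := Fin d) (R := K⸨X⸩)).range ↔ z ∈ (Matrix.ProjectiveSpecialLinearGroup.toPGL
      (n := Fin d) (R := K⸨X⸩)).range := by
    have key : ∀ g z, z ∈ (Matrix.ProjectiveSpecialLinearGroup.toPGL
      (n := Fin d) (R := K⸨X⸩)).range → g * z * g⁻¹ ∈ (Matrix.ProjectiveSpecialLinearGroup.toPGL
      (n := Fin d) (R := K⸨X⸩)).range := by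
      intro g z hz
      induction g using Matrix.ProjGenLinGroup.induction_on with
      | mk g =>
        induction z using Matrix.ProjGenLinGroup.induction_on with
        | mk z =>
          rw [mem_range_toPGL_iff hd] at hz
          rw [← map_inv, ← map_mul, ← map_mul, mem_range_toPGL_iff hd]
          obtain ⟨c, hc⟩ := hz
          refine ⟨c, ?_⟩
          rw [hc, Units.val_mul, Units.val_mul, Matrix.det_units_conj]
    refine fun z => ⟨fun h => ?_, key g z⟩
    have := key g⁻¹ _ h
    convert this using 1
    group
  -- Each class has exactly `|Kˣ|` representatives `w t ^ j` with `j < d`. Rescaling `w` by `k ∈ Kˣ`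
  -- stays in `A` because `N(k) = k ^ d`.
  have hYA : Nat.card Y * Nat.card Kˣ = Nat.card A := by
    have hsec : ∀ y : Y, ∃ a : A, (y : Matrix.ProjGenLinGroup (Fin d) K⸨X⸩) =
        g * psiPGL hσ x hx (constantBasis b) (monomialUnit K σ hd a.1.1 (a.1.2 : ℕ)) * g⁻¹ := by
      rintro ⟨y, hyH, hyS⟩
      obtain ⟨j, hj, w, rfl⟩ := (hH y).mp hyH
      exact ⟨⟨(w, ⟨j, hj⟩), (hε w j).mp ((hnormal _).mp hyS)⟩, rfl⟩
    choose s hs using hsec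
    have hNk : ∀ k : Kˣ, N (Units.map (algebraMap K E).toMonoidHom k) = k ^ d := by
      intro k
      refine Units.ext ?_
      have hfr : Module.finrank K E = d := by
        rw [Module.finrank_eq_card_basis b, Fintype.card_fin]
      have := Algebra.norm_algebraMap (S := E) (k : K)
      rw [hfr] at this
      exact this
    rw [← Nat.card_prod]
    refine Nat.card_congr (Equiv.ofBijective (fun yk : Y × Kˣ => (⟨((s yk.1).1.1 *
      Units.map (algebraMap K E).toMonoidHom yk.2, (s yk.1).1.2), (s yk.1).2.1, by
        obtain ⟨k, hk⟩ := (s yk.1).2.2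
        refine ⟨k * yk.2, ?_⟩
        dsimp only
        rw [mul_pow, hk, map_mul, hNk]
        exact mul_right_comm _ _ _⟩ : A)) ⟨?_, ?_⟩)
    · rintro ⟨y, k⟩ ⟨y', k'⟩ h
      have h1 := congrArg (fun a : A => a.1.1) h
      have h2 := congrArg (fun a : A => a.1.2) h
      dsimp only at h1 h2
      have hyy : y = y' := by
        refine Subtype.ext ?_
        rw [hs y, hs y', ← psiPGL_mul_algebraMap hσ x hx b hd (s y).1.1 _ k, h1, h2,
          psiPGL_mul_algebraMap]
      subst hyy
      rw [Units.map_injective (algebraMap K E).injective (mul_left_cancel h1)]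
    · rintro ⟨⟨w, j⟩, hj, hk⟩
      let y : Y := ⟨g * psiPGL hσ x hx (constantBasis b) (monomialUnit K σ hd w j) * g⁻¹,
        (hH _).mpr ⟨j, j.2, w, rfl⟩, (hnormal _).mpr ((hε w j).mpr ⟨hj, hk⟩)⟩
      have h1 := mul_left_cancel (mul_right_cancel (hs y))
      obtain ⟨h2, k, h3⟩ := psiPGL_monomialUnit_inj hσ x hx b hord hd j.2 (s y).1.2.2 h1
      refine ⟨⟨y, k⁻¹⟩, Subtype.ext (Prod.ext ?_ (Fin.ext h2.symm))⟩
      dsimp only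
      rw [h3, map_inv, mul_inv_cancel_right]
  -- For each admissible `j` the possible `w` form a coset of `P`: the norm is onto, so some `v j`
  -- has norm `ε ^ (-j)`.
  have hAP : Nat.card A = d / p ^ padicValNat p d * Nat.card P := by
    rw [← card_fin_dvd (pow_pos hp.pos _) (pow_padicValNat_dvd (p := p)), ← Nat.card_prod]
    choose v hv using fun j : ℕ => FiniteField.unitsMap_norm_surjective K E (ε ^ j)⁻¹
    have hv' : ∀ j, N (v j) * ε ^ j = 1 := fun j => by
      rw [hN, hv, inv_mul_cancel]
    refine (Nat.card_congr (Equiv.ofBijective (fun jw : {j : Fin d //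
      p ^ padicValNat p d ∣ (j : ℕ)} × P => (⟨((jw.2 : Eˣ) * v jw.1.1, jw.1.1), jw.1.2, by
        obtain ⟨k, hk⟩ := jw.2.2
        refine ⟨k, ?_⟩
        dsimp only
        rw [map_mul, mul_assoc, hv', mul_one]
        exact hk⟩ : A)) ⟨?_, ?_⟩)).symm
    · rintro ⟨⟨j, hj⟩, w⟩ ⟨⟨j', hj'⟩, w'⟩ h
      have h1 := congrArg (fun a : A => a.1.1) h
      have h2 : j = j' := congrArg (fun a : A => a.1.2) h
      subst h2
      dsimp only at h1
      rw [Subtype.ext (mul_right_cancel h1)]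
    · rintro ⟨⟨w, j⟩, hj, k, hk⟩
      refine ⟨⟨⟨j, hj⟩, ⟨w * (v j)⁻¹, k, ?_⟩⟩, Subtype.ext (Prod.ext ?_ rfl)⟩
      · rw [map_mul, map_inv, eq_inv_of_mul_eq_one_left (hv' j), inv_inv]
        exact hk
      · dsimp only
        rw [inv_mul_cancel_right]
  rw [hYA, hAP, mul_assoc, hP, hN, card_norm_pow]

end Stabilizers

/-! ### Stabilisers of arbitrary vertices. -/

section Gamma

variable {K E : Type*} [Field K] [Field E] [Finite E] [Algebra K E] {σ : E ≃ₐ[K] E} {d : ℕ}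
  (hσ : σ ^ d = 1) (x : E⸨X⸩) (hx : laurentNorm σ d x = 1 + HahnSeries.single 1 1)
  (b : Module.Basis (Fin d) K E)

/-- Every vertex stabiliser in `Γ̃` is conjugate to the group of classes of the monomials
`w * t ^ j`, by an element moving the standard vertex to the given one. -/
theorem exists_mem_gamma_inf_stabilizer_iff (hord : orderOf σ = d) (hd : 2 ≤ d)
    (hgen : ∀ τ : E ≃ₐ[K] E, τ ∈ Subgroup.zpowers σ)
    (β : Module.Basis (Fin d) K⸨X⸩ E⸨X⸩) (v : Vertex d K) :
    ∃ g : Matrix.ProjGenLinGroup (Fin d) K⸨X⸩, g • stdVertex d K = v ∧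
      ∀ h, h ∈ gamma hσ x hx β ⊓ MulAction.stabilizer (Matrix.ProjGenLinGroup (Fin d) K⸨X⸩) v ↔
        ∃ j < d, ∃ w : Eˣ, h = g * psiPGL hσ x hx (constantBasis b)
          (monomialUnit K σ (Nat.zero_lt_of_lt hd) w j) * g⁻¹ := by
  have hd0 : 0 < d := Nat.zero_lt_of_lt hd
  obtain ⟨P, hP⟩ := exists_conj_psiPGL hσ x hx β (constantBasis b)
  -- `P` changes the given basis to a constant one. Writing `T = Ψ(y) R` with `R` fixing `v₀`, the
  -- element `g = P Ψ(y)` takes `v₀` to `v`, and conjugation by `y` carries the stabiliser of `v₀`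
  -- to that of `v`.
  obtain ⟨T, hT⟩ := exists_smul_stdVertex (P⁻¹ • v)
  obtain ⟨y, hy, R, hR, rfl⟩ := exists_eq_psiGL_mul hσ x hx b hord hd0 hgen T
  have hfix : ∀ A ∈ intGL d K, A • stdVertex d K = stdVertex d K := fun A hA =>
    smul_stdVertex_iff.mpr ⟨1, by rwa [map_one, one_mul]⟩
  rw [mul_smul, hfix R hR, ← mk_smul_vertex, ← psiPGL_apply] at hT
  have hg : (P * psiPGL hσ x hx (constantBasis b) y) • stdVertex d K = v := by
    rw [mul_smul, hT, smul_inv_smul]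
  refine ⟨_, hg, fun h => ⟨?_, ?_⟩⟩
  · rintro ⟨⟨z, hz, rfl⟩, hv⟩
    have hv : psiPGL hσ x hx β z • v = v := hv
    have hz' : y⁻¹ * z * y ∈ AlgA.conjStab K σ d := mul_mem (mul_mem (inv_mem hy) hz) hy
    have hψ : psiPGL hσ x hx (constantBasis b) (y⁻¹ * z * y) =
        (P * psiPGL hσ x hx (constantBasis b) y)⁻¹ * psiPGL hσ x hx β z *
          (P * psiPGL hσ x hx (constantBasis b) y) := by
      rw [hP, map_mul, map_mul, map_inv]
      group
    obtain ⟨j, hj, w, hw⟩ := exists_eq_monomialUnit hσ x hx b hord hd hgen (y⁻¹ * z * y)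
      (fun a ha => (hz' a ha).1) (by
        rw [hψ, mul_smul, mul_smul, hg, hv, ← hg, inv_smul_smul])
    refine ⟨j, hj, w, ?_⟩
    rw [← hw, hψ]
    group
  · rintro ⟨j, -, w, rfl⟩
    constructor
    · refine ⟨y * monomialUnit K σ hd0 w j * y⁻¹,
        mul_mem (mul_mem hy (monomialUnit_mem hd0 w j)) (inv_mem hy), ?_⟩
      rw [hP, map_mul, map_mul, map_inv]
      group
    · change (_ * _ * _) • v = v
      rw [mul_smul, ← hg, inv_smul_smul, mul_smul, psiPGL_apply _ _ _ _ (monomialUnit ..),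
        mk_smul_vertex, hfix _ (psiGL_monomialUnit_mem hσ x hx b hd0 w j)]

end Gamma

end CartwrightSteger

end

/-! ### The theorem. -/

theorem lemma8 {K E : Type*} [Field K] [Field E] [Finite E] [Algebra K E]
    (p q d : ℕ) (hp : p.Prime) [CharP K p] (hq : Nat.card K = q)
    (hd : Module.finrank K E = d) (hd2 : 2 ≤ d)
    (σ : E ≃ₐ[K] E) (hσ : ∀ τ : E ≃ₐ[K] E, τ ∈ Subgroup.zpowers σ)
    (x : E⸨X⸩) (hx : CartwrightSteger.laurentNorm σ d x = 1 + HahnSeries.single 1 1)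
    (β : Module.Basis (Fin d) K⸨X⸩ E⸨X⸩) :
    ∃ Γ : Subgroup (Matrix.ProjGenLinGroup (Fin d) K⸨X⸩),
      (Γ : Set (Matrix.ProjGenLinGroup (Fin d) K⸨X⸩)) =
        CartwrightSteger.gammaTilde σ d (CartwrightSteger.pow_eq_one_of_finrank σ d hd) x hx β ∧
      ∀ v : CartwrightSteger.Vertex d K,
        ∃ H Gv : Subgroup (Matrix.ProjGenLinGroup (Fin d) K⸨X⸩),
          Gv = MulAction.stabilizer (Matrix.ProjGenLinGroup (Fin d) K⸨X⸩) v ∧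
          H = Γ ⊓ Gv ∧
          ∃ g : Matrix.ProjGenLinGroup (Fin d) K⸨X⸩,
            g • CartwrightSteger.stdVertex d K = v ∧
            (H ≤ Gv ∧ ∃ e : Gv ≃* Matrix.ProjGenLinGroup (Fin d) (PowerSeries K),
              ∀ h : Gv, Matrix.ProjGenLinGroup.map (algebraMap (PowerSeries K) K⸨X⸩) (e h) =
                g⁻¹ * h * g) ∧
            (∃ S₀ : Subgroup (Matrix.ProjGenLinGroup (Fin d) K),
              ∃ S : Subgroup (Matrix.ProjGenLinGroup (Fin d) K⸨X⸩),
                CartwrightSteger.IsSingerPGL S₀ ∧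
                S = (S₀.map (Matrix.ProjGenLinGroup.map (HahnSeries.C : K →+* K⸨X⸩))).map
                  (MulAut.conj g).toMonoidHom ∧
                S ≤ H ∧ (S.subgroupOf H).Normal ∧ IsCyclic S ∧
                (Nat.card S : ℚ) = ((q : ℚ) ^ d - 1) / ((q : ℚ) - 1) ∧
                Nonempty (H ≃* Subgroup.normalizer (S₀ : Set (Matrix.ProjGenLinGroup (Fin d) K)))) ∧
            (Nat.card (H ⊓ (Matrix.ProjectiveSpecialLinearGroup.toPGL
                (n := Fin d) (R := K⸨X⸩)).range : Subgroup _) : ℚ) =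
              (d : ℚ) / (p : ℚ) ^ padicValNat p d *
                (((q : ℚ) ^ d - 1) / (((q : ℚ) - 1) * (Nat.gcd d (q - 1) : ℚ))) := by
  have : Finite K := Finite.of_injective _ (algebraMap K E).injective
  have : FiniteDimensional K E := Module.Finite.of_finite
  have hd0 : 0 < d := Nat.zero_lt_of_lt hd2
  have hσd := CartwrightSteger.pow_eq_one_of_finrank σ d hd
  have hord := CartwrightSteger.orderOf_eq_finrank σ hd hσ
  let b : Module.Basis (Fin d) K E := (Module.finBasis K E).reindex (finCongr hd)
  have hq1 : 1 < q := hq ▸ Finite.one_lt_card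
  have hKu : Nat.card Kˣ = q - 1 := by rw [Nat.card_units, hq]
  have hEu : Nat.card Eˣ = q ^ d - 1 := by
    rw [Nat.card_units, Module.natCard_eq_pow_finrank (K := K) (V := E), hq, hd]
  have hq0 : (q : ℚ) - 1 ≠ 0 := sub_ne_zero.mpr (by exact_mod_cast hq1.ne')
  have hcast : ((q - 1 : ℕ) : ℚ) = q - 1 := by rw [Nat.cast_sub hq1.le, Nat.cast_one]
  have hcast' : ((q ^ d - 1 : ℕ) : ℚ) = (q : ℚ) ^ d - 1 := by
    rw [Nat.cast_sub (Nat.one_le_pow _ _ (Nat.zero_lt_of_lt hq1)), Nat.cast_one, Nat.cast_pow]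
  refine ⟨CartwrightSteger.gamma hσd x hx β, CartwrightSteger.coe_gamma hσd x hx hord hd2 hσ β,
    fun v => ?_⟩
  -- The description of `H` as the `g`-conjugate of the classes of `w t ^ j` feeds the remaining
  -- claims. The two orders follow from counting identities in natural numbers, which are then
  -- divided out over `ℚ`.
  obtain ⟨g, hg, hH⟩ :=
    CartwrightSteger.exists_mem_gamma_inf_stabilizer_iff hσd x hx b hord hd2 hσ β v
  obtain ⟨e, he⟩ := CartwrightSteger.exists_stabilizer_mulEquiv g hg
  refine ⟨_, _, rfl, rfl, g, hg, ⟨inf_le_right, e, he⟩,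
    ⟨CartwrightSteger.singer b, _, CartwrightSteger.isSingerPGL_singer b, rfl, ?_⟩, ?_⟩
  · rw [CartwrightSteger.range_singerConj hσd x hx b g]
    refine ⟨CartwrightSteger.range_singerConj_le hσd x hx b hd0 hH,
      CartwrightSteger.normal_range_singerConj hσd x hx b hd0 hH,
      isCyclic_of_surjective _ (MonoidHom.rangeRestrict_surjective _), ?_,
      CartwrightSteger.nonempty_mulEquiv_normalizer hσd x hx b hord hd0 hσ inf_le_right e he hH⟩
    have h := CartwrightSteger.card_range_singerConj hσd x hx b hord hd0 g
    rw [hKu, hEu] at h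
    rw [eq_div_iff hq0, ← hcast, ← hcast', ← Nat.cast_mul, h]
  · have h := CartwrightSteger.card_inf_range_toPGL hσd x hx b p hp hord hd0 hH
    rw [hKu, hEu, Nat.gcd_comm] at h
    have hgcd : (Nat.gcd d (q - 1) : ℚ) ≠ 0 :=
      Nat.cast_ne_zero.mpr (Nat.gcd_pos_of_pos_left _ hd0).ne'
    have hp0 : ((p ^ padicValNat p d : ℕ) : ℚ) ≠ 0 :=
      Nat.cast_ne_zero.mpr (pow_pos hp.pos _).ne'
    rw [← mul_div_assoc, eq_div_iff (mul_ne_zero hq0 hgcd), ← mul_assoc, ← hcast, ← hcast',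
      ← Nat.cast_pow, ← Nat.cast_div pow_padicValNat_dvd hp0]
    exact_mod_cast h
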